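/- Work over $\mathbb{C}$. Let $\mathfrak{g}=\mathfrak{so}_8$ with Chevalley generators $e_{\alpha_i},f_{\alpha_i}$ ($1\le i\le 4$), where $\alpha_2$ is the simple root at the central node of the Dynkin diagram $D_4$. Then there is exactly one linear action of the symmetric group $\mathfrak{S}_4$ on $\mathfrak{g}$ by Lie algebra automorphisms such that $(1\;2)$ acts by the graph automorphism $\gamma_{13}$ (interchanging the Chevalley generators for $\alpha_1$ and $\alpha_3$ and fixing those for $\alpha_2,\alpha_4$), $(2\;3)$ acts by the graph automorphism $\gamma_{34}$ (interchanging those for $\alpha_3$ and $\alpha_4$ and fixing those for $\alpha_1,\alpha_2$), and $(3\;4)$ acts by $\gamma_{13}\circ\mathrm{Ad}\bigl(\alpha_1^\vee(\sqrt{-1})\,\alpha_3^\vee(-\sqrt{-1})\bigr)$. Let $\mathcal{O}_{\min}\subset\mathfrak{g}$ be the minimal nilpotent orbit, that is, the adjoint orbit of a highest root vector, and $\overline{\mathcal{O}_{\min}}$ its Zariski closure. Then $\overline{\mathcal{O}_{\min}}$ is stable under the above action of $\mathfrak{S}_4$, and the quotient variety $\overline{\mathcal{O}_{\min}}/\mathfrak{S}_4=\mathrm{Spec}\bigl(\mathbb{C}[\overline{\mathcal{O}_{\min}}]^{\mathfrak{S}_4}\bigr)$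 is isomorphic, as a variety over $\mathbb{C}$, to the Zariski closure of the image of the morphism $\psi:\mathrm{SL}_3\times\mathfrak{z}(\mathfrak{l})\to\mathfrak{sl}_3\oplus S^2V\oplus S^2V^*$, $$(g,z)\mapsto\Bigl(g\Delta(z)g^{-1},\ \sum_{i}(\lambda_i-\lambda_{i+1})^2\,gv_i\otimes gv_i,\ \sum_{i}(\lambda_i-\lambda_{i-1})^2\,\chi_ig^{-1}\otimes\chi_ig^{-1}\Bigr),$$ where $\mathfrak{z}(\mathfrak{l})$ denotes the space of triples $z=(\lambda_1,\lambda_2,\lambda_3)\in\mathbb{C}^3$ with $\lambda_1+\lambda_2+\lambda_3=0$, $\Delta(z)=\mathrm{diag}(\lambda_1,\lambda_2,\lambda_3)$, $V=\mathbb{C}^3$ is the natural representation of $\mathrm{SL}_3$ with standard basis $v_1,v_2,v_3$ and dual basis $\chi_1,\chi_2,\chi_3$ of $V^*$, the symmetric squares $S^2V$ and $S^2V^*$ are realised as spaces of symmetric tensors, and the indices $i\in\mathbb{Z}/3$ are cyclic. -/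

import Mathlib

open scoped Matrix TensorProduct

noncomputable section

namespace D4ModS4

attribute [local instance 100] LieRing.ofAssociativeRing

/-! ### Affine varieties over `ℂ` -/

section Varieties

variable {E : Type} [AddCommGroup E] [Module ℂ E]

variable (E) in
/-- The algebra of polynomial functions on a vector space: the algebra of functions generated by
the linear forms. -/
def polyFun : Subalgebra ℂ (E → ℂ) :=
  Algebra.adjoin ℂ (Set.range fun φ : Module.Dual ℂ E => (φ : E → ℂ))

/-- The Zariski closure of a set `S`: the common zeros of all polynomial functions that vanish
on `S`. -/
def zariskiClosure (S : Set E) : Set E :=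
  {x | ∀ f ∈ polyFun E, (∀ y ∈ S, f y = 0) → f x = 0}

/-- Restriction of functions from `E` to `X`. -/
def restrictFun (X : Set E) : (E → ℂ) →ₐ[ℂ] (X → ℂ) where
  toFun f := fun x => f x
  map_one' := rfl
  map_mul' _ _ := rfl
  map_zero' := rfl
  map_add' _ _ := rfl
  commutes' _ := rfl

/-- The coordinate ring `ℂ[X]` of a Zariski closed subset `X` of `E` (with its reduced structure):
the algebra of restrictions to `X` of polynomial functions. -/
def coordRing (X : Set E) : Subalgebra ℂ (X → ℂ) :=
  (polyFun E).map (restrictFun X)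

/-- `X` is stable under the linear action `ρ`. -/
def IsStable {Γ : Type} [Monoid Γ] (ρ : Representation ℂ Γ E) (X : Set E) : Prop :=
  ∀ γ : Γ, ∀ x ∈ X, ρ γ x ∈ X

/-- The algebra of invariants `ℂ[X]^Γ` of a `Γ`-stable closed subset `X`. -/
def invariantRing {Γ : Type} [Monoid Γ] (ρ : Representation ℂ Γ E) (X : Set E)
    (hX : IsStable ρ X) : Subalgebra ℂ (X → ℂ) where
  carrier := {f | f ∈ coordRing X ∧ ∀ (γ : Γ) (x : X), f ⟨ρ γ x, hX γ x x.2⟩ = f x}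
  mul_mem' := fun ha hb =>
    ⟨mul_mem ha.1 hb.1, fun γ x => by simp only [Pi.mul_apply, ha.2 γ x, hb.2 γ x]⟩
  add_mem' := fun ha hb =>
    ⟨add_mem ha.1 hb.1, fun γ x => by simp only [Pi.add_apply, ha.2 γ x, hb.2 γ x]⟩
  algebraMap_mem' := fun r => ⟨(coordRing X).algebraMap_mem r, fun _ _ => rfl⟩

/-- `Spec A → Spec ℂ`, as a scheme over `ℂ`. -/
def specOver (A : Type) [CommRing A] [Algebra ℂ A] :
    CategoryTheory.Over (AlgebraicGeometry.Spec (CommRingCat.of ℂ)) :=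
  CategoryTheory.Over.mk
    (AlgebraicGeometry.Spec.map (CommRingCat.ofHom (algebraMap ℂ A)))

/-- The affine variety over `ℂ` given by a Zariski closed subset `X` of a vector space. -/
def variety (X : Set E) : CategoryTheory.Over (AlgebraicGeometry.Spec (CommRingCat.of ℂ)) :=
  specOver (coordRing X)

/-- The quotient variety `X / Γ = Spec (ℂ[X]^Γ)`. -/
def quotientVariety {Γ : Type} [Monoid Γ] (ρ : Representation ℂ Γ E) (X : Set E)
    (hX : IsStable ρ X) : CategoryTheory.Over (AlgebraicGeometry.Spec (CommRingCat.of ℂ)) :=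
  specOver (invariantRing ρ X hX)

end Varieties

/-! ### The Lie algebra `so₈`, its adjoint action and its minimal nilpotent orbit -/

/-- `so₈` in split form: the `8 × 8` matrices that are skew-adjoint for the symmetric bilinear form
with Gram matrix `(0 1; 1 0)`. With respect to the maximal torus of diagonal matrices
`diag(a₁, …, a₄, a₁⁻¹, …, a₄⁻¹)` and the coordinate characters `ε₁, …, ε₄`, the roots are
`±εᵢ ± εⱼ`, and the simple roots are
`α₁ = ε₁ - ε₂`, `α₂ = ε₂ - ε₃`, `α₃ = ε₃ - ε₄`, `α₄ = ε₃ + ε₄` (so `α₂` is the central node). -/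
abbrev so8 : LieSubalgebra ℂ (Matrix (Fin 4 ⊕ Fin 4) (Fin 4 ⊕ Fin 4) ℂ) :=
  LieAlgebra.Orthogonal.typeD (Fin 4) ℂ

theorem mem_so8 (X : Matrix (Fin 4 ⊕ Fin 4) (Fin 4 ⊕ Fin 4) ℂ) :
    X ∈ so8 ↔ Xᵀ * LieAlgebra.Orthogonal.JD (Fin 4) ℂ =
      LieAlgebra.Orthogonal.JD (Fin 4) ℂ * -X := by
  simp only [so8, LieAlgebra.Orthogonal.typeD, mem_skewAdjointMatricesLieSubalgebra,
    mem_skewAdjointMatricesSubmodule, Matrix.IsSkewAdjoint, Matrix.IsAdjointPair]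

theorem fromBlocks_mem_so8 (A B C : Matrix (Fin 4) (Fin 4) ℂ) (hB : Bᵀ = -B) (hC : Cᵀ = -C) :
    Matrix.fromBlocks A B C (-Aᵀ) ∈ so8 := by
  rw [mem_so8]
  simp [LieAlgebra.Orthogonal.JD, Matrix.fromBlocks_transpose, Matrix.fromBlocks_multiply,
    Matrix.fromBlocks_neg, hB, hC]

/-- A root vector for the root `εᵢ - εⱼ`. -/
def rootMinus (i j : Fin 4) : so8 :=
  ⟨Matrix.fromBlocks (Matrix.single i j 1) 0 0 (-(Matrix.single i j 1)ᵀ),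
    fromBlocks_mem_so8 _ _ _ (by simp) (by simp)⟩

/-- A root vector for the root `εᵢ + εⱼ`. -/
def rootPlus (i j : Fin 4) : so8 :=
  ⟨Matrix.fromBlocks 0 (Matrix.single i j 1 - Matrix.single j i 1) 0 (-0ᵀ),
    fromBlocks_mem_so8 _ _ _ (by simp) (by simp)⟩

/-- A root vector for the root `-εᵢ - εⱼ`. -/
def rootNeg (i j : Fin 4) : so8 :=
  ⟨Matrix.fromBlocks 0 0 (Matrix.single j i 1 - Matrix.single i j 1) (-0ᵀ),
    fromBlocks_mem_so8 _ _ _ (by simp) (by simp)⟩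

/-- The Chevalley generators `e_{α₁}, …, e_{α₄}`; the index `i : Fin 4` stands for the simple root
`α_{i+1}`. -/
def chevE : Fin 4 → so8 := ![rootMinus 0 1, rootMinus 1 2, rootMinus 2 3, rootPlus 2 3]

/-- The Chevalley generators `f_{α₁}, …, f_{α₄}`. -/
def chevF : Fin 4 → so8 := ![rootMinus 1 0, rootMinus 2 1, rootMinus 3 2, rootNeg 2 3]

/-- The group `SO₈(ℂ)` of the same bilinear form. -/
def SO8 : Subgroup (Matrix.SpecialLinearGroup (Fin 4 ⊕ Fin 4) ℂ) where
  carrier := {g | (g : Matrix (Fin 4 ⊕ Fin 4) (Fin 4 ⊕ Fin 4) ℂ)ᵀ *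
    LieAlgebra.Orthogonal.JD (Fin 4) ℂ * (g : Matrix (Fin 4 ⊕ Fin 4) (Fin 4 ⊕ Fin 4) ℂ) =
      LieAlgebra.Orthogonal.JD (Fin 4) ℂ}
  one_mem' := by simp
  mul_mem' := by
    intro a b ha hb
    simp only [Set.mem_ofPred_eq, Matrix.SpecialLinearGroup.coe_mul, Matrix.transpose_mul] at *
    calc _ = (b : Matrix (Fin 4 ⊕ Fin 4) (Fin 4 ⊕ Fin 4) ℂ)ᵀ *
          ((a : Matrix (Fin 4 ⊕ Fin 4) (Fin 4 ⊕ Fin 4) ℂ)ᵀ *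
          LieAlgebra.Orthogonal.JD (Fin 4) ℂ *
          (a : Matrix (Fin 4 ⊕ Fin 4) (Fin 4 ⊕ Fin 4) ℂ)) *
          (b : Matrix (Fin 4 ⊕ Fin 4) (Fin 4 ⊕ Fin 4) ℂ) := by
            simp only [Matrix.mul_assoc]
      _ = _ := by rw [ha, hb]
  inv_mem' := by
    intro a ha
    simp only [Set.mem_ofPred_eq] at *
    have h : (a : Matrix (Fin 4 ⊕ Fin 4) (Fin 4 ⊕ Fin 4) ℂ) *
        ((a⁻¹ : Matrix.SpecialLinearGroup (Fin 4 ⊕ Fin 4) ℂ) :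
          Matrix (Fin 4 ⊕ Fin 4) (Fin 4 ⊕ Fin 4) ℂ) = 1 := by
      rw [← Matrix.SpecialLinearGroup.coe_mul, mul_inv_cancel, Matrix.SpecialLinearGroup.coe_one]
    generalize ((a⁻¹ : Matrix.SpecialLinearGroup (Fin 4 ⊕ Fin 4) ℂ) :
          Matrix (Fin 4 ⊕ Fin 4) (Fin 4 ⊕ Fin 4) ℂ) = b at h
    calc _ = bᵀ * ((a : Matrix (Fin 4 ⊕ Fin 4) (Fin 4 ⊕ Fin 4) ℂ)ᵀ *
          LieAlgebra.Orthogonal.JD (Fin 4) ℂ *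
          (a : Matrix (Fin 4 ⊕ Fin 4) (Fin 4 ⊕ Fin 4) ℂ)) * b := by rw [ha]
      _ = ((a : Matrix (Fin 4 ⊕ Fin 4) (Fin 4 ⊕ Fin 4) ℂ) * b)ᵀ *
          LieAlgebra.Orthogonal.JD (Fin 4) ℂ *
          ((a : Matrix (Fin 4 ⊕ Fin 4) (Fin 4 ⊕ Fin 4) ℂ) * b) := by
            simp only [Matrix.transpose_mul, Matrix.mul_assoc]
      _ = _ := by rw [h]; simp

/-- The adjoint action `X ↦ g X g⁻¹` of `SO₈` on `so₈`. -/
def Ad (g : SO8) (X : so8) : so8 :=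
  ⟨(g : Matrix.SpecialLinearGroup (Fin 4 ⊕ Fin 4) ℂ).1 *
      (X : Matrix (Fin 4 ⊕ Fin 4) (Fin 4 ⊕ Fin 4) ℂ) *
      ((g⁻¹ : SO8) : Matrix.SpecialLinearGroup (Fin 4 ⊕ Fin 4) ℂ).1, by
    have hX := (mem_so8 _).1 X.2
    have hg : ((g : Matrix.SpecialLinearGroup (Fin 4 ⊕ Fin 4) ℂ).1)ᵀ *
      LieAlgebra.Orthogonal.JD (Fin 4) ℂ *
      (g : Matrix.SpecialLinearGroup (Fin 4 ⊕ Fin 4) ℂ).1 =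
      LieAlgebra.Orthogonal.JD (Fin 4) ℂ := g.2
    have hi : (((g⁻¹ : SO8) : Matrix.SpecialLinearGroup (Fin 4 ⊕ Fin 4) ℂ).1)ᵀ *
      LieAlgebra.Orthogonal.JD (Fin 4) ℂ *
      ((g⁻¹ : SO8) : Matrix.SpecialLinearGroup (Fin 4 ⊕ Fin 4) ℂ).1 =
      LieAlgebra.Orthogonal.JD (Fin 4) ℂ := (g⁻¹).2
    have h : (g : Matrix.SpecialLinearGroup (Fin 4 ⊕ Fin 4) ℂ).1 *
        ((g⁻¹ : SO8) : Matrix.SpecialLinearGroup (Fin 4 ⊕ Fin 4) ℂ).1 = 1 :=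
      congrArg (fun x : SO8 => (x : Matrix.SpecialLinearGroup (Fin 4 ⊕ Fin 4) ℂ).1)
        (mul_inv_cancel g)
    rw [mem_so8]
    generalize ((g⁻¹ : SO8) : Matrix.SpecialLinearGroup (Fin 4 ⊕ Fin 4) ℂ).1 = b at *
    generalize (g : Matrix.SpecialLinearGroup (Fin 4 ⊕ Fin 4) ℂ).1 = a at *
    generalize (X : Matrix (Fin 4 ⊕ Fin 4) (Fin 4 ⊕ Fin 4) ℂ) = x at *
    generalize LieAlgebra.Orthogonal.JD (Fin 4) ℂ = J at *
    have e1 : aᵀ * J = J * b := by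
      calc aᵀ * J = aᵀ * J * (a * b) := by rw [h, mul_one]
        _ = (aᵀ * J * a) * b := by simp only [Matrix.mul_assoc]
        _ = _ := by rw [hg]
    have e2 : bᵀ * J = J * a := by
      have h' : b * a = 1 := mul_eq_one_comm.1 h
      calc bᵀ * J = bᵀ * J * (b * a) := by rw [h', mul_one]
        _ = (bᵀ * J * b) * a := by simp only [Matrix.mul_assoc]
        _ = _ := by rw [hi]
    calc (a * x * b)ᵀ * J = bᵀ * (xᵀ * (aᵀ * J)) := by
          simp only [Matrix.transpose_mul, Matrix.mul_assoc]
      _ = bᵀ * ((xᵀ * J) * b) := by rw [e1]; simp only [Matrix.mul_assoc]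
      _ = (bᵀ * J) * (-x * b) := by rw [hX]; simp only [Matrix.mul_assoc]
      _ = J * -(a * x * b) := by rw [e2]; simp [Matrix.mul_assoc]⟩

/-- The minimal nilpotent orbit of `so₈`: the adjoint orbit of a root vector for the highest root
`α₁ + 2α₂ + α₃ + α₄ = ε₁ + ε₂`. -/
def minOrbit : Set so8 :=
  Set.range fun g : SO8 => Ad g (rootPlus 0 1)

/-- The closure of the minimal nilpotent orbit. -/
def minOrbitClosure : Set so8 :=
  zariskiClosure minOrbit

/-! ### The action of `𝔖₄` on `so₈` -/

/-- The element `diag(a₁, …, a₄, a₁⁻¹, …, a₄⁻¹)` of the maximal torus of `SO₈`. -/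
def torus (a : Fin 4 → ℂˣ) : SO8 :=
  ⟨⟨Matrix.fromBlocks (Matrix.diagonal fun i => (a i : ℂ)) 0 0
      (Matrix.diagonal fun i => ((a i)⁻¹ : ℂˣ)), by
      rw [Matrix.det_fromBlocks_zero₂₁, Matrix.det_diagonal, Matrix.det_diagonal,
        ← Finset.prod_mul_distrib]
      simp⟩, by
    change (Matrix.fromBlocks (Matrix.diagonal fun i => (a i : ℂ)) 0 0
      (Matrix.diagonal fun i => (((a i)⁻¹ : ℂˣ) : ℂ)))ᵀ * LieAlgebra.Orthogonal.JD (Fin 4) ℂ *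
      Matrix.fromBlocks (Matrix.diagonal fun i => (a i : ℂ)) 0 0
      (Matrix.diagonal fun i => (((a i)⁻¹ : ℂˣ) : ℂ)) = LieAlgebra.Orthogonal.JD (Fin 4) ℂ
    simp only [LieAlgebra.Orthogonal.JD, Matrix.fromBlocks_transpose, Matrix.fromBlocks_multiply]
    simp⟩

/-- The cocharacter `α₁^∨`. -/
def coroot1 (s : ℂˣ) : SO8 := torus ![s, s⁻¹, 1, 1]

/-- The cocharacter `α₃^∨`. -/
def coroot3 (s : ℂˣ) : SO8 := torus ![1, 1, s, s⁻¹]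

/-- `√-1` as a unit of `ℂ`. -/
def sqrtNegOne : ℂˣ := Units.mk0 Complex.I Complex.I_ne_zero

/-- `ρ` is the action of `𝔖₄` on `so₈` by affine diagram automorphisms: `𝔖₄` acts by Lie algebra
automorphisms; `(1 2)` acts by the graph automorphism `γ₁₃` that interchanges `α₁, α₃` and fixes
`α₂, α₄`; `(2 3)` acts by the graph automorphism `γ₃₄` that interchanges `α₃, α₄` and fixes
`α₁, α₂`; and `(3 4)` acts by `γ₁₃ ∘ Ad (α₁^∨(√-1) α₃^∨(-√-1))`. Graph automorphisms permute the
Chevalley generators. The letters `1, 2, 3, 4` are `0, 1, 2, 3 : Fin 4`, and likewise for the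
indices of the simple roots. -/
structure IsAffineDiagramAction (ρ : Representation ℂ (Equiv.Perm (Fin 4)) so8) : Prop where
  map_lie : ∀ (σ : Equiv.Perm (Fin 4)) (X Y : so8), ρ σ ⁅X, Y⁆ = ⁅ρ σ X, ρ σ Y⁆
  swap12_e : ∀ i, ρ (Equiv.swap 0 1) (chevE i) = chevE (Equiv.swap 0 2 i)
  swap12_f : ∀ i, ρ (Equiv.swap 0 1) (chevF i) = chevF (Equiv.swap 0 2 i)
  swap23_e : ∀ i, ρ (Equiv.swap 1 2) (chevE i) = chevE (Equiv.swap 2 3 i)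
  swap23_f : ∀ i, ρ (Equiv.swap 1 2) (chevF i) = chevF (Equiv.swap 2 3 i)
  swap34 : ∀ X, ρ (Equiv.swap 2 3) X =
    ρ (Equiv.swap 0 1) (Ad (coroot1 sqrtNegOne * coroot3 (-sqrtNegOne)) X)

/-! ### The morphism `ψ` -/

/-- `S²M`, the space of symmetric tensors in `M ⊗ M`. -/
def symSq (M : Type) [AddCommGroup M] [Module ℂ M] : Submodule ℂ (M ⊗[ℂ] M) :=
  LinearMap.eqLocus (TensorProduct.comm ℂ M M).toLinearMap LinearMap.id

/-- The symmetric tensor `m ⊗ m`. -/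
def tsq {M : Type} [AddCommGroup M] [Module ℂ M] (m : M) : symSq M :=
  ⟨m ⊗ₜ[ℂ] m, by simp [symSq]⟩

/-- The natural representation of `SL₃`, with standard basis `v₁, v₂, v₃`. -/
abbrev V : Type := Fin 3 → ℂ

/-- The plane `𝔷(𝔩) = {(λ₁, λ₂, λ₃) : λ₁ + λ₂ + λ₃ = 0}`. -/
def zl : Set (Fin 3 → ℂ) := {l | ∑ i, l i = 0}

/-- `g v_i`. -/
def gv (g : Matrix.SpecialLinearGroup (Fin 3) ℂ) (i : Fin 3) : V :=
  g.1 *ᵥ Pi.single i 1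

/-- `χ_i g⁻¹`, where `χ₁, χ₂, χ₃` is the basis of `V^*` dual to `v₁, v₂, v₃`. -/
def chig (g : Matrix.SpecialLinearGroup (Fin 3) ℂ) (i : Fin 3) : Module.Dual ℂ V :=
  (LinearMap.proj i : V →ₗ[ℂ] ℂ) ∘ₗ Matrix.toLin' (g⁻¹).1

/-- `g Δ(z) g⁻¹`, where `Δ(z) = diag(λ₁, λ₂, λ₃)`. -/
def conjDiag (g : Matrix.SpecialLinearGroup (Fin 3) ℂ) (z : zl) :
    LieAlgebra.SpecialLinear.sl (Fin 3) ℂ :=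
  ⟨g.1 * Matrix.diagonal z.1 * (g⁻¹).1, by
    have h : (g⁻¹).1 * g.1 = 1 := congrArg Subtype.val (inv_mul_cancel g)
    have hz : ∑ i, z.1 i = 0 := z.2
    change Matrix.trace (g.1 * Matrix.diagonal z.1 * (g⁻¹).1) = 0
    rw [Matrix.trace_mul_comm, ← Matrix.mul_assoc, h, one_mul, Matrix.trace_diagonal, hz]⟩

/-- The morphism `ψ : SL₃ × 𝔷(𝔩) → sl₃ ⊕ S²V ⊕ S²V^*`. Indices are cyclic: `i + 1` and `i - 1` are
taken in `Fin 3 = ℤ/3`. -/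
def psi (p : Matrix.SpecialLinearGroup (Fin 3) ℂ × zl) :
    LieAlgebra.SpecialLinear.sl (Fin 3) ℂ × symSq V × symSq (Module.Dual ℂ V) :=
  (conjDiag p.1 p.2,
    ∑ i : Fin 3, (p.2.1 i - p.2.1 (i + 1)) ^ 2 • tsq (gv p.1 i),
    ∑ i : Fin 3, (p.2.1 i - p.2.1 (i - 1)) ^ 2 • tsq (chig p.1 i))

end D4ModS4

end

/-!
The Lie algebra `so₈` decomposes as `sl₃ ⊕ 𝔷(𝔩) ⊕ (V ⊗ ℂ³) ⊕ (V^* ⊗ ℂ³)`, where `𝔷(𝔩)` is the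
plane of triples with sum zero. In the corresponding coordinates `x`, `λ_i`, `u_i`, `w_i` (`i` in
`ℤ/3`) the group `𝔖₄` acts by signed permutations: it fixes `x`, permutes the indices `i` through
the surjection `𝔖₄ → 𝔖₃`, and its Klein four-group changes the signs of the `u_i` and `w_i`. The
bracket formulas in these coordinates (`xCoord_lie`, `lamCoord_lie`, `uCoord_lie`, `wCoord_lie`)
show that this is an action by automorphisms, and it is the one prescribed
(`isAffineDiagramAction_permRep`). It is unique because the Chevalley generators generate `so₈`
(`eq_of_isAffineDiagramAction`).

The minimal orbit consists of the nonzero bivectors `a ∧ b` with `a`, `b` orthogonal and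
isotropic; together with `0` they form a cone (`minCone`). Any two points of the cone are joined
by a polynomial curve, so a polynomial that vanishes on a nonempty open subset of the cone
vanishes on the whole closure (`eq_zero_on_minCone`, `eq_zero_on_minOrbitClosure`). The points of
the cone satisfy an `𝔖₄`-symmetric system of quadratic equations (`MinRel`): the `u_i` and `w_i`
are eigenvectors of `x` with eigenvalue `λ_i`, the products `u_i w_i` are polynomials in `x` and
`λ_i`, and the products `u_i u_j` and `w_i w_j` with `i ≠ j` are linear in the third `w_k` and
`u_k`, with coefficients in `x` and `λ_i`. A solution of this system with distinct `λ_i` has the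
form `phi g z` (`MinRel.exists_eq_phi`): the vectors `u_i / (λ_i - λ_{i+1})` are the columns of a
matrix `g` in `SL₃`, and `w_i / (λ_i - λ_{i-1})` are the rows of `g⁻¹`. Conversely all `phi g z`
are in the cone (`phi_mem_minCone`). Hence the generic points of the cone are permuted by `𝔖₄`,
which gives stability, and the image of `phi` is dense.

The morphism `ψ` is the composition of `phi` with `M ↦ (x, ∑ u_i ⊗ u_i, ∑ w_i ⊗ w_i)`. So the
theorem says that the entries of these three tensors, the basic invariants, generate the algebra
of invariants (`invariantRing_eq`). By the quadratic equations every function is a combination of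
`1`, `u_i`, `w_i` and `u_i w_j` with coefficients that are polynomials in `x`, `λ_i`, `u_i u_i`,
`w_i w_i`; averaging over the Klein four-group leaves these polynomials only (`symmetrize_mem`).
Averaging over `𝔖₃` reduces to power sums over `i` (`sum_perm_mul`). A power sum of a monomial is
reduced to shorter ones by multiplying two power sums: the off-diagonal terms `u_i u_i u_j u_j`
are rewritten in terms of `w_k w_k` (`IsPowerSumSystem.mul_mul_mem`). The remaining power sums of
`λ_i ^ n`, `λ_i ^ n u_i u_i` and `λ_i ^ n w_i w_i` are basic invariants by the characteristic
equation of `x` and the eigenvector equations.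
-/

open scoped Matrix TensorProduct

noncomputable section

namespace D4ModS4

attribute [local instance 100] LieRing.ofAssociativeRing

/-! ### Entries of elements of `so₈` -/

/-- The index set of the standard basis of `ℂ⁸`; `Sum.swap` exchanges an isotropic basis vector with
its dual. -/
abbrev Idx : Type := Fin 4 ⊕ Fin 4

theorem mul_JD_apply (X : Matrix Idx Idx ℂ) (k l : Idx) :
    (X * LieAlgebra.Orthogonal.JD (Fin 4) ℂ) k l = X k l.swap := by
  rcases l with l | l <;>
    simp [Matrix.mul_apply, LieAlgebra.Orthogonal.JD, Matrix.one_apply]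

theorem JD_mul_apply (X : Matrix Idx Idx ℂ) (k l : Idx) :
    (LieAlgebra.Orthogonal.JD (Fin 4) ℂ * X) k l = X k.swap l := by
  rcases k with k | k <;>
    simp [Matrix.mul_apply, LieAlgebra.Orthogonal.JD, Matrix.one_apply]

theorem mem_so8_iff_apply (X : Matrix Idx Idx ℂ) :
    X ∈ so8 ↔ ∀ k l, X k l = -X l.swap k.swap := by
  rw [mem_so8, ← Matrix.ext_iff]
  simp only [mul_JD_apply, JD_mul_apply, Matrix.transpose_apply, Matrix.neg_apply]
  constructor
  · intro h k l
    simpa using h l k.swap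
  · intro h k l
    simpa using h l.swap k

theorem so8_apply (M : so8) (k l : Idx) : M.1 k l = -M.1 l.swap k.swap :=
  (mem_so8_iff_apply M.1).1 M.2 k l

/-! ### The homomorphism from `𝔖₄` to `𝔖₃` -/

/-- The index `i : Fin 3` of the partition `{3, i} ∪ {j, k}` of the four letters that contains the
pair `{a, b}`. -/
def pairing (a b : Fin 4) : Fin 3 :=
  ![![0, 2, 1, 0], ![2, 0, 0, 1], ![1, 0, 0, 2], ![0, 1, 2, 0]] a b

/-- The action of a permutation of four letters on their three partitions into pairs. This is the
surjection `𝔖₄ → 𝔖₃`. -/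
def resolvent (σ : Equiv.Perm (Fin 4)) (i : Fin 3) : Fin 3 := pairing (σ 3) (σ i.castSucc)

/-- The sign with which `σ` maps `e₃ + eᵢ - eⱼ - eₖ` to plus or minus a vector of the same shape. -/
def pairSign (σ : Equiv.Perm (Fin 4)) (i : Fin 3) : ℤ :=
  if σ 3 = 3 ∨ σ i.castSucc = 3 then 1 else -1

theorem resolvent_mul : ∀ (σ τ : Equiv.Perm (Fin 4)) (i : Fin 3),
    resolvent (σ * τ) i = resolvent σ (resolvent τ i) := by
  decide +kernel

theorem pairSign_mul : ∀ (σ τ : Equiv.Perm (Fin 4)) (i : Fin 3),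
    pairSign (σ * τ) i = pairSign σ (resolvent τ i) * pairSign τ i := by
  decide +kernel

theorem resolvent_one (i : Fin 3) : resolvent 1 i = i := by
  revert i; decide

theorem pairSign_one (i : Fin 3) : pairSign 1 i = 1 := by
  revert i; decide

/-! ### Coordinates adapted to the subalgebra `sl₃ ⊕ 𝔷(𝔩)` -/

/-- The basis vectors of `ℂ⁸` that span the natural representation `V` of the subalgebra `sl₃` with
simple roots `α₂` and `α₁ + α₂ + α₃ + α₄`. Their images under `Sum.swap` span `V^*`. -/
def wt : Fin 3 → Idx := ![Sum.inl 1, Sum.inl 2, Sum.inr 0]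

/-- A third of the trace of `M` on `V`. -/
def centralTrace (M : Matrix Idx Idx ℂ) : ℂ :=
  (M (wt 0) (wt 0) + M (wt 1) (wt 1) + M (wt 2) (wt 2)) / 3

/-- The component of an element of `so₈` in `sl₃`. -/
def xCoord : so8 →ₗ[ℂ] Matrix (Fin 3) (Fin 3) ℂ where
  toFun M := Matrix.of fun a b => M.1 (wt a) (wt b) - if a = b then centralTrace M.1 else 0
  map_add' M N := by
    ext a b
    by_cases h : a = b <;> simp [h, centralTrace] <;> ring
  map_smul' c M := by
    ext a b
    by_cases h : a = b <;> simp [h, centralTrace] <;> ring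

/-- The component of an element of `so₈` in `𝔷(𝔩)`, as a triple with sum zero. -/
def lamCoord : so8 →ₗ[ℂ] (Fin 3 → ℂ) where
  toFun M := ![-centralTrace M.1, (centralTrace M.1 - M.1 (.inl 3) (.inl 3)) / 2,
    (centralTrace M.1 + M.1 (.inl 3) (.inl 3)) / 2]
  map_add' M N := by
    ext i
    fin_cases i <;> simp [centralTrace] <;> ring
  map_smul' c M := by
    ext i
    fin_cases i <;> simp [centralTrace] <;> ring

/-- The components of an element of `so₈` in the three copies of `V`. The `sl₃`-submodules that
contain `e_{α₁}`, `e_{α₃}`, `e_{α₄}` have the indices `0`, `1`, `2`. -/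
def uCoord (i : Fin 3) : so8 →ₗ[ℂ] (Fin 3 → ℂ) where
  toFun M := fun a => -![M.1 (wt (a + 1)).swap (wt (a + 2)), M.1 (wt a) (.inl 3),
    M.1 (wt a) (.inr 3)] i
  map_add' M N := by
    ext a
    fin_cases i <;> simp <;> ring
  map_smul' c M := by
    ext a
    fin_cases i <;> simp

/-- The components of an element of `so₈` in the three copies of `V^*`. -/
def wCoord (i : Fin 3) : so8 →ₗ[ℂ] (Fin 3 → ℂ) where
  toFun M := fun a => -![M.1 (wt (a + 1)) (wt (a + 2)).swap, M.1 (wt a).swap (.inr 3),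
    M.1 (wt a).swap (.inl 3)] i
  map_add' M N := by
    ext a
    fin_cases i <;> simp <;> ring
  map_smul' c M := by
    ext a
    fin_cases i <;> simp

/-- The element of `so₈` with given components. -/
def ofCoord (x : Matrix (Fin 3) (Fin 3) ℂ) (l : Fin 3 → ℂ) (u w : Fin 3 → Fin 3 → ℂ) : so8 :=
  ⟨Matrix.fromBlocks
    !![-(x 2 2 - l 0), -u 0 1, u 0 0, -w 2 2;
      w 0 1, x 0 0 - l 0, x 0 1, -u 1 0;
      -w 0 0, x 1 0, x 1 1 - l 0, -u 1 1;
      u 2 2, w 1 0, w 1 1, l 2 - l 1]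
    !![0, -x 0 2, -x 1 2, -w 1 2;
      x 0 2, 0, -w 0 2, -u 2 0;
      x 1 2, w 0 2, 0, -u 2 1;
      w 1 2, u 2 0, u 2 1, 0]
    !![0, x 2 0, x 2 1, -u 1 2;
      -x 2 0, 0, -u 0 2, -w 2 0;
      -x 2 1, u 0 2, 0, -w 2 1;
      u 1 2, w 2 0, w 2 1, 0]
    (-(!![-(x 2 2 - l 0), -u 0 1, u 0 0, -w 2 2;
      w 0 1, x 0 0 - l 0, x 0 1, -u 1 0;
      -w 0 0, x 1 0, x 1 1 - l 0, -u 1 1;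
      u 2 2, w 1 0, w 1 1, l 2 - l 1])ᵀ),
    fromBlocks_mem_so8 _ _ _ (by ext i j; fin_cases i <;> fin_cases j <;> simp)
      (by ext i j; fin_cases i <;> fin_cases j <;> simp)⟩

theorem trace_xCoord (M : so8) : (xCoord M).trace = 0 := by
  simp [Matrix.trace, Fin.sum_univ_three, xCoord, centralTrace]; ring

theorem sum_lamCoord (M : so8) : ∑ i, lamCoord M i = 0 := by
  simp [Fin.sum_univ_three, lamCoord]; ring

/-- An element of `so₈` is determined by its upper left block and the entries above the diagonal in
the two off-diagonal blocks. -/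
theorem so8_ext {M N : so8} (hA : ∀ i j, M.1 (.inl i) (.inl j) = N.1 (.inl i) (.inl j))
    (hB : ∀ i j, i < j → M.1 (.inl i) (.inr j) = N.1 (.inl i) (.inr j))
    (hC : ∀ i j, i < j → M.1 (.inr i) (.inl j) = N.1 (.inr i) (.inl j)) : M = N := by
  have hM := so8_apply M
  have hN := so8_apply N
  have hz : ∀ (M : so8) (k : Idx), M.1 k k.swap = 0 := fun M k => by
    have := so8_apply M k k.swap
    rw [Sum.swap_swap] at this
    linear_combination this / 2
  apply Subtype.ext
  ext k l
  rcases k with i | i <;> rcases l with j | j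
  · exact hA i j
  · rcases lt_trichotomy i j with h | rfl | h
    · exact hB i j h
    · exact (hz M (.inl i)).trans (hz N (.inl i)).symm
    · rw [hM, hN]; exact congrArg _ (hB j i h)
  · rcases lt_trichotomy i j with h | rfl | h
    · exact hC i j h
    · exact (hz M (.inr i)).trans (hz N (.inr i)).symm
    · rw [hM, hN]; exact congrArg _ (hC j i h)
  · rw [hM, hN]; exact congrArg _ (hA j i)

/-- The components determine an element of `so₈`. -/
theorem ofCoord_coord (M : so8) :
    ofCoord (xCoord M) (lamCoord M) (fun i => uCoord i M) (fun i => wCoord i M) = M := by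
  have h := so8_apply M
  refine so8_ext (fun i j => ?_) (fun i j hij => ?_) (fun i j hij => ?_)
  · have := h (.inl i) (.inl j)
    fin_cases i <;> fin_cases j <;>
    simp [ofCoord, xCoord, lamCoord, uCoord, wCoord, wt, centralTrace] at this ⊢ <;>
    first | done | (linear_combination -this) | ring
  · have := h (.inl i) (.inr j)
    fin_cases i <;> fin_cases j <;> first | exact absurd hij (by decide) |
    (simp [ofCoord, xCoord, uCoord, wCoord, wt] at this ⊢ <;>
      linear_combination -this)
  · have := h (.inr i) (.inl j)
    fin_cases i <;> fin_cases j <;> first | exact absurd hij (by decide) |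
    simp [ofCoord, xCoord, uCoord, wCoord, wt] at this ⊢

theorem ext_coord {M N : so8} (hx : xCoord M = xCoord N) (hl : lamCoord M = lamCoord N)
    (hu : ∀ i, uCoord i M = uCoord i N) (hw : ∀ i, wCoord i M = wCoord i N) : M = N := by
  rw [← ofCoord_coord M, ← ofCoord_coord N, hx, hl, funext hu, funext hw]

section
variable {x : Matrix (Fin 3) (Fin 3) ℂ} {l : Fin 3 → ℂ} (u w : Fin 3 → Fin 3 → ℂ)

theorem xCoord_ofCoord (hx : x.trace = 0) : xCoord (ofCoord x l u w) = x := by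
  simp only [Matrix.trace, Fin.sum_univ_three, Matrix.diag] at hx
  ext a b
  fin_cases a <;> fin_cases b <;> simp [ofCoord, xCoord, wt, centralTrace] <;>
    linear_combination -hx / 3

theorem lamCoord_ofCoord (hx : x.trace = 0) (hl : ∑ i, l i = 0) :
    lamCoord (ofCoord x l u w) = l := by
  simp only [Matrix.trace, Fin.sum_univ_three, Matrix.diag] at hx hl
  ext i
  fin_cases i <;> simp [ofCoord, lamCoord, wt, centralTrace]
  · linear_combination -hx / 3
  · linear_combination hx / 6 - hl / 2
  · linear_combination hx / 6 - hl / 2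

theorem uCoord_ofCoord (i : Fin 3) : uCoord i (ofCoord x l u w) = u i := by
  ext a
  fin_cases i <;> fin_cases a <;> simp [ofCoord, uCoord, wt]

theorem wCoord_ofCoord (i : Fin 3) : wCoord i (ofCoord x l u w) = w i := by
  ext a
  fin_cases i <;> fin_cases a <;> simp [ofCoord, wCoord, wt]
end

/-! ### The Lie bracket in the adapted coordinates -/

theorem lie_apply (M N : so8) (k l : Idx) :
    (⁅M, N⁆ : so8).1 k l = ∑ j, (M.1 k j * N.1 j l - N.1 k j * M.1 j l) := by
  rw [Finset.sum_sub_distrib]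
  rfl

section
variable (x x' : Matrix (Fin 3) (Fin 3) ℂ) (l l' : Fin 3 → ℂ) (u w u' w' : Fin 3 → Fin 3 → ℂ)

set_option maxHeartbeats 4000000 in
/-- The entries of a bracket in the block `V ⊗ V^*`, before the trace is split off. -/
theorem wt_lie (a b : Fin 3) :
    (⁅ofCoord x l u w, ofCoord x' l' u' w'⁆ : so8).1 (wt a) (wt b) =
    (x * x' - x' * x) a b - ∑ i, (u i a * w' i b - u' i a * w i b) +
      if a = b then w' 0 ⬝ᵥ u 0 - w 0 ⬝ᵥ u' 0 else 0 := by
  rw [lie_apply]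
  fin_cases a <;> fin_cases b <;>
    simp [ofCoord, wt, Matrix.mul_apply, Fintype.sum_sum_type, Fin.sum_univ_four,
      Fin.sum_univ_three, dotProduct] <;>
    ring

theorem inl_three_lie :
    (⁅ofCoord x l u w, ofCoord x' l' u' w'⁆ : so8).1 (.inl 3) (.inl 3) =
    w' 1 ⬝ᵥ u 1 - w 1 ⬝ᵥ u' 1 - w' 2 ⬝ᵥ u 2 + w 2 ⬝ᵥ u' 2 := by
  rw [lie_apply]
  simp [ofCoord, Fintype.sum_sum_type, Fin.sum_univ_four, Fin.sum_univ_three, dotProduct]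
  ring

set_option maxHeartbeats 4000000 in
theorem uCoord_lie_ofCoord (hx : x.trace = 0) (hx' : x'.trace = 0) (hl : ∑ i, l i = 0)
    (hl' : ∑ i, l' i = 0) (i : Fin 3) :
    uCoord i ⁅ofCoord x l u w, ofCoord x' l' u' w'⁆ = x *ᵥ u' i - x' *ᵥ u i +
      (2 : ℂ) • (l i • u' i - l' i • u i) + crossProduct (w (i + 1)) (w' (i + 2)) +
      crossProduct (w (i + 2)) (w' (i + 1)) := by
  simp only [Matrix.trace, Fin.sum_univ_three, Matrix.diag] at hx hx' hl hl'
  replace hx : x 2 2 = -x 0 0 - x 1 1 := by linear_combination hx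
  replace hx' : x' 2 2 = -x' 0 0 - x' 1 1 := by linear_combination hx'
  replace hl : l 2 = -l 0 - l 1 := by linear_combination hl
  replace hl' : l' 2 = -l' 0 - l' 1 := by linear_combination hl'
  ext a
  simp only [Pi.add_apply, Pi.sub_apply, Pi.smul_apply, cross_apply, Matrix.mulVec, dotProduct,
    Fin.sum_univ_three, smul_eq_mul]
  fin_cases i <;> fin_cases a <;>
    simp [uCoord, lie_apply, ofCoord, wt, Fintype.sum_sum_type, Fin.sum_univ_four, hx, hx',
      hl, hl'] <;>
    ring

set_option maxHeartbeats 4000000 in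
theorem wCoord_lie_ofCoord (hx : x.trace = 0) (hx' : x'.trace = 0) (hl : ∑ i, l i = 0)
    (hl' : ∑ i, l' i = 0) (i : Fin 3) :
    wCoord i ⁅ofCoord x l u w, ofCoord x' l' u' w'⁆ = w i ᵥ* x' - w' i ᵥ* x -
      (2 : ℂ) • (l i • w' i - l' i • w i) + crossProduct (u (i + 1)) (u' (i + 2)) +
      crossProduct (u (i + 2)) (u' (i + 1)) := by
  simp only [Matrix.trace, Fin.sum_univ_three, Matrix.diag] at hx hx' hl hl'
  replace hx : x 2 2 = -x 0 0 - x 1 1 := by linear_combination hx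
  replace hx' : x' 2 2 = -x' 0 0 - x' 1 1 := by linear_combination hx'
  replace hl : l 2 = -l 0 - l 1 := by linear_combination hl
  replace hl' : l' 2 = -l' 0 - l' 1 := by linear_combination hl'
  ext a
  simp only [Pi.add_apply, Pi.sub_apply, Pi.smul_apply, cross_apply, Matrix.vecMul, dotProduct,
    Fin.sum_univ_three, smul_eq_mul]
  fin_cases i <;> fin_cases a <;>
    simp [wCoord, lie_apply, ofCoord, wt, Fintype.sum_sum_type, Fin.sum_univ_four, hx, hx',
      hl, hl'] <;>
    ring
end

theorem xCoord_lie (M N : so8) :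
    xCoord ⁅M, N⁆ = xCoord M * xCoord N - xCoord N * xCoord M - ∑ i,
      (Matrix.vecMulVec (uCoord i M) (wCoord i N) - Matrix.vecMulVec (uCoord i N) (wCoord i M) -
        ((wCoord i N ⬝ᵥ uCoord i M - wCoord i M ⬝ᵥ uCoord i N) / 3) • 1) := by
  have h := wt_lie (xCoord M) (xCoord N) (lamCoord M) (lamCoord N) (fun i => uCoord i M)
    (fun i => wCoord i M) (fun i => uCoord i N) (fun i => wCoord i N)
  rw [ofCoord_coord, ofCoord_coord] at h
  ext a b
  simp only [xCoord, centralTrace, LinearMap.coe_mk, AddHom.coe_mk, Matrix.of_apply, h] at h ⊢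
  by_cases hab : a = b <;>
    simp [hab, Matrix.sub_apply, Fin.sum_univ_three, Matrix.vecMulVec, Matrix.mul_apply,
      dotProduct] <;> ring

theorem lamCoord_lie (M N : so8) (i : Fin 3) :
    lamCoord ⁅M, N⁆ i =
      (∑ j, (wCoord j N ⬝ᵥ uCoord j M - wCoord j M ⬝ᵥ uCoord j N)) / 3 -
        (wCoord i N ⬝ᵥ uCoord i M - wCoord i M ⬝ᵥ uCoord i N) := by
  have h := wt_lie (xCoord M) (xCoord N) (lamCoord M) (lamCoord N) (fun i => uCoord i M)
    (fun i => wCoord i M) (fun i => uCoord i N) (fun i => wCoord i N)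
  have h' := inl_three_lie (xCoord M) (xCoord N) (lamCoord M) (lamCoord N) (fun i => uCoord i M)
    (fun i => wCoord i M) (fun i => uCoord i N) (fun i => wCoord i N)
  rw [ofCoord_coord, ofCoord_coord] at h h'
  have ht : centralTrace (⁅M, N⁆ : so8).1 =
    (wCoord 0 N ⬝ᵥ uCoord 0 M - wCoord 0 M ⬝ᵥ uCoord 0 N) -
    (∑ j, (wCoord j N ⬝ᵥ uCoord j M - wCoord j M ⬝ᵥ uCoord j N)) / 3 := by
    simp only [centralTrace, h]
    generalize xCoord M = x
    generalize xCoord N = x'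
    generalize uCoord 0 M = u0
    simp [Matrix.sub_apply, Fin.sum_univ_three, Matrix.mul_apply, dotProduct]
    ring
  simp only [lamCoord, LinearMap.coe_mk, AddHom.coe_mk, ht, h', Fin.sum_univ_three]
  fin_cases i <;> simp <;> ring

theorem uCoord_lie (M N : so8) (i : Fin 3) :
    uCoord i ⁅M, N⁆ = xCoord M *ᵥ uCoord i N - xCoord N *ᵥ uCoord i M +
      (2 : ℂ) • (lamCoord M i • uCoord i N - lamCoord N i • uCoord i M) +
      crossProduct (wCoord (i + 1) M) (wCoord (i + 2) N) +
      crossProduct (wCoord (i + 2) M) (wCoord (i + 1) N) := by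
  have h := uCoord_lie_ofCoord (xCoord M) (xCoord N) (lamCoord M) (lamCoord N)
    (fun i => uCoord i M) (fun i => wCoord i M) (fun i => uCoord i N) (fun i => wCoord i N)
    (trace_xCoord M) (trace_xCoord N) (sum_lamCoord M) (sum_lamCoord N) i
  rwa [ofCoord_coord, ofCoord_coord] at h

theorem wCoord_lie (M N : so8) (i : Fin 3) :
    wCoord i ⁅M, N⁆ = wCoord i M ᵥ* xCoord N - wCoord i N ᵥ* xCoord M -
      (2 : ℂ) • (lamCoord M i • wCoord i N - lamCoord N i • wCoord i M) +
      crossProduct (uCoord (i + 1) M) (uCoord (i + 2) N) +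
      crossProduct (uCoord (i + 2) M) (uCoord (i + 1) N) := by
  have h := wCoord_lie_ofCoord (xCoord M) (xCoord N) (lamCoord M) (lamCoord N)
    (fun i => uCoord i M) (fun i => wCoord i M) (fun i => uCoord i N) (fun i => wCoord i N)
    (trace_xCoord M) (trace_xCoord N) (sum_lamCoord M) (sum_lamCoord N) i
  rwa [ofCoord_coord, ofCoord_coord] at h

/-! ### The action of `𝔖₄` -/

theorem resolvent_bijective (σ : Equiv.Perm (Fin 4)) : Function.Bijective (resolvent σ) := by
  refine Function.bijective_iff_has_inverse.2 ⟨resolvent σ⁻¹, fun i => ?_, fun i => ?_⟩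
  · rw [← resolvent_mul, inv_mul_cancel, resolvent_one]
  · rw [← resolvent_mul, mul_inv_cancel, resolvent_one]

theorem pairSign_mul_self (σ : Equiv.Perm (Fin 4)) (i : Fin 3) :
    (pairSign σ i : ℂ) * pairSign σ i = 1 := by
  unfold pairSign
  split_ifs <;> simp

theorem pairSign_add_one_mul (σ : Equiv.Perm (Fin 4)) (i : Fin 3) :
    (pairSign σ (i + 1) : ℂ) * pairSign σ (i + 2) = pairSign σ i := by
  have : ∀ (σ : Equiv.Perm (Fin 4)) (i : Fin 3),
    pairSign σ (i + 1) * pairSign σ (i + 2) = pairSign σ i := by decide +kernel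
  exact_mod_cast this σ i

theorem resolvent_add (σ : Equiv.Perm (Fin 4)) (i : Fin 3) :
    resolvent σ (i + 1) = resolvent σ i + 1 ∧ resolvent σ (i + 2) = resolvent σ i + 2 ∨
      resolvent σ (i + 1) = resolvent σ i + 2 ∧ resolvent σ (i + 2) = resolvent σ i + 1 := by
  revert σ i
  decide +kernel

theorem sum_resolvent {A : Type*} [AddCommMonoid A] (σ : Equiv.Perm (Fin 4)) (f : Fin 3 → A) :
    ∑ i, f (resolvent σ i) = ∑ i, f i :=
  (resolvent_bijective σ).sum_comp f

/-- The effect of a permutation of four letters on `so₈`: it fixes `sl₃`, permutes the coordinates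
on `𝔷(𝔩)`, and permutes the three copies of `V` and of `V^*` up to signs. -/
def permFun (σ : Equiv.Perm (Fin 4)) (M : so8) : so8 :=
  ofCoord (xCoord M) (fun i => lamCoord M (resolvent σ⁻¹ i))
    (fun i => (pairSign σ⁻¹ i : ℂ) • uCoord (resolvent σ⁻¹ i) M)
    (fun i => (pairSign σ⁻¹ i : ℂ) • wCoord (resolvent σ⁻¹ i) M)

section
variable (σ : Equiv.Perm (Fin 4)) (M : so8)

theorem xCoord_permFun : xCoord (permFun σ M) = xCoord M :=
  xCoord_ofCoord _ _ (trace_xCoord M)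

theorem lamCoord_permFun (i : Fin 3) :
    lamCoord (permFun σ M) i = lamCoord M (resolvent σ⁻¹ i) :=
  congrFun (lamCoord_ofCoord _ _ (trace_xCoord M)
    ((sum_resolvent σ⁻¹ (lamCoord M)).trans (sum_lamCoord M))) i

theorem uCoord_permFun (i : Fin 3) :
    uCoord i (permFun σ M) = (pairSign σ⁻¹ i : ℂ) • uCoord (resolvent σ⁻¹ i) M :=
  uCoord_ofCoord _ _ i

theorem wCoord_permFun (i : Fin 3) :
    wCoord i (permFun σ M) = (pairSign σ⁻¹ i : ℂ) • wCoord (resolvent σ⁻¹ i) M :=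
  wCoord_ofCoord _ _ i
end

/-- The action of `𝔖₄` on `so₈` by signed permutations of the adapted coordinates. -/
def permRep : Representation ℂ (Equiv.Perm (Fin 4)) so8 where
  toFun σ :=
    { toFun := permFun σ
      map_add' := fun M N => ext_coord
        (by simp only [xCoord_permFun, map_add])
        (by ext i; simp only [lamCoord_permFun, map_add, Pi.add_apply])
        (fun i => by simp only [uCoord_permFun, map_add, smul_add])
        (fun i => by simp only [wCoord_permFun, map_add, smul_add])
      map_smul' := fun c M => ext_coord
        (by simp only [xCoord_permFun, map_smul, RingHom.id_apply])
        (by ext i; simp only [lamCoord_permFun, map_smul, RingHom.id_apply, Pi.smul_apply])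
        (fun i => by simp only [uCoord_permFun, map_smul, RingHom.id_apply]; rw [smul_comm])
        (fun i => by simp only [wCoord_permFun, map_smul, RingHom.id_apply]; rw [smul_comm]) }
  map_one' := LinearMap.ext fun M => ext_coord
    (xCoord_permFun 1 M)
    (by ext i; exact (lamCoord_permFun 1 M i).trans (by rw [inv_one, resolvent_one]; rfl))
    (fun i => (uCoord_permFun 1 M i).trans
      (by rw [inv_one, resolvent_one, pairSign_one, Int.cast_one, one_smul]; rfl))
    (fun i => (wCoord_permFun 1 M i).trans
      (by rw [inv_one, resolvent_one, pairSign_one, Int.cast_one, one_smul]; rfl))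
  map_mul' σ τ := LinearMap.ext fun M => by
    change permFun (σ * τ) M = permFun σ (permFun τ M)
    refine ext_coord ?_ ?_ (fun i => ?_) (fun i => ?_)
    · simp only [xCoord_permFun]
    · ext i
      simp only [lamCoord_permFun, mul_inv_rev, resolvent_mul]
    · simp only [uCoord_permFun, mul_inv_rev, resolvent_mul, pairSign_mul, Int.cast_mul, smul_smul]
      rw [mul_comm]
    · simp only [wCoord_permFun, mul_inv_rev, resolvent_mul, pairSign_mul, Int.cast_mul, smul_smul]
      rw [mul_comm]

section
variable (σ : Equiv.Perm (Fin 4)) (M : so8)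

theorem xCoord_permRep : xCoord (permRep σ M) = xCoord M := xCoord_permFun σ M

theorem lamCoord_permRep (i : Fin 3) :
    lamCoord (permRep σ M) i = lamCoord M (resolvent σ⁻¹ i) := lamCoord_permFun σ M i

theorem uCoord_permRep (i : Fin 3) :
    uCoord i (permRep σ M) = (pairSign σ⁻¹ i : ℂ) • uCoord (resolvent σ⁻¹ i) M :=
  uCoord_permFun σ M i

theorem wCoord_permRep (i : Fin 3) :
    wCoord i (permRep σ M) = (pairSign σ⁻¹ i : ℂ) • wCoord (resolvent σ⁻¹ i) M :=
  wCoord_permFun σ M i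
end

/-- The bracket formulas are symmetric in the three copies of `V` and of `V^*`, and the signs of
`𝔖₄` are compatible with the cross product, because the product of two signs is the third. -/
theorem permRep_lie (σ : Equiv.Perm (Fin 4)) (M N : so8) :
    permRep σ ⁅M, N⁆ = ⁅permRep σ M, permRep σ N⁆ := by
  have hs := pairSign_mul_self σ⁻¹
  have hp := pairSign_add_one_mul σ⁻¹
  have hc := resolvent_add σ⁻¹
  refine ext_coord ?_ ?_ (fun i => ?_) (fun i => ?_)
  · rw [xCoord_permRep, xCoord_lie, xCoord_lie]
    simp only [xCoord_permRep, uCoord_permRep, wCoord_permRep, Matrix.smul_vecMulVec,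
      Matrix.vecMulVec_smul, smul_smul, smul_dotProduct, dotProduct_smul, hs, one_smul]
    rw [sum_resolvent σ⁻¹ fun i => Matrix.vecMulVec (uCoord i M) (wCoord i N) -
      Matrix.vecMulVec (uCoord i N) (wCoord i M) -
        ((wCoord i N ⬝ᵥ uCoord i M - wCoord i M ⬝ᵥ uCoord i N) / 3) • 1]
  · ext i
    rw [lamCoord_permRep, lamCoord_lie, lamCoord_lie]
    simp only [uCoord_permRep, wCoord_permRep, smul_dotProduct, dotProduct_smul, smul_smul, hs,
      one_smul]
    rw [sum_resolvent σ⁻¹ fun j => wCoord j N ⬝ᵥ uCoord j M - wCoord j M ⬝ᵥ uCoord j N]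
  · rw [uCoord_permRep, uCoord_lie, uCoord_lie]
    simp only [xCoord_permRep, lamCoord_permRep, uCoord_permRep, wCoord_permRep, map_smul,
      LinearMap.smul_apply, smul_smul, hp, (mul_comm _ _).trans (hp i), Matrix.mulVec_smul]
    rcases hc i with ⟨h1, h2⟩ | ⟨h1, h2⟩ <;> rw [h1, h2] <;> module
  · rw [wCoord_permRep, wCoord_lie, wCoord_lie]
    simp only [xCoord_permRep, lamCoord_permRep, uCoord_permRep, wCoord_permRep, map_smul,
      LinearMap.smul_apply, smul_smul, hp, (mul_comm _ _).trans (hp i), Matrix.smul_vecMul]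
    rcases hc i with ⟨h1, h2⟩ | ⟨h1, h2⟩ <;> rw [h1, h2] <;> module

theorem permRep_ofCoord (σ : Equiv.Perm (Fin 4)) {x : Matrix (Fin 3) (Fin 3) ℂ} {l : Fin 3 → ℂ}
    (u w : Fin 3 → Fin 3 → ℂ) (hx : x.trace = 0) (hl : ∑ i, l i = 0) :
    permRep σ (ofCoord x l u w) = ofCoord x (fun i => l (resolvent σ⁻¹ i))
      (fun i => (pairSign σ⁻¹ i : ℂ) • u (resolvent σ⁻¹ i))
      (fun i => (pairSign σ⁻¹ i : ℂ) • w (resolvent σ⁻¹ i)) := by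
  change permFun _ _ = _
  simp only [permFun, xCoord_ofCoord _ _ hx, lamCoord_ofCoord _ _ hx hl, uCoord_ofCoord,
    wCoord_ofCoord]

/-! ### Chevalley generators -/

/-- The Chevalley generators for the outer nodes are vectors in the three copies of `V`, in the
same position. -/
theorem chevE_eq (i : Fin 4) : chevE i =
    ofCoord (if i = 1 then Matrix.single 0 1 1 else 0) 0
      (fun j => if i = ![0, 2, 3] j then Pi.single 1 (-1) else 0) 0 := by
  refine so8_ext (fun k l => ?_) (fun k l _ => ?_) (fun k l _ => ?_) <;>
  fin_cases i <;> fin_cases k <;> fin_cases l <;>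
    simp [chevE, ofCoord, rootMinus, rootPlus]

theorem chevF_eq (i : Fin 4) : chevF i =
    ofCoord (if i = 1 then Matrix.single 1 0 1 else 0) 0 0
      (fun j => if i = ![0, 2, 3] j then Pi.single 1 1 else 0) := by
  refine so8_ext (fun k l => ?_) (fun k l _ => ?_) (fun k l _ => ?_) <;>
  fin_cases i <;> fin_cases k <;> fin_cases l <;>
    simp [chevF, ofCoord, rootMinus, rootNeg]

theorem trace_ite_single (i : Fin 4) {a b : Fin 3} (hab : a ≠ b) :
    (if i = 1 then Matrix.single a b (1 : ℂ) else 0).trace = 0 := by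
  split_ifs
  · exact Matrix.trace_single_eq_of_ne _ _ _ hab
  · exact Matrix.trace_zero _ _

theorem permRep_chevE {σ : Equiv.Perm (Fin 4)} {τ : Equiv.Perm (Fin 4)}
    (h : ∀ j, pairSign σ⁻¹ j = 1) (h1 : ∀ i, τ i = 1 ↔ i = 1)
    (hτ : ∀ (i : Fin 4) (j : Fin 3),
      (τ i = (![0, 2, 3] : Fin 3 → Fin 4) j ↔ i = (![0, 2, 3] : Fin 3 → Fin 4) (resolvent σ⁻¹ j)))
    (i : Fin 4) : permRep σ (chevE i) = chevE (τ i) := by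
  rw [chevE_eq, chevE_eq, permRep_ofCoord σ _ _ (trace_ite_single i (by decide)) (by simp)]
  simp only [h, Int.cast_one, one_smul, h1, hτ]
  rfl

theorem permRep_chevF {σ : Equiv.Perm (Fin 4)} {τ : Equiv.Perm (Fin 4)}
    (h : ∀ j, pairSign σ⁻¹ j = 1) (h1 : ∀ i, τ i = 1 ↔ i = 1)
    (hτ : ∀ (i : Fin 4) (j : Fin 3),
      (τ i = (![0, 2, 3] : Fin 3 → Fin 4) j ↔ i = (![0, 2, 3] : Fin 3 → Fin 4) (resolvent σ⁻¹ j)))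
    (i : Fin 4) : permRep σ (chevF i) = chevF (τ i) := by
  rw [chevF_eq, chevF_eq, permRep_ofCoord σ _ _ (trace_ite_single i (by decide)) (by simp)]
  simp only [h, Int.cast_one, one_smul, h1, hτ]
  rfl

theorem torus_mul (a b : Fin 4 → ℂˣ) : torus a * torus b = torus (a * b) := by
  apply Subtype.ext
  apply Subtype.ext
  change Matrix.fromBlocks _ _ _ _ * Matrix.fromBlocks _ _ _ _ = Matrix.fromBlocks _ _ _ _
  simp [mul_comm]

theorem torus_inv (a : Fin 4 → ℂˣ) : (torus a)⁻¹ = torus a⁻¹ := by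
  refine inv_eq_of_mul_eq_one_right ?_
  rw [torus_mul, mul_inv_cancel]
  apply Subtype.ext
  apply Subtype.ext
  change Matrix.fromBlocks _ _ _ _ = 1
  simp

theorem Ad_torus_apply (a : Fin 4 → ℂˣ) (M : so8) (k l : Idx) :
    (Ad (torus a) M).1 k l =
      (Sum.elim a a⁻¹ k : ℂˣ) * M.1 k l * ((Sum.elim a a⁻¹ l)⁻¹ : ℂˣ) := by
  change ((torus a).1.1 * M.1 * ((torus a)⁻¹ : SO8).1.1) k l = _
  rw [torus_inv]
  change ((Matrix.fromBlocks _ _ _ _ : Matrix Idx Idx ℂ) * M.1 *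
    (Matrix.fromBlocks _ _ _ _ : Matrix Idx Idx ℂ)) k l = _
  rcases k with k | k <;> rcases l with l | l <;>
    simp [Matrix.fromBlocks_diagonal, Matrix.mul_diagonal, Matrix.diagonal_mul]

theorem coroot1_mul_coroot3 : coroot1 sqrtNegOne * coroot3 (-sqrtNegOne) =
    torus ![sqrtNegOne, -sqrtNegOne, -sqrtNegOne, sqrtNegOne] := by
  have h : sqrtNegOne⁻¹ = -sqrtNegOne := by
    ext
    simp [sqrtNegOne]
  rw [coroot1, coroot3, torus_mul]
  congr 1
  ext i
  fin_cases i <;> simp [h, inv_neg]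

theorem Ad_coroot_apply (M : so8) (k l : Idx) :
    (Ad (coroot1 sqrtNegOne * coroot3 (-sqrtNegOne)) M).1 k l =
      (Sum.elim ![1, -1, -1, 1] ![-1, 1, 1, -1] k : ℂ) *
        (Sum.elim ![1, -1, -1, 1] ![-1, 1, 1, -1] l : ℂ) * M.1 k l := by
  have h : ∀ k : Idx, ((Sum.elim ![sqrtNegOne, -sqrtNegOne, -sqrtNegOne, sqrtNegOne]
      (![sqrtNegOne, -sqrtNegOne, -sqrtNegOne, sqrtNegOne])⁻¹ k : ℂˣ) : ℂ) =
      Complex.I * Sum.elim ![1, -1, -1, 1] ![-1, 1, 1, -1] k := fun k => by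
    rcases k with k | k <;> fin_cases k <;> simp [sqrtNegOne]
  have h1 : (Sum.elim ![1, -1, -1, 1] ![-1, 1, 1, -1] l : ℂ) *
      Sum.elim ![1, -1, -1, 1] ![-1, 1, 1, -1] l = 1 := by
    rcases l with l | l <;> fin_cases l <;> simp
  have h2 : (Sum.elim ![1, -1, -1, 1] ![-1, 1, 1, -1] l : ℂ) ≠ 0 := left_ne_zero_of_mul_eq_one h1
  rw [coroot1_mul_coroot3, Ad_torus_apply, Units.val_inv_eq_inv_val, h, h, mul_inv,
    inv_eq_of_mul_eq_one_right h1, Complex.inv_I]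
  linear_combination (-Sum.elim ![1, -1, -1, 1] ![-1, 1, 1, -1] k * M.1 k l *
    Sum.elim ![1, -1, -1, 1] ![-1, 1, 1, -1] l) * Complex.I_mul_I

/-- Both sides act on the coordinates by the same transposition; the signs come from the torus. -/
theorem permRep_swap_two_three (M : so8) : permRep (Equiv.swap 2 3) M =
    permRep (Equiv.swap 0 1) (Ad (coroot1 sqrtNegOne * coroot3 (-sqrtNegOne)) M) := by
  have r1 : resolvent (Equiv.swap 2 3)⁻¹ = ![1, 0, 2] := by decide
  have r2 : resolvent (Equiv.swap 0 1)⁻¹ = ![1, 0, 2] := by decide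
  have s1 : pairSign (Equiv.swap 2 3)⁻¹ = ![-1, -1, 1] := by decide
  have s2 : pairSign (Equiv.swap 0 1)⁻¹ = ![1, 1, 1] := by decide
  refine ext_coord ?_ ?_ (fun i => ?_) (fun i => ?_)
  · rw [xCoord_permRep, xCoord_permRep]
    ext a b
    fin_cases a <;> fin_cases b <;>
      simp [xCoord, centralTrace, Ad_coroot_apply, wt]
  · ext i
    rw [lamCoord_permRep, lamCoord_permRep, r1, r2]
    fin_cases i <;>
      simp [lamCoord, centralTrace, Ad_coroot_apply, wt]
  · rw [uCoord_permRep, uCoord_permRep, r1, r2, s1, s2]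
    ext a
    fin_cases i <;> fin_cases a <;>
      simp [uCoord, Ad_coroot_apply, wt]
  · rw [wCoord_permRep, wCoord_permRep, r1, r2, s1, s2]
    ext a
    fin_cases i <;> fin_cases a <;>
      simp [wCoord, Ad_coroot_apply, wt]

theorem isAffineDiagramAction_permRep : IsAffineDiagramAction permRep where
  map_lie := permRep_lie
  swap12_e := permRep_chevE (by decide) (by decide) (by decide)
  swap12_f := permRep_chevF (by decide) (by decide) (by decide)
  swap23_e := permRep_chevE (by decide) (by decide) (by decide)
  swap23_f := permRep_chevF (by decide) (by decide) (by decide)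
  swap34 := permRep_swap_two_three

/-! ### Uniqueness of the action -/

theorem lie_rootMinus_rootMinus {i j k : Fin 4} (hik : i ≠ k) :
    ⁅rootMinus i j, rootMinus j k⁆ = rootMinus i k := by
  apply Subtype.ext
  simp [rootMinus, Ring.lie_def, Matrix.fromBlocks_multiply, Matrix.single_mul_single_of_ne, hik,
    hik.symm, sub_eq_add_neg, Matrix.fromBlocks_neg, Matrix.fromBlocks_add]

theorem lie_rootMinus_symm (i j : Fin 4) :
    ⁅rootMinus i j, rootMinus j i⁆ = rootMinus i i - rootMinus j j := by
  apply Subtype.ext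
  simp [rootMinus, Ring.lie_def, Matrix.fromBlocks_multiply,
    sub_eq_add_neg, Matrix.fromBlocks_neg, Matrix.fromBlocks_add]
  abel

theorem lie_rootMinus_rootPlus {i j k : Fin 4} (hjk : j ≠ k) :
    ⁅rootMinus i j, rootPlus j k⁆ = rootPlus i k := by
  apply Subtype.ext
  simp [rootMinus, rootPlus, Ring.lie_def, Matrix.fromBlocks_multiply, add_mul,
    mul_add, Matrix.single_mul_single_of_ne, hjk, hjk.symm,
    sub_eq_add_neg, Matrix.fromBlocks_neg, Matrix.fromBlocks_add]

theorem lie_rootMinus_rootNeg {i j k : Fin 4} (hjk : j ≠ k) :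
    ⁅rootMinus j i, rootNeg j k⁆ = rootNeg k i := by
  apply Subtype.ext
  simp [rootMinus, rootNeg, Ring.lie_def, Matrix.fromBlocks_multiply, add_mul,
    mul_add, Matrix.single_mul_single_of_ne, hjk, hjk.symm,
    sub_eq_add_neg, Matrix.fromBlocks_neg, Matrix.fromBlocks_add]

theorem lie_rootPlus_rootNeg {i j : Fin 4} (hij : i ≠ j) :
    ⁅rootPlus i j, rootNeg i j⁆ = rootMinus i i + rootMinus j j := by
  apply Subtype.ext
  simp [rootPlus, rootNeg, rootMinus, Ring.lie_def, Matrix.fromBlocks_multiply, add_mul,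
    mul_add, Matrix.single_mul_single_of_ne, hij, hij.symm,
    sub_eq_add_neg, Matrix.fromBlocks_neg, Matrix.fromBlocks_add]

theorem rootPlus_swap (i j : Fin 4) : rootPlus j i = -rootPlus i j := by
  apply Subtype.ext
  simp [rootPlus, Matrix.fromBlocks_neg]

theorem rootNeg_swap (i j : Fin 4) : rootNeg j i = -rootNeg i j := by
  apply Subtype.ext
  simp [rootNeg, Matrix.fromBlocks_neg]

/-- The factors `1 / 2` occur because the root vectors for `(i, j)` and `(j, i)` are opposite. -/
theorem eq_sum_root (M : so8) : M = ∑ i, ∑ j, (M.1 (.inl i) (.inl j) • rootMinus i j +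
    (M.1 (.inl i) (.inr j) / 2) • rootPlus i j + (M.1 (.inr j) (.inl i) / 2) • rootNeg i j) := by
  have h := so8_apply M
  refine so8_ext (fun k l => ?_) (fun k l _ => ?_) (fun k l _ => ?_)
  · simp [rootMinus, rootPlus, rootNeg, Matrix.sum_apply, Matrix.single_apply, ite_and]
  · have := h (.inl k) (.inr l)
    simp [rootMinus, rootPlus, rootNeg, Matrix.sum_apply, Matrix.single_apply, mul_sub,
      Finset.sum_sub_distrib, ite_and] at this ⊢
    linear_combination this / 2
  · have := h (.inr k) (.inl l)
    simp [rootMinus, rootPlus, rootNeg, Matrix.sum_apply, Matrix.single_apply, mul_sub,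
      Finset.sum_sub_distrib, ite_and] at this ⊢
    linear_combination this / 2

/-- The Chevalley generators generate `so₈`. -/
theorem lieSubalgebra_eq_top (L : LieSubalgebra ℂ so8) (he : ∀ i, chevE i ∈ L)
    (hf : ∀ i, chevF i ∈ L) : L = ⊤ := by
  have hM : ∀ {i j k : Fin 4}, i ≠ k → rootMinus i j ∈ L → rootMinus j k ∈ L →
      rootMinus i k ∈ L := fun hik h1 h2 => lie_rootMinus_rootMinus hik ▸ L.lie_mem h1 h2
  have m01 : rootMinus 0 1 ∈ L := he 0
  have m12 : rootMinus 1 2 ∈ L := he 1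
  have m23 : rootMinus 2 3 ∈ L := he 2
  have m10 : rootMinus 1 0 ∈ L := hf 0
  have m21 : rootMinus 2 1 ∈ L := hf 1
  have m32 : rootMinus 3 2 ∈ L := hf 2
  have m02 := hM (by decide) m01 m12
  have m13 := hM (by decide) m12 m23
  have m03 := hM (by decide) m02 m23
  have m20 := hM (by decide) m21 m10
  have m31 := hM (by decide) m32 m21
  have m30 := hM (by decide) m32 m20
  have hm : ∀ i j, i ≠ j → rootMinus i j ∈ L := fun i j hij => by
    fin_cases i <;> fin_cases j <;> first | assumption | exact absurd rfl hij
  have hP : ∀ {i j k : Fin 4}, i ≠ j → j ≠ k → rootPlus j k ∈ L → rootPlus k i ∈ L :=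
    fun {i j k} hij hjk h => by
      rw [rootPlus_swap, ← lie_rootMinus_rootPlus hjk]
      exact neg_mem (L.lie_mem (hm _ _ hij) h)
  have hN : ∀ {i j k : Fin 4}, i ≠ j → j ≠ k → rootNeg j k ∈ L → rootNeg k i ∈ L :=
    fun hij hjk h => by
      rw [← lie_rootMinus_rootNeg hjk]
      exact L.lie_mem (hm _ _ hij.symm) h
  have p23 : rootPlus 2 3 ∈ L := he 3
  have n23 : rootNeg 2 3 ∈ L := hf 3
  have hroot : ∀ {R : Fin 4 → Fin 4 → so8}, (∀ i j, R j i = -R i j) → R 2 3 ∈ L →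
      (∀ {i j k : Fin 4}, i ≠ j → j ≠ k → R j k ∈ L → R k i ∈ L) →
      ∀ i j, R i j ∈ L := fun {R} hR r23 hstep => by
    have r30 := hstep (i := 0) (by decide) (by decide) r23
    have r31 := hstep (i := 1) (by decide) (by decide) r23
    have r01 := hstep (i := 1) (by decide) (by decide) r30
    have r02 := hstep (i := 2) (by decide) (by decide) r30
    have r12 := hstep (i := 2) (by decide) (by decide) r31
    have r0 : ∀ i, R i i ∈ L := fun i => by
      have : R i i = 0 := by
        have h2 : (2 : ℂ) • R i i = 0 := by
          rw [two_smul]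
          exact eq_neg_iff_add_eq_zero.1 (hR i i)
        simpa using h2
      rw [this]
      exact zero_mem L
    intro i j
    fin_cases i <;> fin_cases j <;>
      first | exact r0 _ | assumption | (rw [hR]; exact neg_mem (by assumption))
  have hp := hroot rootPlus_swap p23 hP
  have hn := hroot rootNeg_swap n23 hN
  have h23 : rootMinus 2 2 + rootMinus 3 3 ∈ L :=
    lie_rootPlus_rootNeg (i := 2) (j := 3) (by decide) ▸ L.lie_mem p23 n23
  have hd : ∀ i j, i ≠ j → rootMinus i i - rootMinus j j ∈ L := fun i j hij =>
    lie_rootMinus_symm i j ▸ L.lie_mem (hm _ _ hij) (hm _ _ hij.symm)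
  have h33 : rootMinus 3 3 ∈ L := by
    have : rootMinus 3 3 = (2⁻¹ : ℂ) • ((rootMinus 2 2 + rootMinus 3 3) -
      (rootMinus 2 2 - rootMinus 3 3)) := by module
    rw [this]
    exact L.smul_mem _ (sub_mem h23 (hd 2 3 (by decide)))
  have hm' : ∀ i j, rootMinus i j ∈ L := fun i j => by
    by_cases hij : i = j
    · subst hij
      by_cases hi : i = 3
      · rwa [hi]
      · simpa using add_mem (hd i 3 hi) h33
    · exact hm i j hij
  refine eq_top_iff.2 fun M _ => ?_
  rw [eq_sum_root M]
  exact sum_mem fun i _ => sum_mem fun j _ => add_mem (add_mem (L.smul_mem _ (hm' i j))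
    (L.smul_mem _ (hp i j))) (L.smul_mem _ (hn i j))

theorem eq_of_isAffineDiagramAction {ρ ρ' : Representation ℂ (Equiv.Perm (Fin 4)) so8}
    (h : IsAffineDiagramAction ρ) (h' : IsAffineDiagramAction ρ') : ρ = ρ' := by
  -- automorphisms that agree on the Chevalley generators are equal
  have key : ∀ σ, (∀ i, ρ σ (chevE i) = ρ' σ (chevE i)) → (∀ i, ρ σ (chevF i) = ρ' σ (chevF i)) →
      ρ σ = ρ' σ := fun σ he hf => by
    let L : LieSubalgebra ℂ so8 :=
      { LinearMap.eqLocus (ρ σ) (ρ' σ) with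
        lie_mem' := fun {X Y} hX hY => by
          change ρ σ ⁅X, Y⁆ = ρ' σ ⁅X, Y⁆
          rw [h.map_lie, h'.map_lie, show ρ σ X = ρ' σ X from hX, show ρ σ Y = ρ' σ Y from hY] }
    have hL := lieSubalgebra_eq_top L he hf
    exact LinearMap.ext fun X => (hL ▸ LieSubalgebra.mem_top X : X ∈ L)
  have h01 : ρ (Equiv.swap 0 1) = ρ' (Equiv.swap 0 1) :=
    key _ (fun i => by rw [h.swap12_e, h'.swap12_e]) (fun i => by rw [h.swap12_f, h'.swap12_f])
  have h12 : ρ (Equiv.swap 1 2) = ρ' (Equiv.swap 1 2) :=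
    key _ (fun i => by rw [h.swap23_e, h'.swap23_e]) (fun i => by rw [h.swap23_f, h'.swap23_f])
  have h23 : ρ (Equiv.swap 2 3) = ρ' (Equiv.swap 2 3) :=
    LinearMap.ext fun X => by rw [h.swap34, h'.swap34, h01]
  refine MonoidHom.eq_of_eqOn_denseM (Equiv.Perm.mclosure_swap_castSucc_succ 3) ?_
  rintro _ ⟨i, rfl⟩
  fin_cases i
  · exact h01
  · exact h12
  · exact h23

/-! ### The cone of decomposable isotropic bivectors -/

/-- The symmetric bilinear form on `ℂ⁸` that defines `so₈`. -/
def splitForm (a b : Idx → ℂ) : ℂ := ∑ k, a k * b k.swap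

theorem splitForm_comm (a b : Idx → ℂ) : splitForm a b = splitForm b a := by
  unfold splitForm
  rw [← (Equiv.sumComm (Fin 4) (Fin 4)).sum_comp]
  exact Finset.sum_congr rfl fun k _ => by simp [mul_comm]

/-- The bivector `a ∧ b` as an element of `so₈`: the operator `v ↦ (b, v) a - (a, v) b`. -/
def wedge (a b : Idx → ℂ) : so8 :=
  ⟨Matrix.of fun k l => a k * b l.swap - b k * a l.swap, (mem_so8_iff_apply _).2 fun k l => by
    simp only [Matrix.of_apply, Sum.swap_swap]; ring⟩

theorem wedge_apply (a b : Idx → ℂ) (k l : Idx) :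
    (wedge a b).1 k l = a k * b l.swap - b k * a l.swap := rfl

/-- The Plücker coordinates of an element of `so₈`, considered as a bivector. -/
def plucker (M : so8) (k l : Idx) : ℂ := M.1 k l.swap

theorem plucker_wedge (a b : Idx → ℂ) (k l : Idx) :
    plucker (wedge a b) k l = a k * b l - b k * a l := by
  simp [plucker, wedge_apply]

theorem plucker_swap (M : so8) (k l : Idx) : plucker M l k = -plucker M k l := by
  rw [plucker, plucker, so8_apply, Sum.swap_swap]

theorem smul_wedge (c : ℂ) (a b : Idx → ℂ) : c • wedge a b = wedge (c • a) b := by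
  apply Subtype.ext
  ext k l
  change c * (wedge a b).1 k l = (wedge (c • a) b).1 k l
  simp only [wedge_apply, Pi.smul_apply, smul_eq_mul]
  ring

theorem wedge_sq_apply (a b : Idx → ℂ) (k l : Idx) :
    ((wedge a b).1 * (wedge a b).1) k l.swap = splitForm a b * (a k * b l + b k * a l) -
      splitForm b b * (a k * a l) - splitForm a a * (b k * b l) := by
  have h : splitForm a b * (a k * b l + b k * a l) =
      splitForm a b * (a k * b l) + splitForm b a * (b k * a l) := by
    rw [splitForm_comm b a]; ring
  rw [h, Matrix.mul_apply]
  unfold splitForm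
  simp only [wedge_apply, Sum.swap_swap, Finset.sum_mul, ← Finset.sum_add_distrib,
    ← Finset.sum_sub_distrib]
  exact Finset.sum_congr rfl fun j _ => by ring

/-- The set of bivectors `a ∧ b` with `a`, `b` spanning a totally isotropic subspace. Its nonzero
elements form the minimal nilpotent orbit. -/
def minCone : Set so8 :=
  {M | ∃ a b, splitForm a a = 0 ∧ splitForm a b = 0 ∧ splitForm b b = 0 ∧ M = wedge a b}

theorem sq_eq_zero_of_mem_minCone {M : so8} (hM : M ∈ minCone) : M.1 * M.1 = 0 := by
  obtain ⟨a, b, haa, hab, hbb, rfl⟩ := hM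
  ext k l
  rw [← Sum.swap_swap l, wedge_sq_apply, haa, hab, hbb]
  simp

theorem plucker_relation {M : so8} (hM : M ∈ minCone) (k l m n : Idx) :
    plucker M k l * plucker M m n - plucker M k m * plucker M l n +
      plucker M k n * plucker M l m = 0 := by
  obtain ⟨a, b, -, -, -, rfl⟩ := hM
  simp only [plucker_wedge]
  ring

theorem smul_mem_minCone (c : ℂ) {M : so8} (hM : M ∈ minCone) : c • M ∈ minCone := by
  obtain ⟨a, b, haa, hab, hbb, rfl⟩ := hM
  refine ⟨c • a, b, ?_, ?_, hbb, smul_wedge c a b⟩ <;>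
    simp only [splitForm, Pi.smul_apply, smul_eq_mul, mul_assoc, mul_left_comm _ c,
      ← Finset.mul_sum] at haa hab ⊢ <;> simp [haa, hab]

/-! ### The adjoint action of `SO₈` -/

theorem SO8_inv_apply (g : SO8) (k l : Idx) : (g⁻¹ : SO8).1.1 k l = g.1.1 l.swap k.swap := by
  have h : (g.1.1)ᵀ * LieAlgebra.Orthogonal.JD (Fin 4) ℂ * g.1.1 =
      LieAlgebra.Orthogonal.JD (Fin 4) ℂ := g.2
  have h1 : g.1.1 * (g⁻¹ : SO8).1.1 = 1 :=
    congrArg (fun x : SO8 => x.1.1) (mul_inv_cancel g)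
  have h2 : (g.1.1)ᵀ * LieAlgebra.Orthogonal.JD (Fin 4) ℂ =
      LieAlgebra.Orthogonal.JD (Fin 4) ℂ * (g⁻¹ : SO8).1.1 := by
    calc _ = (g.1.1)ᵀ * LieAlgebra.Orthogonal.JD (Fin 4) ℂ * (g.1.1 * (g⁻¹ : SO8).1.1) := by
          rw [h1, mul_one]
      _ = _ := by rw [← Matrix.mul_assoc, h]
  have h3 := congrFun (congrFun h2 k.swap) l
  rw [mul_JD_apply, JD_mul_apply, Sum.swap_swap] at h3
  exact h3.symm

theorem splitForm_mulVec (g : SO8) (a b : Idx → ℂ) :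
    splitForm (g.1.1 *ᵥ a) (g.1.1 *ᵥ b) = splitForm a b := by
  have e : ∀ a b : Idx → ℂ, splitForm a b = a ⬝ᵥ (LieAlgebra.Orthogonal.JD (Fin 4) ℂ *ᵥ b) := by
    intro a b
    simp only [splitForm, dotProduct]
    refine Finset.sum_congr rfl fun k _ => ?_
    congr 1
    have := JD_mul_apply (Matrix.of fun k (_ : Idx) => b k) k k
    exact this.symm
  have h : (g.1.1)ᵀ * LieAlgebra.Orthogonal.JD (Fin 4) ℂ * g.1.1 =
      LieAlgebra.Orthogonal.JD (Fin 4) ℂ := g.2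
  rw [e, e, ← Matrix.vecMul_transpose, ← Matrix.dotProduct_mulVec, Matrix.mulVec_mulVec,
    Matrix.mulVec_mulVec, h]

theorem Ad_apply (g : SO8) (M : so8) (k l : Idx) :
    (Ad g M).1 k l = ∑ i, ∑ j, g.1.1 k i * M.1 i j * g.1.1 l.swap j.swap := by
  change (g.1.1 * M.1 * (g⁻¹ : SO8).1.1) k l = _
  simp only [Matrix.mul_apply, SO8_inv_apply, Finset.sum_mul]
  exact Finset.sum_comm

theorem plucker_Ad (g : SO8) (M : so8) (k l : Idx) :
    plucker (Ad g M) k l = ∑ i, ∑ j, g.1.1 k i * plucker M i j * g.1.1 l j := by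
  rw [plucker, Ad_apply, Sum.swap_swap]
  refine Finset.sum_congr rfl fun i _ => ?_
  rw [← (Equiv.sumComm (Fin 4) (Fin 4)).sum_comp]
  simp [plucker]

theorem so8_ext_plucker {M N : so8} (h : ∀ k l, plucker M k l = plucker N k l) : M = N := by
  apply Subtype.ext
  ext k l
  simpa [plucker] using h k l.swap

theorem Ad_wedge (g : SO8) (a b : Idx → ℂ) :
    Ad g (wedge a b) = wedge (g.1.1 *ᵥ a) (g.1.1 *ᵥ b) := by
  refine so8_ext_plucker fun k l => ?_
  rw [plucker_Ad, plucker_wedge]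
  simp only [plucker_wedge, Matrix.mulVec, dotProduct, Finset.sum_mul_sum, ← Finset.sum_sub_distrib]
  exact Finset.sum_congr rfl fun i _ => Finset.sum_congr rfl fun j _ => by ring

theorem Ad_mem_minCone (g : SO8) {M : so8} (hM : M ∈ minCone) : Ad g M ∈ minCone := by
  obtain ⟨a, b, haa, hab, hbb, rfl⟩ := hM
  exact ⟨_, _, by rwa [splitForm_mulVec], by rwa [splitForm_mulVec], by rwa [splitForm_mulVec],
    Ad_wedge g a b⟩

theorem Ad_smul (g : SO8) (c : ℂ) (M : so8) : Ad g (c • M) = c • Ad g M := by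
  apply Subtype.ext
  change g.1.1 * (c • M.1) * _ = c • (g.1.1 * M.1 * _)
  rw [Matrix.mul_smul, Matrix.smul_mul]

theorem Ad_mul (g h : SO8) (M : so8) : Ad (g * h) M = Ad g (Ad h M) := by
  apply Subtype.ext
  change (g.1.1 * h.1.1) * M.1 * ((g * h)⁻¹ : SO8).1.1 = g.1.1 * (h.1.1 * M.1 * (h⁻¹ : SO8).1.1) *
    (g⁻¹ : SO8).1.1
  rw [mul_inv_rev]
  change (g.1.1 * h.1.1) * M.1 * ((h⁻¹ : SO8).1.1 * (g⁻¹ : SO8).1.1) = _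
  simp only [Matrix.mul_assoc]

theorem Ad_one (M : so8) : Ad 1 M = M := by
  apply Subtype.ext
  change (1 : Matrix Idx Idx ℂ) * M.1 * ((1 : SO8)⁻¹).1.1 = M.1
  rw [inv_one]
  change (1 : Matrix Idx Idx ℂ) * M.1 * 1 = M.1
  rw [one_mul, mul_one]

theorem Ad_inv_Ad (g : SO8) (M : so8) : Ad g⁻¹ (Ad g M) = M := by
  rw [← Ad_mul, inv_mul_cancel, Ad_one]

theorem rootPlus_eq_wedge : rootPlus 0 1 = wedge (Pi.single (.inl 0) 1) (Pi.single (.inl 1) 1) := by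
  refine so8_ext (fun k l => ?_) (fun k l _ => ?_) (fun k l _ => ?_)
  · simp [rootPlus, wedge, Pi.single_apply]
  · simp [rootPlus, wedge, Matrix.single_apply, Pi.single_apply, eq_comm, ← ite_and, and_comm]
  · simp [rootPlus, wedge, Pi.single_apply]

theorem rootPlus_mem_minCone : rootPlus 0 1 ∈ minCone :=
  ⟨_, _, by simp [splitForm, Pi.single_apply], by simp [splitForm, Pi.single_apply],
    by simp [splitForm, Pi.single_apply], rootPlus_eq_wedge⟩

theorem minOrbit_subset_minCone : minOrbit ⊆ minCone := by
  rintro _ ⟨g, rfl⟩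
  exact Ad_mem_minCone g rootPlus_mem_minCone

/-! ### Unipotent elements of `SO₈` -/

theorem JD_mul_JD :
    LieAlgebra.Orthogonal.JD (Fin 4) ℂ * LieAlgebra.Orthogonal.JD (Fin 4) ℂ = 1 := by
  simp [LieAlgebra.Orthogonal.JD, Matrix.fromBlocks_multiply]

theorem one_add_preserves {N : Matrix Idx Idx ℂ} (hN : N ∈ so8) (h : N * N = 0) :
    (1 + N)ᵀ * LieAlgebra.Orthogonal.JD (Fin 4) ℂ * (1 + N) =
      LieAlgebra.Orthogonal.JD (Fin 4) ℂ := by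
  have := (mem_so8 N).1 hN
  have h2 : LieAlgebra.Orthogonal.JD (Fin 4) ℂ * -N * N = 0 := by
    rw [Matrix.mul_assoc, Matrix.neg_mul, h, neg_zero, Matrix.mul_zero]
  rw [Matrix.transpose_add, Matrix.transpose_one, add_mul, this, one_mul, mul_add, mul_one,
    add_mul, h2]
  simp

/-- The determinant of `1 + N` is a square, because `1 + N = (1 + N / 2) ^ 2`, and the square of
the determinant of an isometry is `1`. -/
theorem det_one_add {N : Matrix Idx Idx ℂ} (hN : N ∈ so8) (h : N * N = 0) : (1 + N).det = 1 := by
  have h1 : ((2⁻¹ : ℂ) • N) * ((2⁻¹ : ℂ) • N) = 0 := by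
    rw [Matrix.smul_mul, Matrix.mul_smul, h, smul_zero, smul_zero]
  have h2 := congrArg Matrix.det (one_add_preserves (so8.smul_mem (2⁻¹ : ℂ) hN) h1)
  have hJ : (LieAlgebra.Orthogonal.JD (Fin 4) ℂ).det ≠ 0 := fun h0 => by
    have := congrArg Matrix.det JD_mul_JD
    rw [Matrix.det_mul, h0] at this
    simp at this
  have h3 : 1 + N = (1 + (2⁻¹ : ℂ) • N) * (1 + (2⁻¹ : ℂ) • N) := by
    rw [mul_add, add_mul, add_mul, h1, one_mul, one_mul, mul_one]
    module
  rw [Matrix.det_mul, Matrix.det_mul, Matrix.det_transpose] at h2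
  rw [h3, Matrix.det_mul]
  exact mul_right_cancel₀ hJ (by linear_combination h2)

/-- The element `1 + N = exp N` of `SO₈`, for `N` in `so₈` with `N ^ 2 = 0`. -/
def oneAdd (N : so8) (h : N.1 * N.1 = 0) : SO8 :=
  ⟨⟨1 + N.1, det_one_add N.2 h⟩, one_add_preserves N.2 h⟩

theorem smul_mul_smul_eq_zero {N : so8} (h : N.1 * N.1 = 0) (t : ℂ) :
    (t • N).1 * (t • N).1 = 0 := by
  change (t • N.1) * (t • N.1) = 0
  rw [Matrix.smul_mul, Matrix.mul_smul, h, smul_zero, smul_zero]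

/-- The algebra of polynomial functions on `ℂ`. -/
def polyCurve : Subalgebra ℂ (ℂ → ℂ) := (Polynomial.aeval (id : ℂ → ℂ)).range

theorem aeval_id_apply (p : Polynomial ℂ) (t : ℂ) :
    Polynomial.aeval (id : ℂ → ℂ) p t = p.eval t := by
  induction p using Polynomial.induction_on' with
  | add p q hp hq => simp
  | monomial n a => simp

theorem id_mem_polyCurve : (fun t => t) ∈ polyCurve := ⟨Polynomial.X, by simp; rfl⟩

theorem const_mem_polyCurve (c : ℂ) : (fun _ => c) ∈ polyCurve := polyCurve.algebraMap_mem c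

theorem eq_zero_of_mul_eq_zero {f g : ℂ → ℂ} (hf : f ∈ polyCurve) (hg : g ∈ polyCurve)
    (h : ∀ t, f t * g t = 0) {s : ℂ} (hs : g s ≠ 0) (t : ℂ) : f t = 0 := by
  obtain ⟨p, rfl⟩ := hf
  obtain ⟨q, rfl⟩ := hg
  simp only [AlgHom.toRingHom_eq_coe, RingHom.coe_coe, aeval_id_apply] at *
  have hpq : p * q = 0 := Polynomial.funext fun t => by simpa using h t
  rcases mul_eq_zero.1 hpq with hp | hq
  · simp [hp]
  · simp [hq] at hs

/-- The elements of `SO₈` that are joined to the identity by a curve with polynomial entries. -/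
def polyConn : Subgroup SO8 where
  carrier := {g | ∃ c : ℂ → SO8, c 0 = 1 ∧ c 1 = g ∧
    ∀ k l, (fun t => (c t).1.1 k l) ∈ polyCurve}
  one_mem' := ⟨fun _ => 1, rfl, rfl, fun _ _ => const_mem_polyCurve _⟩
  mul_mem' := by
    rintro _ _ ⟨c, hc, rfl, hp⟩ ⟨d, hd, rfl, hq⟩
    refine ⟨fun t => c t * d t, by simp only [hc, hd, mul_one], rfl, fun k l => ?_⟩
    have : (fun t => (c t * d t).1.1 k l) =
        ∑ j, (fun t => (c t).1.1 k j) * (fun t => (d t).1.1 j l) := by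
      ext t
      rw [Finset.sum_apply]
      exact Matrix.mul_apply
    rw [this]
    exact sum_mem fun j _ => mul_mem (hp k j) (hq j l)
  inv_mem' := by
    rintro _ ⟨c, hc, rfl, hp⟩
    refine ⟨fun t => (c t)⁻¹, by simp only [hc, inv_one], rfl, fun k l => ?_⟩
    simp only [SO8_inv_apply]
    exact hp _ _

theorem oneAdd_mem_polyConn (N : so8) (h : N.1 * N.1 = 0) : oneAdd N h ∈ polyConn := by
  refine ⟨fun t => oneAdd (t • N) (smul_mul_smul_eq_zero h t), ?_, ?_, fun k l => ?_⟩
  · apply Subtype.ext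
    apply Subtype.ext
    change 1 + (0 : ℂ) • N.1 = 1
    rw [zero_smul, add_zero]
  · apply Subtype.ext
    apply Subtype.ext
    change 1 + (1 : ℂ) • N.1 = 1 + N.1
    rw [one_smul]
  · change (fun t => (1 : Matrix Idx Idx ℂ) k l + t * N.1 k l) ∈ polyCurve
    exact add_mem (const_mem_polyCurve _) (mul_mem id_mem_polyCurve (const_mem_polyCurve _))

/-! ### Transitivity on the cone -/

/-- A root vector of `so₈` as a matrix unit, made skew. -/
def rootVec (k l : Idx) : so8 :=
  ⟨Matrix.of fun i j => (if i = k ∧ j = l then 1 else 0) - if j.swap = k ∧ i.swap = l then 1 else 0,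
    (mem_so8_iff_apply _).2 fun i j => by simp only [Matrix.of_apply, Sum.swap_swap]; ring⟩

theorem rootVec_sq {k l : Idx} (h : k ≠ l) (h' : k ≠ l.swap) :
    (rootVec k l).1 * (rootVec k l).1 = 0 := by
  ext i j
  rw [Matrix.mul_apply]
  refine Finset.sum_eq_zero fun m _ => ?_
  have hs : ∀ a b : Idx, a.swap = b ↔ a = b.swap := fun a b =>
    ⟨fun h => by rw [← h, Sum.swap_swap], fun h => by rw [h, Sum.swap_swap]⟩
  simp only [rootVec, Matrix.of_apply, hs]
  grind

/-- The element `1 + N`, for the root vector `N` at `(m, l)`, adds the Plücker coordinate `(k, l)`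
to the coordinate `(k, m)`. -/
theorem exists_plucker_ne_zero {M : so8} {k l m : Idx} (h : plucker M k l ≠ 0)
    (hml : m ≠ l) (hml' : m ≠ l.swap) (hkm : k ≠ m) (hkl : k ≠ l.swap) :
    ∃ g ∈ polyConn, plucker (Ad g M) k m ≠ 0 := by
  by_cases h0 : plucker M k m = 0
  · refine ⟨oneAdd (rootVec m l) (rootVec_sq hml hml'), oneAdd_mem_polyConn _ _, ?_⟩
    have hk : ∀ i, (1 + (rootVec m l).1) k i = (1 : Matrix Idx Idx ℂ) k i := fun i => by
      have : k.swap ≠ l := fun h => hkl (by rw [← h, Sum.swap_swap])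
      simp [rootVec, hkm, this]
    have hm : ∀ j, (1 + (rootVec m l).1) m j =
        (1 : Matrix Idx Idx ℂ) m j + if j = l then 1 else 0 := fun j => by
      have : m.swap ≠ l := fun h => hml' (by rw [← h, Sum.swap_swap])
      simp [rootVec, this]
    rw [plucker_Ad]
    change ∑ i, ∑ j, (1 + (rootVec m l).1) k i * plucker M i j * (1 + (rootVec m l).1) m j ≠ 0
    simp only [hk, hm]
    simpa [Matrix.one_apply, mul_add, Finset.sum_add_distrib, h0] using h
  · exact ⟨1, one_mem _, by rwa [Ad_one]⟩

/-- The pair of dual basis vectors that contains a given basis vector. -/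
def absIdx : Idx → Fin 4 := Sum.elim id id

theorem exists_plucker_Ad_ne_zero {M : so8} {k l m : Idx} (h : plucker M k l ≠ 0)
    (hkl : absIdx k ≠ absIdx l) (hml : absIdx m ≠ absIdx l) (hmk : absIdx m ≠ absIdx k) :
    ∃ g ∈ polyConn, plucker (Ad g M) k m ≠ 0 := by
  have hs : ∀ l, absIdx l.swap = absIdx l := by decide
  refine exists_plucker_ne_zero h ?_ ?_ ?_ ?_ <;> rintro rfl
  · exact hml rfl
  · exact hml (hs _)
  · exact hmk rfl
  · exact hkl (hs _)

theorem eq_zero_of_plucker_eq_zero {M : so8} (hM : M.1 * M.1 = 0)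
    (h : ∀ k l, absIdx k ≠ absIdx l → plucker M k l = 0) : M = 0 := by
  have h1 : ∀ k l, k ≠ l → M.1 k l = 0 := fun k l hkl => by
    have hp : M.1 k l = plucker M k l.swap := by rw [plucker, Sum.swap_swap]
    rw [hp]
    by_cases ha : absIdx k = absIdx l.swap
    · have : ∀ k l : Idx, k ≠ l → absIdx k = absIdx l.swap → k = l.swap := by decide
      rw [← this k l hkl ha]
      have := plucker_swap M k k
      linear_combination this / 2
    · exact h _ _ ha
  apply Subtype.ext
  ext k l
  by_cases hkl : k = l
  · subst hkl
    have := congrFun (congrFun hM k) k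
    rw [Matrix.mul_apply, Finset.sum_eq_single k
      (fun j _ hj => by rw [h1 k j hj.symm, zero_mul]) (by simp)] at this
    exact mul_self_eq_zero.1 this
  · exact h1 k l hkl

/-- Every nonzero element of the cone can be moved, within the group of polynomially connected
elements, to the chart in which the highest weight coordinate does not vanish. -/
theorem exists_plucker_zero_one_ne_zero {M : so8} (hM : M ∈ minCone) (h0 : M ≠ 0) :
    ∃ g ∈ polyConn, plucker (Ad g M) (.inl 0) (.inl 1) ≠ 0 := by
  let P : Idx → Idx → Prop := fun k l => ∃ g ∈ polyConn, plucker (Ad g M) k l ≠ 0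
  have hP : ∀ {k l}, P k l → P l k := fun {k l} ⟨g, hg, h⟩ =>
    ⟨g, hg, by rwa [plucker_swap, neg_ne_zero]⟩
  have hstep : ∀ {k l m}, P k l → absIdx k ≠ absIdx l → absIdx m ≠ absIdx l → absIdx m ≠ absIdx k →
      P k m := fun {k l m} ⟨g, hg, h⟩ h1 h2 h3 => by
    obtain ⟨g', hg', h'⟩ := exists_plucker_Ad_ne_zero h h1 h2 h3
    exact ⟨g' * g, mul_mem hg' hg, by rwa [Ad_mul]⟩
  -- one index of a pair can be moved away from `0` and `1`
  have hhigh : ∀ {k l}, P k l → absIdx k ≠ absIdx l →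
      ∃ l', 2 ≤ absIdx l' ∧ absIdx k ≠ absIdx l' ∧ P k l' := fun {k l} h hkl => by
    have : ∀ k l : Idx, absIdx k ≠ absIdx l → ∃ l', 2 ≤ absIdx l' ∧ absIdx k ≠ absIdx l' ∧
        (l' = l ∨ absIdx l' ≠ absIdx l) := by decide
    obtain ⟨l', h2, hk, rfl | hl⟩ := this k l hkl
    · exact ⟨_, h2, hk, h⟩
    · exact ⟨l', h2, hk, hstep h hkl hl hk.symm⟩
  obtain ⟨k, l, hkl, h⟩ : ∃ k l, absIdx k ≠ absIdx l ∧ plucker M k l ≠ 0 := by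
    by_contra! h
    exact h0 (eq_zero_of_plucker_eq_zero (sq_eq_zero_of_mem_minCone hM) h)
  have hPkl : P k l := ⟨1, one_mem _, by rwa [Ad_one]⟩
  obtain ⟨l', hl', hkl', h1⟩ := hhigh hPkl hkl
  obtain ⟨k', hk', hkl'', h2⟩ := hhigh (hP h1) hkl'.symm
  have n0 : ∀ i : Fin 4, 2 ≤ i → 0 ≠ i := by decide
  have n1 : ∀ i : Fin 4, 2 ≤ i → 1 ≠ i := by decide
  have h3 : P l' (.inl 1) := hstep h2 hkl'' (n1 _ hk') (n1 _ hl')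
  have h4 : P (.inl 1) (.inl 0) := hstep (hP h3) (n1 _ hl') (n0 _ hl') (by decide)
  exact hP h4

/-- In the chart, the bivector is obtained from the highest weight vector by a product of a lower
triangular unipotent element of the Levi subgroup `GL₄` and one of the opposite unipotent
radical. -/
theorem exists_Ad_eq_of_plucker_ne_zero {M : so8} (hM : M ∈ minCone)
    (h : plucker M (.inl 0) (.inl 1) ≠ 0) :
    ∃ g ∈ polyConn, M = Ad g (plucker M (.inl 0) (.inl 1) • rootPlus 0 1) := by
  set c := plucker M (.inl 0) (.inl 1) with hc
  set a : Idx → ℂ := fun k => plucker M k (.inl 1) / c with ha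
  set b : Idx → ℂ := fun k => plucker M (.inl 0) k / c with hb
  have hself : ∀ k, plucker M k k = 0 := fun k => by
    have := plucker_swap M k k
    linear_combination this / 2
  -- the Plücker relations express all coordinates in terms of those that involve `0` or `1`
  have hMab : M = c • wedge a b := so8_ext_plucker fun k l => by
    change _ = c * plucker (wedge a b) k l
    have hr := plucker_relation hM (.inl 0) (.inl 1) k l
    have h1 := plucker_swap M (.inl 1) k
    have h2 := plucker_swap M (.inl 1) l
    rw [plucker_wedge, ha, hb]
    simp only []
    field_simp
    rw [h1, h2]
    linear_combination hr
  have a0 : a (.inl 0) = 1 := div_self h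
  have a1 : a (.inl 1) = 0 := by simp [ha, hself]
  have b0 : b (.inl 0) = 0 := by simp [hb, hself]
  have b1 : b (.inl 1) = 1 := div_self h
  have hsq : ∀ k l : Idx, ((wedge a b).1 * (wedge a b).1) k l.swap = 0 := fun k l => by
    have h1 := sq_eq_zero_of_mem_minCone (smul_mem_minCone c⁻¹ hM)
    rw [hMab, smul_smul, inv_mul_cancel₀ h, one_smul] at h1
    rw [h1]
    rfl
  have hbb := hsq (.inl 0) (.inl 0)
  have haa := hsq (.inl 1) (.inl 1)
  have hab := hsq (.inl 0) (.inl 1)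
  rw [wedge_sq_apply, a0, b0] at hbb
  rw [wedge_sq_apply, a1, b1] at haa
  rw [wedge_sq_apply, a0, b0, a1, b1] at hab
  simp [splitForm, Fintype.sum_sum_type, Fin.sum_univ_four, a0, a1, b0, b1] at haa hab hbb
  clear_value a b
  have hA : !![0, 0, 0, 0; 0, 0, 0, 0; a (.inl 2), b (.inl 2), 0, 0;
      a (.inl 3), b (.inl 3), 0, 0] * !![0, 0, 0, 0; 0, 0, 0, 0; a (.inl 2), b (.inl 2), 0, 0;
      a (.inl 3), b (.inl 3), 0, 0] = 0 := by
    ext i j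
    fin_cases i <;> fin_cases j <;> simp [Matrix.mul_apply, Fin.sum_univ_four]
  generalize hAdef : !![0, 0, 0, 0; 0, 0, 0, 0; a (.inl 2), b (.inl 2), 0, 0;
    a (.inl 3), b (.inl 3), 0, 0] = A at hA
  -- the two nilpotent elements have the blocks `A` and `C` and are zero elsewhere
  generalize hCdef : !![0, -(a (.inr 1) + b (.inr 2) * a (.inl 2) + b (.inr 3) * a (.inl 3)),
      -a (.inr 2), -a (.inr 3);
    a (.inr 1) + b (.inr 2) * a (.inl 2) + b (.inr 3) * a (.inl 3), 0, -b (.inr 2), -b (.inr 3);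
    a (.inr 2), b (.inr 2), 0, 0; a (.inr 3), b (.inr 3), 0, 0] = C
  have hC : Cᵀ = -C := by
    subst hCdef
    ext i j
    fin_cases i <;> fin_cases j <;> simp
  have hN1 : (⟨_, fromBlocks_mem_so8 A 0 0 (by simp) (by simp)⟩ : so8).1 *
      (⟨_, fromBlocks_mem_so8 A 0 0 (by simp) (by simp)⟩ : so8).1 = 0 := by
    simp [Matrix.fromBlocks_multiply, hA, ← Matrix.transpose_mul]
  have hN2 : (⟨_, fromBlocks_mem_so8 0 0 C (by simp) hC⟩ : so8).1 *
      (⟨_, fromBlocks_mem_so8 0 0 C (by simp) hC⟩ : so8).1 = 0 := by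
    simp [Matrix.fromBlocks_multiply]
  refine ⟨oneAdd _ hN2 * oneAdd _ hN1, mul_mem (oneAdd_mem_polyConn _ _)
    (oneAdd_mem_polyConn _ _), ?_⟩
  have hg : ((oneAdd _ hN2 * oneAdd _ hN1 : SO8).1.1) =
      Matrix.fromBlocks (1 + A) 0 (C + C * A) (1 - Aᵀ) := by
    change (1 + Matrix.fromBlocks _ _ _ _) * (1 + Matrix.fromBlocks _ _ _ _) = _
    rw [← Matrix.fromBlocks_one, Matrix.fromBlocks_add, Matrix.fromBlocks_add,
      Matrix.fromBlocks_multiply]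
    simp [sub_eq_add_neg, mul_add]
  rw [Ad_smul, rootPlus_eq_wedge, Ad_wedge, hg, Matrix.mulVec_single_one, Matrix.mulVec_single_one]
  refine hMab.trans (congrArg (c • ·) ?_)
  congr 1
  · ext k
    subst hAdef hCdef
    rcases k with k | k <;> fin_cases k <;>
      simp [a0, a1] <;>
      first | ring1 | linear_combination -haa / 2
  · ext k
    subst hAdef hCdef
    rcases k with k | k <;> fin_cases k <;>
      simp [b0, b1] <;>
      first | ring1 | linear_combination hab | linear_combination -hbb / 2

/-! ### The cone is the closure of the minimal orbit, and it is irreducible -/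

theorem exists_eq_Ad_smul {M : so8} (hM : M ∈ minCone) :
    ∃ g ∈ polyConn, ∃ c : ℂ, M = Ad g (c • rootPlus 0 1) := by
  by_cases h0 : M = 0
  · exact ⟨1, one_mem _, 0, by rw [Ad_one, zero_smul, h0]⟩
  · obtain ⟨g, hg, h⟩ := exists_plucker_zero_one_ne_zero hM h0
    obtain ⟨g', hg', h'⟩ := exists_Ad_eq_of_plucker_ne_zero (Ad_mem_minCone g hM) h
    exact ⟨g⁻¹ * g', mul_mem (inv_mem hg) hg', _, by rw [Ad_mul, ← h', Ad_inv_Ad]⟩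

theorem dual_comp_mem_polyCurve {γ : ℂ → so8}
    (hγ : ∀ k l, (fun t => (γ t).1 k l) ∈ polyCurve) (φ : Module.Dual ℂ so8) :
    (fun t => φ (γ t)) ∈ polyCurve := by
  obtain ⟨ψ, hψ⟩ := LinearMap.exists_extend (p := so8.toSubmodule) φ
  have : (fun t => φ (γ t)) = ∑ k, ∑ l, ψ (Matrix.single k l 1) • fun t => (γ t).1 k l := by
    ext t
    have h1 : φ (γ t) = ψ (γ t).1 := by rw [← hψ]; rfl
    rw [h1, Matrix.matrix_eq_sum_single (γ t).1]
    simp only [map_sum, Finset.sum_apply, Pi.smul_apply, smul_eq_mul]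
    refine Finset.sum_congr rfl fun k _ => Finset.sum_congr rfl fun l _ => ?_
    have : Matrix.single k l ((γ t).1 k l) = (γ t).1 k l • Matrix.single k l (1 : ℂ) := by
      rw [Matrix.smul_single, smul_eq_mul, mul_one]
    rw [this, map_smul, smul_eq_mul, mul_comm]
  rw [this]
  exact sum_mem fun k _ => sum_mem fun l _ => polyCurve.smul_mem (hγ k l) _

theorem polyFun_comp_mem_polyCurve {γ : ℂ → so8}
    (hγ : ∀ k l, (fun t => (γ t).1 k l) ∈ polyCurve) {f : so8 → ℂ} (hf : f ∈ polyFun so8) :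
    (fun t => f (γ t)) ∈ polyCurve := by
  induction hf using Algebra.adjoin_induction with
  | mem f hf =>
    obtain ⟨φ, rfl⟩ := hf
    exact dual_comp_mem_polyCurve hγ φ
  | algebraMap r => exact polyCurve.algebraMap_mem r
  | add f g _ _ hf hg => exact polyCurve.add_mem hf hg
  | mul f g _ _ hf hg => exact polyCurve.mul_mem hf hg

/-- Any two elements of the cone lie on a curve in it with polynomial entries. -/
theorem exists_curve {M₀ M₁ : so8} (h₀ : M₀ ∈ minCone) (h₁ : M₁ ∈ minCone) :
    ∃ γ : ℂ → so8, γ 0 = M₀ ∧ γ 1 = M₁ ∧ (∀ t, γ t ∈ minCone) ∧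
      ∀ k l, (fun t => (γ t).1 k l) ∈ polyCurve := by
  obtain ⟨g₀, hg₀, c₀, rfl⟩ := exists_eq_Ad_smul h₀
  obtain ⟨g₁, hg₁, c₁, rfl⟩ := exists_eq_Ad_smul h₁
  obtain ⟨d, hd0, hd1, hd⟩ := mul_mem (inv_mem hg₀) hg₁
  refine ⟨fun t => Ad (g₀ * d t) ((c₀ + t * (c₁ - c₀)) • rootPlus 0 1), ?_, ?_,
    fun t => Ad_mem_minCone _ (smul_mem_minCone _ rootPlus_mem_minCone), fun k l => ?_⟩
  · simp only [hd0, mul_one, zero_mul, add_zero]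
  · simp only [hd1, mul_inv_cancel_left, one_mul, add_sub_cancel]
  · have hg : ∀ k l, (fun t => (g₀ * d t).1.1 k l) ∈ polyCurve := fun k l => by
      have : (fun t => (g₀ * d t).1.1 k l) = ∑ j, g₀.1.1 k j • fun t => (d t).1.1 j l := by
        ext t
        simp only [Finset.sum_apply]
        exact Matrix.mul_apply
      rw [this]
      exact sum_mem fun j _ => polyCurve.smul_mem (hd j l) _
    have hc : (fun t => c₀ + t * (c₁ - c₀)) ∈ polyCurve :=
      add_mem (const_mem_polyCurve _) (mul_mem id_mem_polyCurve (const_mem_polyCurve _))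
    have : (fun t => (Ad (g₀ * d t) ((c₀ + t * (c₁ - c₀)) • rootPlus 0 1)).1 k l) =
        ∑ i, ∑ j, (fun t => (g₀ * d t).1.1 k i) * (fun t => c₀ + t * (c₁ - c₀)) *
          (fun _ => (rootPlus 0 1).1 i j) * fun t => (g₀ * d t).1.1 l.swap j.swap := by
      ext t
      simp only [Ad_smul, Finset.sum_apply, Pi.mul_apply]
      change (c₀ + t * (c₁ - c₀)) * (Ad (g₀ * d t) (rootPlus 0 1)).1 k l = _
      simp only [Ad_apply, Finset.mul_sum]
      exact Finset.sum_congr rfl fun i _ => Finset.sum_congr rfl fun j _ => by ring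
    rw [this]
    exact sum_mem fun i _ => sum_mem fun j _ =>
      mul_mem (mul_mem (mul_mem (hg _ _) hc) (const_mem_polyCurve _)) (hg _ _)

/-- A polynomial function that vanishes on a nonempty principal open subset of the cone vanishes
on the cone. -/
theorem eq_zero_on_minCone {f d : so8 → ℂ} (hf : f ∈ polyFun so8) (hd : d ∈ polyFun so8)
    (h : ∀ M ∈ minCone, d M ≠ 0 → f M = 0) {M₁ : so8} (h₁ : M₁ ∈ minCone) (hd₁ : d M₁ ≠ 0)
    {M : so8} (hM : M ∈ minCone) : f M = 0 := by
  obtain ⟨γ, rfl, rfl, hγ, hp⟩ := exists_curve hM h₁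
  refine eq_zero_of_mul_eq_zero (polyFun_comp_mem_polyCurve hp hf)
    (polyFun_comp_mem_polyCurve hp hd) (fun t => ?_) hd₁ 0
  by_cases ht : d (γ t) = 0
  · rw [ht, mul_zero]
  · rw [h _ (hγ t) ht, zero_mul]

theorem dual_mem_polyFun {E : Type} [AddCommGroup E] [Module ℂ E] (φ : E →ₗ[ℂ] ℂ) :
    (φ : E → ℂ) ∈ polyFun E :=
  Algebra.subset_adjoin ⟨φ, rfl⟩

theorem entry_mem_polyFun (k l : Idx) : (fun M : so8 => M.1 k l) ∈ polyFun so8 :=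
  dual_mem_polyFun
    { toFun := fun M : so8 => M.1 k l
      map_add' := fun _ _ => rfl
      map_smul' := fun _ _ => rfl }

theorem smul_rootPlus_mem_minOrbit {c : ℂ} (hc : c ≠ 0) : c • rootPlus 0 1 ∈ minOrbit := by
  refine ⟨torus ![Units.mk0 c hc, 1, 1, 1], ?_⟩
  refine so8_ext (fun k l => ?_) (fun k l _ => ?_) (fun k l _ => ?_) <;>
    rw [Ad_torus_apply] <;> change _ = c * _ <;> fin_cases k <;> fin_cases l <;> simp [rootPlus]

theorem mem_minOrbit {M : so8} (hM : M ∈ minCone) (h0 : M ≠ 0) : M ∈ minOrbit := by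
  obtain ⟨g, -, c, rfl⟩ := exists_eq_Ad_smul hM
  have hc : c ≠ 0 := fun hc => h0 (by rw [hc, Ad_smul, zero_smul])
  obtain ⟨g', hg'⟩ := smul_rootPlus_mem_minOrbit hc
  exact ⟨g * g', by rw [← hg']; exact Ad_mul g g' _⟩

theorem minCone_subset_minOrbitClosure : minCone ⊆ minOrbitClosure := fun M hM f hf hv => by
  refine eq_zero_on_minCone hf (entry_mem_polyFun (.inl 0) (.inr 1)) (fun N hN hd => hv N
    (mem_minOrbit hN fun h => hd ?_)) rootPlus_mem_minCone ?_ hM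
  · rw [h]; rfl
  · simp [rootPlus]

theorem eq_zero_on_minOrbitClosure {f : so8 → ℂ} (hf : f ∈ polyFun so8)
    (h : ∀ M ∈ minCone, f M = 0) {M : so8} (hM : M ∈ minOrbitClosure) : f M = 0 :=
  hM f hf fun N hN => h N (minOrbit_subset_minCone hN)

/-! ### Quadratic relations on the cone -/

/-- The second elementary symmetric function of three numbers. -/
def esymmTwo (l : Fin 3 → ℂ) : ℂ := l 0 * l 1 + l 0 * l 2 + l 1 * l 2

/-- Quadratic equations of the minimal orbit in the adapted coordinates. They are symmetric under
`𝔖₄`. The index `-(i + j)` is the one different from `i` and `j`. The right-hand side of `u_mul_u`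
is the cross product of a row of `x - λ_i` with `w`, and that of `w_mul_w` the negative of the cross
product of a column of `x - λ_i` with `u`. -/
structure MinRel (M : so8) : Prop where
  x_mulVec_u : ∀ i, xCoord M *ᵥ uCoord i M = lamCoord M i • uCoord i M
  w_vecMul_x : ∀ i, wCoord i M ᵥ* xCoord M = lamCoord M i • wCoord i M
  trace_sq : (xCoord M * xCoord M).trace = -2 * esymmTwo (lamCoord M)
  u_mul_w : ∀ i a b, uCoord i M a * wCoord i M b = (xCoord M * xCoord M) a b +
    lamCoord M i * xCoord M a b +
      (lamCoord M i ^ 2 + esymmTwo (lamCoord M)) * (1 : Matrix (Fin 3) (Fin 3) ℂ) a b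
  u_mul_u : ∀ i j, i ≠ j → ∀ a b, uCoord i M a * uCoord j M b =
    crossProduct ((xCoord M - lamCoord M i • 1) b) (wCoord (-(i + j)) M) a
  w_mul_w : ∀ i j, i ≠ j → ∀ a b, wCoord i M a * wCoord j M b =
    -crossProduct (((xCoord M)ᵀ - lamCoord M i • 1) b) (uCoord (-(i + j)) M) a

theorem splitForm_eq (a b : Idx → ℂ) : splitForm a b =
    a (.inl 0) * b (.inr 0) + a (.inl 1) * b (.inr 1) + a (.inl 2) * b (.inr 2) +
      a (.inl 3) * b (.inr 3) + (a (.inr 0) * b (.inl 0) + a (.inr 1) * b (.inl 1) +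
      a (.inr 2) * b (.inl 2) + a (.inr 3) * b (.inl 3)) := by
  simp [splitForm, Fintype.sum_sum_type, Fin.sum_univ_four]

section
variable {a b : Idx → ℂ}

/-- The entries of the square of `a ∧ b` vanish. They are not simplified, since they become linear
relations between products of Plücker coordinates when `splitForm` is expanded. -/
theorem isotropic_identity (haa : splitForm a a = 0) (hab : splitForm a b = 0)
    (hbb : splitForm b b = 0) (k l : Idx) : splitForm a b * (a k * b l + b k * a l) -
      splitForm b b * (a k * a l) - splitForm a a * (b k * b l) = 0 := by
  rw [haa, hab, hbb]
  ring

theorem wedge_x_mulVec_u (haa : splitForm a a = 0) (hab : splitForm a b = 0)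
    (hbb : splitForm b b = 0) (i : Fin 3) : xCoord (wedge a b) *ᵥ uCoord i (wedge a b) =
    lamCoord (wedge a b) i • uCoord i (wedge a b) := by
  have hS := isotropic_identity haa hab hbb
  simp only [splitForm_eq] at hS
  ext c
  simp only [Matrix.mulVec, dotProduct, Fin.sum_univ_three, Pi.smul_apply, smul_eq_mul]
  fin_cases i
  · fin_cases c <;> simp [xCoord, uCoord, lamCoord, wt, centralTrace, wedge_apply] <;> ring
  · have h := hS (wt c) (.inr 3)
    fin_cases c <;> simp [xCoord, uCoord, lamCoord, wt, centralTrace, wedge_apply] at h ⊢ <;>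
      linear_combination (-1 / 2) * h
  · have h := hS (wt c) (.inl 3)
    fin_cases c <;> simp [xCoord, uCoord, lamCoord, wt, centralTrace, wedge_apply] at h ⊢ <;>
      linear_combination (-1 / 2) * h

theorem wedge_trace_sq (haa : splitForm a a = 0) (hab : splitForm a b = 0)
    (hbb : splitForm b b = 0) : (xCoord (wedge a b) * xCoord (wedge a b)).trace =
      -2 * esymmTwo (lamCoord (wedge a b)) := by
  have hS := isotropic_identity haa hab hbb
  simp only [splitForm_eq] at hS
  simp [xCoord, lamCoord, wt, centralTrace, wedge_apply, Matrix.trace, Matrix.mul_apply,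
    Fin.sum_univ_three, esymmTwo]
  linear_combination (1 / 2) * (hS (.inl 1) (.inr 1) + hS (.inl 2) (.inr 2) +
    hS (.inl 0) (.inr 0) - hS (.inl 3) (.inr 3))

set_option maxHeartbeats 1000000 in
theorem wedge_u_mul_w (haa : splitForm a a = 0) (hab : splitForm a b = 0)
    (hbb : splitForm b b = 0) (i c d : Fin 3) :
    uCoord i (wedge a b) c * wCoord i (wedge a b) d =
      (xCoord (wedge a b) * xCoord (wedge a b)) c d +
        lamCoord (wedge a b) i * xCoord (wedge a b) c d +
        (lamCoord (wedge a b) i ^ 2 + esymmTwo (lamCoord (wedge a b))) *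
          (1 : Matrix (Fin 3) (Fin 3) ℂ) c d := by
  have hS := isotropic_identity haa hab hbb
  simp only [splitForm_eq] at hS
  have h := hS (wt c) (wt d).swap
  -- the relation needed for the diagonal entries at `i = 0`
  have ht : (-1 / 4 : ℂ) * _ = _ := congrArg ((-1 / 4 : ℂ) * ·)
    (congrArg₂ (· - ·) (congrArg₂ (· + ·)
    (hS (.inl 1) (.inr 1)) (congrArg₂ (· + ·) (hS (.inl 2) (.inr 2)) (hS (.inl 0) (.inr 0))))
    (hS (.inl 3) (.inr 3)))
  rw [Matrix.mul_apply, Fin.sum_univ_three]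
  fin_cases i
  · clear h hS
    fin_cases c <;> fin_cases d <;>
      simp [xCoord, uCoord, wCoord, lamCoord, wt, centralTrace, wedge_apply, esymmTwo] <;>
      first | ring1 | linear_combination ht
  · clear ht hS
    fin_cases c <;> fin_cases d <;>
      simp [xCoord, uCoord, wCoord, lamCoord, wt, centralTrace, wedge_apply, esymmTwo] at h ⊢ <;>
      linear_combination (-1 / 2) * h
  · clear ht hS
    fin_cases c <;> fin_cases d <;>
      simp [xCoord, uCoord, wCoord, lamCoord, wt, centralTrace, wedge_apply, esymmTwo] at h ⊢ <;>
      linear_combination (-1 / 2) * h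

theorem wedge_u_zero_mul_u (i : Fin 3) (hi : 0 ≠ i) (c d : Fin 3) :
    uCoord 0 (wedge a b) c * uCoord i (wedge a b) d =
      crossProduct ((xCoord (wedge a b) - lamCoord (wedge a b) 0 • 1) d)
        (wCoord (-(0 + i)) (wedge a b)) c := by
  rw [cross_apply]
  fin_cases i
  · exact absurd rfl hi
  · fin_cases c <;> fin_cases d <;>
      simp [xCoord, uCoord, wCoord, lamCoord, wt, centralTrace, wedge_apply] <;> ring
  · fin_cases c <;> fin_cases d <;>
      simp [xCoord, uCoord, wCoord, lamCoord, wt, centralTrace, wedge_apply] <;> ring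

theorem wedge_u_one_mul_u_two (haa : splitForm a a = 0) (hab : splitForm a b = 0)
    (hbb : splitForm b b = 0) (c d : Fin 3) :
    uCoord 1 (wedge a b) c * uCoord 2 (wedge a b) d =
      crossProduct ((xCoord (wedge a b) - lamCoord (wedge a b) 1 • 1) d)
        (wCoord 0 (wedge a b)) c := by
  have hS := isotropic_identity haa hab hbb
  simp only [splitForm_eq] at hS
  have h := hS (wt c) (wt d)
  rw [cross_apply]
  fin_cases c <;> fin_cases d <;>
    simp [xCoord, uCoord, wCoord, lamCoord, wt, centralTrace, wedge_apply] at h ⊢ <;>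
    linear_combination (-1 / 2) * h

end

/-- The expressions for `u i a * u j b` and `u j b * u i a` agree when `w` is a left eigenvector. -/
theorem cross_row_symm {x : Matrix (Fin 3) (Fin 3) ℂ} (hx : x.trace = 0) {w : Fin 3 → ℂ}
    {r s t : ℂ} (h : w ᵥ* x = t • w) (hrst : r + s + t = 0) (a b : Fin 3) :
    crossProduct ((x - r • 1) b) w a = crossProduct ((x - s • 1) a) w b := by
  have h0 := congrFun h 0
  have h1 := congrFun h 1
  have h2 := congrFun h 2
  simp only [Matrix.vecMul, dotProduct, Fin.sum_univ_three, Pi.smul_apply, smul_eq_mul] at h0 h1 h2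
  simp only [Matrix.trace, Fin.sum_univ_three, Matrix.diag] at hx
  rw [cross_apply, cross_apply]
  fin_cases a <;> fin_cases b <;> simp [Matrix.sub_apply]
  all_goals first
    | done
    | linear_combination hx * w 2 - hrst * w 2 - h2
    | linear_combination -(hx * w 2 - hrst * w 2 - h2)
    | linear_combination hx * w 1 - hrst * w 1 - h1
    | linear_combination -(hx * w 1 - hrst * w 1 - h1)
    | linear_combination hx * w 0 - hrst * w 0 - h0
    | linear_combination -(hx * w 0 - hrst * w 0 - h0)

/-- The transpose of an element of `so₈`, which is minus its image under the Chevalley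
involution. -/
def transpose (M : so8) : so8 :=
  ⟨M.1ᵀ, by
    rw [mem_so8_iff_apply]
    intro k l
    rw [Matrix.transpose_apply, Matrix.transpose_apply, so8_apply M]⟩

theorem transpose_apply (M : so8) (k l : Idx) : (transpose M).1 k l = M.1 l k := rfl

theorem transpose_mem_minCone {M : so8} (h : M ∈ minCone) : transpose M ∈ minCone := by
  obtain ⟨a, b, haa, hab, hbb, rfl⟩ := h
  rw [splitForm_eq] at haa hab hbb
  refine ⟨b ∘ Sum.swap, a ∘ Sum.swap, ?_, ?_, ?_, ?_⟩
  · rw [splitForm_eq]; simp; linear_combination hbb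
  · rw [splitForm_eq]; simp; linear_combination hab
  · rw [splitForm_eq]; simp; linear_combination haa
  · apply Subtype.ext
    ext k l
    rw [transpose_apply, wedge_apply, wedge_apply]
    simp
    ring

theorem xCoord_transpose (M : so8) : xCoord (transpose M) = (xCoord M)ᵀ := by
  ext a b
  simp [xCoord, transpose_apply, centralTrace, eq_comm]

theorem lamCoord_transpose (M : so8) : lamCoord (transpose M) = lamCoord M := by
  ext i
  simp [lamCoord, transpose_apply, centralTrace]

theorem uCoord_transpose (i : Fin 3) (M : so8) : uCoord i (transpose M) = -wCoord i M := by
  ext a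
  fin_cases i
  · simp [uCoord, wCoord, transpose_apply]
    rw [so8_apply M, Sum.swap_swap]; simp
  · simp [uCoord, wCoord, transpose_apply]
    rw [so8_apply M]; simp
  · simp [uCoord, wCoord, transpose_apply]
    rw [so8_apply M]; simp

theorem transpose_transpose (M : so8) : transpose (transpose M) = M := rfl

theorem wCoord_transpose (i : Fin 3) (M : so8) : wCoord i (transpose M) = -uCoord i M := by
  rw [← neg_eq_iff_eq_neg.2 (uCoord_transpose i (transpose M)), transpose_transpose]

theorem x_mulVec_u_of_mem_minCone {M : so8} (h : M ∈ minCone) (i : Fin 3) :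
    xCoord M *ᵥ uCoord i M = lamCoord M i • uCoord i M := by
  obtain ⟨a, b, haa, hab, hbb, rfl⟩ := h
  exact wedge_x_mulVec_u haa hab hbb i

theorem w_vecMul_x_of_mem_minCone {M : so8} (h : M ∈ minCone) (i : Fin 3) :
    wCoord i M ᵥ* xCoord M = lamCoord M i • wCoord i M := by
  have := x_mulVec_u_of_mem_minCone (transpose_mem_minCone h) i
  rw [xCoord_transpose, uCoord_transpose, lamCoord_transpose, Matrix.mulVec_transpose,
    Matrix.neg_vecMul, smul_neg, neg_inj] at this
  exact this

theorem sum_eq_add_add (f : Fin 3 → ℂ) {i j : Fin 3} (hij : i ≠ j) :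
    ∑ k, f k = f i + f j + f (-(i + j)) := by
  rw [Fin.sum_univ_three]
  fin_cases i <;> fin_cases j <;> first | exact absurd rfl hij |
    (simp [show (-1 : Fin 3) = 2 from rfl, show (-2 : Fin 3) = 1 from rfl]; try ring)

/-- The equations for the index pairs `(i, j)` imply those for `(j, i)`. -/
theorem u_mul_u_symm {M : so8} (h : M ∈ minCone) {i j : Fin 3} (hij : i ≠ j)
    (H : ∀ a b, uCoord i M a * uCoord j M b =
      crossProduct ((xCoord M - lamCoord M i • 1) b) (wCoord (-(i + j)) M) a) (a b : Fin 3) :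
    uCoord j M a * uCoord i M b =
      crossProduct ((xCoord M - lamCoord M j • 1) b) (wCoord (-(j + i)) M) a := by
  rw [mul_comm, H, add_comm j i]
  refine cross_row_symm (trace_xCoord M) (w_vecMul_x_of_mem_minCone h _) ?_ b a
  rw [← sum_lamCoord M, sum_eq_add_add _ hij]

theorem u_mul_u_of_mem_minCone {M : so8} (h : M ∈ minCone) {i j : Fin 3} (hij : i ≠ j)
    (a b : Fin 3) : uCoord i M a * uCoord j M b =
      crossProduct ((xCoord M - lamCoord M i • 1) b) (wCoord (-(i + j)) M) a := by
  have h0 : ∀ i : Fin 3, 0 ≠ i → ∀ a b, uCoord 0 M a * uCoord i M b =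
      crossProduct ((xCoord M - lamCoord M 0 • 1) b) (wCoord (-(0 + i)) M) a := by
    obtain ⟨a, b, haa, hab, hbb, rfl⟩ := h
    exact wedge_u_zero_mul_u
  have h1 : ∀ a b, uCoord 1 M a * uCoord 2 M b =
      crossProduct ((xCoord M - lamCoord M 1 • 1) b) (wCoord (-(1 + 2)) M) a := by
    obtain ⟨a, b, haa, hab, hbb, rfl⟩ := h
    exact wedge_u_one_mul_u_two haa hab hbb
  fin_cases i <;> fin_cases j
  · exact absurd rfl hij
  · exact h0 1 hij a b
  · exact h0 2 hij a b
  · exact u_mul_u_symm h hij.symm (h0 1 hij.symm) a b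
  · exact absurd rfl hij
  · exact h1 a b
  · exact u_mul_u_symm h hij.symm (h0 2 hij.symm) a b
  · exact u_mul_u_symm h hij.symm h1 a b
  · exact absurd rfl hij

/-- The points of the cone over the minimal orbit satisfy the quadratic equations. -/
theorem minRel_of_mem_minCone {M : so8} (h : M ∈ minCone) : MinRel M where
  x_mulVec_u := x_mulVec_u_of_mem_minCone h
  w_vecMul_x := w_vecMul_x_of_mem_minCone h
  trace_sq := by
    obtain ⟨a, b, haa, hab, hbb, rfl⟩ := h
    exact wedge_trace_sq haa hab hbb
  u_mul_w := by
    obtain ⟨a, b, haa, hab, hbb, rfl⟩ := h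
    exact wedge_u_mul_w haa hab hbb
  u_mul_u _ _ := u_mul_u_of_mem_minCone h
  w_mul_w i j hij a b := by
    have := u_mul_u_of_mem_minCone (transpose_mem_minCone h) hij a b
    rw [xCoord_transpose, uCoord_transpose, uCoord_transpose, lamCoord_transpose,
      wCoord_transpose, map_neg, Pi.neg_apply, Pi.neg_apply, neg_mul_neg] at this
    exact this

theorem esymmTwo_eq (l : Fin 3 → ℂ) : esymmTwo l = ((∑ i, l i) ^ 2 - ∑ i, l i ^ 2) / 2 := by
  simp only [esymmTwo, Fin.sum_univ_three]
  ring

theorem esymmTwo_lamCoord_permRep (σ : Equiv.Perm (Fin 4)) (M : so8) :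
    esymmTwo (lamCoord (permRep σ M)) = esymmTwo (lamCoord M) := by
  simp only [esymmTwo_eq, lamCoord_permRep, sum_resolvent σ⁻¹ (lamCoord M),
    sum_resolvent σ⁻¹ (fun i => lamCoord M i ^ 2)]

theorem resolvent_neg_add : ∀ (σ : Equiv.Perm (Fin 4)) (i j : Fin 3), i ≠ j →
    resolvent σ (-(i + j)) = -(resolvent σ i + resolvent σ j) := by
  decide +kernel

theorem pairSign_mul_pairSign : ∀ (σ : Equiv.Perm (Fin 4)) (i j : Fin 3), i ≠ j →
    pairSign σ i * pairSign σ j = pairSign σ (-(i + j)) := by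
  decide +kernel

/-- The quadratic equations are stable under `𝔖₄`. -/
theorem MinRel.permRep {M : so8} (h : MinRel M) (σ : Equiv.Perm (Fin 4)) :
    MinRel (permRep σ M) where
  x_mulVec_u i := by
    rw [xCoord_permRep, uCoord_permRep, lamCoord_permRep, Matrix.mulVec_smul, h.x_mulVec_u,
      smul_comm]
  w_vecMul_x i := by
    rw [xCoord_permRep, wCoord_permRep, lamCoord_permRep, Matrix.smul_vecMul, h.w_vecMul_x,
      smul_comm]
  trace_sq := by rw [xCoord_permRep, esymmTwo_lamCoord_permRep, h.trace_sq]
  u_mul_w i a b := by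
    rw [xCoord_permRep, esymmTwo_lamCoord_permRep, uCoord_permRep, wCoord_permRep,
      lamCoord_permRep, ← h.u_mul_w]
    have := pairSign_mul_self σ⁻¹ i
    simp only [Pi.smul_apply, smul_eq_mul]
    linear_combination uCoord (resolvent σ⁻¹ i) M a * wCoord (resolvent σ⁻¹ i) M b * this
  u_mul_u i j hij a b := by
    have hs : (pairSign σ⁻¹ i : ℂ) * pairSign σ⁻¹ j = pairSign σ⁻¹ (-(i + j)) := by
      exact_mod_cast pairSign_mul_pairSign σ⁻¹ i j hij
    rw [xCoord_permRep, uCoord_permRep, uCoord_permRep, wCoord_permRep, lamCoord_permRep,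
      map_smul, Pi.smul_apply, Pi.smul_apply, Pi.smul_apply, smul_mul_smul_comm,
      h.u_mul_u _ _ ((resolvent_bijective _).1.ne hij), resolvent_neg_add _ _ _ hij, hs]
  w_mul_w i j hij a b := by
    have hs : (pairSign σ⁻¹ i : ℂ) * pairSign σ⁻¹ j = pairSign σ⁻¹ (-(i + j)) := by
      exact_mod_cast pairSign_mul_pairSign σ⁻¹ i j hij
    rw [xCoord_permRep, wCoord_permRep, wCoord_permRep, uCoord_permRep, lamCoord_permRep,
      map_smul, Pi.smul_apply, Pi.smul_apply, Pi.smul_apply, smul_mul_smul_comm,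
      h.w_mul_w _ _ ((resolvent_bijective _).1.ne hij), resolvent_neg_add _ _ _ hij, hs, smul_neg]

/-! ### The parametrisation of the cone by `SL₃ × 𝔷(𝔩)` -/

/-- The element of `so₈` whose `sl₃`-component is `g Δ(z) g⁻¹` and whose components in the copies
of `V` and `V^*` are multiples of the columns of `g` and of the rows of `g⁻¹`. -/
def phi (g : Matrix.SpecialLinearGroup (Fin 3) ℂ) (z : zl) : so8 :=
  ofCoord (conjDiag g z).1 z.1 (fun i => (z.1 i - z.1 (i + 1)) • gv g i)
    (fun i => (z.1 i - z.1 (i - 1)) • (g⁻¹).1 i)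

section
variable (g : Matrix.SpecialLinearGroup (Fin 3) ℂ) (z : zl)

theorem trace_conjDiag : (conjDiag g z).1.trace = 0 := (conjDiag g z).2

theorem xCoord_phi : xCoord (phi g z) = g.1 * Matrix.diagonal z.1 * (g⁻¹).1 :=
  xCoord_ofCoord _ _ (trace_conjDiag g z)

theorem lamCoord_phi : lamCoord (phi g z) = z.1 :=
  lamCoord_ofCoord _ _ (trace_conjDiag g z) z.2

theorem uCoord_phi (i : Fin 3) : uCoord i (phi g z) = (z.1 i - z.1 (i + 1)) • gv g i :=
  uCoord_ofCoord _ _ i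

theorem wCoord_phi (i : Fin 3) : wCoord i (phi g z) = (z.1 i - z.1 (i - 1)) • (g⁻¹).1 i :=
  wCoord_ofCoord _ _ i

theorem gv_apply (i a : Fin 3) : gv g i a = g.1 a i := by
  simp [gv]

end

/-- The vector of `ℂ⁸ = V ⊕ V^* ⊕ ℂ ⊕ ℂ` with components `p`, `q`, `x`, `y`. -/
def mkVec (p q : Fin 3 → ℂ) (x y : ℂ) : Idx → ℂ :=
  Sum.elim ![q 2, p 0, p 1, x] ![p 2, q 0, q 1, y]

theorem splitForm_mkVec (p q p' q' : Fin 3 → ℂ) (x y x' y' : ℂ) :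
    splitForm (mkVec p q x y) (mkVec p' q' x' y') =
      p ⬝ᵥ q' + q ⬝ᵥ p' + x * y' + y * x' := by
  simp [splitForm_eq, mkVec, dotProduct, Fin.sum_univ_three]
  ring

/-- The element `phi g z` is the wedge product of two explicit orthogonal isotropic vectors. Besides
`g g⁻¹ = 1`, the proof uses that `g` and `g⁻¹` are the adjugates of each other: this identifies the
first column of `g` with the cross product of two rows of `g⁻¹`, and vice versa. -/
theorem phi_mem_minCone (g : Matrix.SpecialLinearGroup (Fin 3) ℂ) (z : zl) :
    phi g z ∈ minCone := by
  have hz : ∑ i, z.1 i = 0 := z.2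
  rw [Fin.sum_univ_three] at hz
  have h1 : g.1 * (g⁻¹).1 = 1 := congrArg Subtype.val (mul_inv_cancel g)
  have h2 : (g⁻¹).1 * g.1 = 1 := congrArg Subtype.val (inv_mul_cancel g)
  have h3 : (g⁻¹).1 = g.1.adjugate := Matrix.SpecialLinearGroup.coe_inv g
  have h4 : g.1 = (g⁻¹).1.adjugate := by
    conv_lhs => rw [← inv_inv g]
    exact Matrix.SpecialLinearGroup.coe_inv g⁻¹
  have e : phi g z = wedge
      (mkVec ((z.1 0 - z.1 2) • gv g 2) ((z.1 0 - z.1 1) • (g⁻¹).1 1) 0 (z.1 1 - z.1 2))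
      (mkVec (gv g 1) (-(g⁻¹).1 2) 1 0) := by
    have k1 := fun a b => congrFun (congrFun h1 a) b
    have k2 := fun a b => congrFun (congrFun h2 a) b
    have k3 := fun a b => congrFun (congrFun h3 a) b
    have k4 := fun a b => congrFun (congrFun h4 a) b
    simp only [Matrix.adjugate_fin_three] at k3 k4
    simp only [Matrix.mul_apply, Fin.sum_univ_three] at k1 k2
    have hm : (-1 : Fin 3) = 2 := rfl
    have ht : centralTrace (wedge
        (mkVec ((z.1 0 - z.1 2) • gv g 2) ((z.1 0 - z.1 1) • (g⁻¹).1 1) 0 (z.1 1 - z.1 2))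
        (mkVec (gv g 1) (-(g⁻¹).1 2) 1 0)).1 = -z.1 0 := by
      have k11 := k2 1 1
      have k22 := k2 2 2
      simp [centralTrace, wedge_apply, mkVec, wt, gv_apply] at k11 k22 ⊢
      linear_combination -(z.1 0 - z.1 1) / 3 * k11 - (z.1 0 - z.1 2) / 3 * k22 + hz / 3
    refine ext_coord ?_ ?_ (fun i => ?_) (fun i => ?_)
    · rw [xCoord_phi]
      ext a b
      have := k1 a b
      simp only [xCoord, LinearMap.coe_mk, AddHom.coe_mk, Matrix.of_apply, ht]
      rw [Matrix.mul_apply, Fin.sum_univ_three]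
      simp only [Matrix.mul_diagonal]
      fin_cases a <;> fin_cases b <;>
        simp [wedge_apply, mkVec, wt, gv_apply] at this ⊢ <;>
        linear_combination z.1 0 * this
    · rw [lamCoord_phi]
      ext i
      simp only [lamCoord, LinearMap.coe_mk, AddHom.coe_mk, ht]
      fin_cases i <;> simp [wedge_apply, mkVec]
      · linear_combination hz / 2
      · linear_combination hz / 2
    · rw [uCoord_phi]
      ext a
      have := k4 a 0
      fin_cases i
      · fin_cases a <;> simp [uCoord, wedge_apply, mkVec, wt, gv_apply] at this ⊢ <;>
          linear_combination (z.1 0 - z.1 1) * this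
      · fin_cases a <;> simp [uCoord, wedge_apply, mkVec, wt, gv_apply] <;> ring
      · fin_cases a <;> simp [uCoord, wedge_apply, mkVec, wt, gv_apply] <;> ring
    · rw [wCoord_phi]
      ext a
      have := k3 0 a
      fin_cases i
      · fin_cases a <;> simp [wCoord, wedge_apply, mkVec, wt, gv_apply, hm] at this ⊢ <;>
          linear_combination (z.1 0 - z.1 2) * this
      · fin_cases a <;> simp [wCoord, wedge_apply, mkVec, wt, gv_apply] <;> ring
      · fin_cases a <;> simp [wCoord, wedge_apply, mkVec, wt, gv_apply] <;> ring
  have k2 : ∀ i j, (g⁻¹).1 i ⬝ᵥ gv g j = (1 : Matrix (Fin 3) (Fin 3) ℂ) i j := by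
    intro i j
    rw [← h2, Matrix.mul_apply]
    simp only [dotProduct, gv_apply]
  refine ⟨_, _, ?_, ?_, ?_, e⟩ <;>
    simp only [splitForm_mkVec, smul_dotProduct, dotProduct_smul, dotProduct_neg, neg_dotProduct,
      k2, dotProduct_comm (gv g _), Matrix.one_apply] <;> simp

/-- Points of the cone with distinct `𝔷(𝔩)`-coordinates are in the image of the parametrisation:
the components in the copies of `V` are proportional to the columns of `g`. -/
theorem MinRel.exists_eq_phi {M : so8} (h : MinRel M) (hinj : Function.Injective (lamCoord M)) :
    ∃ g z, M = phi g z := by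
  set x := xCoord M with hx
  set l := lamCoord M with hl
  set u := fun i => uCoord i M with hu
  set w := fun i => wCoord i M with hw
  have hsum := sum_lamCoord M
  rw [Fin.sum_univ_three, ← hl] at hsum
  have htr := trace_xCoord M
  rw [← hx] at htr
  have hd : ∀ i, l i - l (i + 1) ≠ 0 := fun i => sub_ne_zero.2 (hinj.ne (by simp))
  have he : ∀ i, l i - l (i - 1) ≠ 0 := fun i => sub_ne_zero.2 (hinj.ne (by revert i; decide))
  -- the pairing of the eigenvectors
  have hwu : ∀ i j, w i ⬝ᵥ u j = if i = j then (l i - l (i + 1)) * (l i - l (i - 1)) else 0 := by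
    intro i j
    split_ifs with hij
    · subst hij
      have h1 : w i ⬝ᵥ u i = (x * x).trace + l i * x.trace + (l i ^ 2 + esymmTwo l) * 3 := by
        have h2 : ∀ a, w i a * u i a = _ := fun a => (mul_comm _ _).trans (h.u_mul_w i a a)
        rw [dotProduct, Fin.sum_univ_three, h2, h2, h2]
        simp only [Matrix.trace, Fin.sum_univ_three, Matrix.diag, Matrix.one_apply_eq]
        ring
      rw [h1, htr, h.trace_sq]
      have hm : (-1 : Fin 3) = 2 := rfl
      have h2 : l 2 = -l 0 - l 1 := by linear_combination hsum
      fin_cases i <;> simp [esymmTwo, ← hl, hm, h2] <;> ring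
    · have h1 : (w i ᵥ* x) ⬝ᵥ u j = w i ⬝ᵥ (x *ᵥ u j) := (Matrix.dotProduct_mulVec _ _ _).symm
      rw [h.w_vecMul_x, h.x_mulVec_u, smul_dotProduct, dotProduct_smul, smul_eq_mul, smul_eq_mul,
        ← sub_eq_zero, ← sub_mul] at h1
      exact (mul_eq_zero.1 h1).resolve_left (sub_ne_zero.2 (hinj.ne hij))
  -- rescaling turns the eigenvectors into the columns of `g` and the rows of `g⁻¹`
  let G : Matrix (Fin 3) (Fin 3) ℂ := Matrix.of fun a i => (l i - l (i + 1))⁻¹ * u i a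
  let H : Matrix (Fin 3) (Fin 3) ℂ := Matrix.of fun i a => (l i - l (i - 1))⁻¹ * w i a
  have hHG : H * G = 1 := by
    ext i j
    have h1 : (H * G) i j = (l i - l (i - 1))⁻¹ * (l j - l (j + 1))⁻¹ * (w i ⬝ᵥ u j) := by
      simp only [Matrix.mul_apply, dotProduct, Finset.mul_sum, H, G, Matrix.of_apply]
      exact Finset.sum_congr rfl fun a _ => by ring
    rw [h1, hwu, Matrix.one_apply]
    split_ifs with hij
    · subst hij
      have := hd i
      have := he i
      field_simp
    · rw [mul_zero]
  have hdet : G.det = 1 := by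
    -- the cross product of two eigenvectors is a multiple of a left eigenvector
    have hc : crossProduct (u 0) (u 1) = (l 1 - l 0) • w 2 := by
      have h0 := fun a b => h.u_mul_u 0 1 (by decide) a b
      have h2 := h.w_vecMul_x 2
      have e0 := congrFun h2 0
      have e1 := congrFun h2 1
      have e2 := congrFun h2 2
      simp only [Matrix.vecMul, dotProduct, Fin.sum_univ_three, Pi.smul_apply, smul_eq_mul]
        at e0 e1 e2
      simp only [Matrix.trace, Fin.sum_univ_three, Matrix.diag] at htr
      have hm : (-(0 + 1) : Fin 3) = 2 := rfl
      ext a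
      rw [cross_apply]
      simp only [hu, h0, hm]
      simp only [← hx, ← hl] at e0 e1 e2 ⊢
      simp only [cross_apply]
      fin_cases a <;> simp [hw]
      · linear_combination htr * wCoord 2 M 0 - e0 - hsum * wCoord 2 M 0
      · linear_combination htr * wCoord 2 M 1 - e1 - hsum * wCoord 2 M 1
      · linear_combination htr * wCoord 2 M 2 - e2 - hsum * wCoord 2 M 2
    have h1 : crossProduct (u 0) (u 1) ⬝ᵥ u 2 = (l 1 - l 0) * ((l 2 - l 0) * (l 2 - l 1)) := by
      rw [hc, smul_dotProduct, hwu, if_pos rfl, smul_eq_mul]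
      rfl
    have h2 : G.det = (l 0 - l 1)⁻¹ * (l 1 - l 2)⁻¹ * (l 2 - l 0)⁻¹ *
        (crossProduct (u 0) (u 1) ⬝ᵥ u 2) := by
      rw [Matrix.det_fin_three, cross_apply]
      simp [G, dotProduct, Fin.sum_univ_three]
      ring
    rw [h2, h1]
    have d0 := hd 0
    have d1 := hd 1
    have d2 := hd 2
    simp only [zero_add, show (1 + 1 : Fin 3) = 2 from rfl, show (2 + 1 : Fin 3) = 0 from rfl]
      at d0 d1 d2
    field_simp
    ring
  obtain ⟨g, hg⟩ : ∃ g : Matrix.SpecialLinearGroup (Fin 3) ℂ, g.1 = G := ⟨⟨G, hdet⟩, rfl⟩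
  obtain ⟨z, hz⟩ : ∃ z : zl, z.1 = l := ⟨⟨l, sum_lamCoord M⟩, rfl⟩
  have hG : (g⁻¹).1 = H := by
    have h1 : g.1 * (g⁻¹).1 = 1 := congrArg Subtype.val (mul_inv_cancel g)
    rw [hg] at h1
    exact (left_inv_eq_right_inv hHG h1).symm
  refine ⟨g, z, ext_coord ?_ ?_ (fun i => ?_) fun i => ?_⟩
  · have h1 : x * G = G * Matrix.diagonal l := by
      ext a i
      have h2 := congrFun (h.x_mulVec_u i) a
      rw [Matrix.mul_diagonal, Matrix.mul_apply]
      simp only [Matrix.mulVec, dotProduct, Pi.smul_apply, smul_eq_mul] at h2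
      simp only [G, Matrix.of_apply, mul_left_comm _ (l i - l (i + 1))⁻¹, ← Finset.mul_sum, hu, hx,
        h2]
      rw [← hl]
      ring
    rw [xCoord_phi, hG, hg, hz, ← h1, Matrix.mul_assoc, mul_eq_one_comm.1 hHG, Matrix.mul_one]
  · rw [lamCoord_phi, hz]
  · rw [uCoord_phi, hz]
    ext a
    have := hd i
    simp [gv_apply, hg, G, hu, this]
  · rw [wCoord_phi, hG, hz]
    ext a
    have := he i
    simp [H, hw, this]

/-- The product of the differences of the `𝔷(𝔩)`-coordinates. -/
def lamDisc (M : so8) : ℂ :=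
  (lamCoord M 0 - lamCoord M 1) * (lamCoord M 1 - lamCoord M 2) * (lamCoord M 2 - lamCoord M 0)

theorem lamCoord_injective {M : so8} (h : lamDisc M ≠ 0) : Function.Injective (lamCoord M) := by
  simp only [lamDisc, mul_ne_zero_iff, sub_ne_zero] at h
  intro i j hij
  fin_cases i <;> fin_cases j <;> simp_all

theorem lamDisc_mem_polyFun : lamDisc ∈ polyFun so8 := by
  have h : ∀ i, (fun M : so8 => lamCoord M i) ∈ polyFun so8 := fun i =>
    dual_mem_polyFun (LinearMap.proj i ∘ₗ lamCoord)
  exact mul_mem (mul_mem (sub_mem (h 0) (h 1)) (sub_mem (h 1) (h 2))) (sub_mem (h 2) (h 0))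

theorem exists_lamDisc_ne_zero : ∃ M ∈ minCone, lamDisc M ≠ 0 := by
  refine ⟨_, phi_mem_minCone 1 ⟨![1, 0, -1], by simp [zl, Fin.sum_univ_three]⟩, ?_⟩
  simp [lamDisc, lamCoord_phi]
  norm_num

/-- The image of the parametrisation is Zariski dense in the closure of the minimal orbit. -/
theorem eq_zero_of_forall_phi {f : so8 → ℂ} (hf : f ∈ polyFun so8) (h : ∀ g z, f (phi g z) = 0)
    {M : so8} (hM : M ∈ minOrbitClosure) : f M = 0 := by
  obtain ⟨M₁, h₁, hd₁⟩ := exists_lamDisc_ne_zero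
  refine eq_zero_on_minOrbitClosure hf (fun N hN => ?_) hM
  refine eq_zero_on_minCone hf lamDisc_mem_polyFun (fun N hN hd => ?_) h₁ hd₁ hN
  obtain ⟨g, z, rfl⟩ := (minRel_of_mem_minCone hN).exists_eq_phi (lamCoord_injective hd)
  exact h g z

/-- Generic points of the cone are mapped to the cone by every permutation. -/
theorem permRep_mem_minCone {M : so8} (hM : M ∈ minCone) (hd : lamDisc M ≠ 0)
    (σ : Equiv.Perm (Fin 4)) : permRep σ M ∈ minCone := by
  have hinj : Function.Injective (lamCoord (permRep σ M)) := by
    have : lamCoord (permRep σ M) = lamCoord M ∘ resolvent σ⁻¹ :=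
      funext fun i => lamCoord_permRep σ M i
    rw [this]
    exact (lamCoord_injective hd).comp (resolvent_bijective _).1
  obtain ⟨g, z, h⟩ := ((minRel_of_mem_minCone hM).permRep σ).exists_eq_phi hinj
  rw [h]
  exact phi_mem_minCone g z

theorem comp_linear_mem_polyFun {E F : Type} [AddCommGroup E] [Module ℂ E] [AddCommGroup F]
    [Module ℂ F] {f : F → ℂ} (hf : f ∈ polyFun F) (T : E →ₗ[ℂ] F) : f ∘ T ∈ polyFun E := by
  induction hf using Algebra.adjoin_induction with
  | mem f hf =>
    obtain ⟨φ, rfl⟩ := hf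
    exact dual_mem_polyFun (φ ∘ₗ T)
  | algebraMap r => exact (polyFun E).algebraMap_mem r
  | add f g _ _ hf hg => exact add_mem hf hg
  | mul f g _ _ hf hg => exact mul_mem hf hg

/-- Stability follows from that of a dense subset. -/
theorem isStable_permRep : IsStable permRep minOrbitClosure := by
  intro σ M hM f hf hv
  obtain ⟨M₁, h₁, hd₁⟩ := exists_lamDisc_ne_zero
  refine eq_zero_on_minOrbitClosure (comp_linear_mem_polyFun hf (permRep σ)) (fun N hN => ?_) hM
  refine eq_zero_on_minCone (comp_linear_mem_polyFun hf (permRep σ)) lamDisc_mem_polyFun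
    (fun N hN hd => ?_) h₁ hd₁ hN
  exact minCone_subset_minOrbitClosure (permRep_mem_minCone hN hd σ) f hf hv

/-! ### The equations on the closure of the minimal orbit -/

theorem cross_apply_add (v w : Fin 3 → ℂ) (a : Fin 3) :
    crossProduct v w a = v (a + 1) * w (a + 2) - v (a + 2) * w (a + 1) := by
  rw [cross_apply]
  fin_cases a <;> rfl

theorem xCoord_mem_polyFun (a b : Fin 3) : (fun M : so8 => xCoord M a b) ∈ polyFun so8 :=
  dual_mem_polyFun (LinearMap.proj b ∘ₗ LinearMap.proj a ∘ₗ xCoord)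

theorem lamCoord_mem_polyFun (i : Fin 3) : (fun M : so8 => lamCoord M i) ∈ polyFun so8 :=
  dual_mem_polyFun (LinearMap.proj i ∘ₗ lamCoord)

theorem uCoord_mem_polyFun (i a : Fin 3) : (fun M : so8 => uCoord i M a) ∈ polyFun so8 :=
  dual_mem_polyFun (LinearMap.proj a ∘ₗ uCoord i)

theorem wCoord_mem_polyFun (i a : Fin 3) : (fun M : so8 => wCoord i M a) ∈ polyFun so8 :=
  dual_mem_polyFun (LinearMap.proj a ∘ₗ wCoord i)

theorem const_mem_polyFun (c : ℂ) : (fun _ : so8 => c) ∈ polyFun so8 :=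
  (polyFun so8).algebraMap_mem c

theorem esymmTwo_mem_polyFun : (fun M : so8 => esymmTwo (lamCoord M)) ∈ polyFun so8 :=
  add_mem (add_mem (mul_mem (lamCoord_mem_polyFun 0) (lamCoord_mem_polyFun 1))
    (mul_mem (lamCoord_mem_polyFun 0) (lamCoord_mem_polyFun 2)))
    (mul_mem (lamCoord_mem_polyFun 1) (lamCoord_mem_polyFun 2))

theorem sum_mem_polyFun {f : Fin 3 → so8 → ℂ} (h : ∀ i, f i ∈ polyFun so8) :
    (fun M => ∑ i, f i M) ∈ polyFun so8 := by
  rw [show (fun M => ∑ i, f i M) = ∑ i, f i from funext fun M => (Finset.sum_apply M _ _).symm]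
  exact sum_mem fun i _ => h i

theorem xCoord_sq_mem_polyFun (a b : Fin 3) :
    (fun M : so8 => (xCoord M * xCoord M) a b) ∈ polyFun so8 :=
  sum_mem_polyFun fun c => mul_mem (xCoord_mem_polyFun a c) (xCoord_mem_polyFun c b)

theorem eq_on_minOrbitClosure {f g : so8 → ℂ} (hf : f ∈ polyFun so8) (hg : g ∈ polyFun so8)
    (h : ∀ M ∈ minCone, f M = g M) {M : so8} (hM : M ∈ minOrbitClosure) : f M = g M :=
  sub_eq_zero.1 (eq_zero_on_minOrbitClosure (sub_mem hf hg) (fun N hN => sub_eq_zero.2 (h N hN)) hM)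

theorem minRel_of_mem_minOrbitClosure {M : so8} (hM : M ∈ minOrbitClosure) : MinRel M where
  x_mulVec_u i := funext fun a => eq_on_minOrbitClosure
    (f := fun M => (xCoord M *ᵥ uCoord i M) a) (g := fun M => (lamCoord M i • uCoord i M) a)
    (sum_mem_polyFun fun c => mul_mem (xCoord_mem_polyFun a c) (uCoord_mem_polyFun i c))
    (mul_mem (lamCoord_mem_polyFun i) (uCoord_mem_polyFun i a))
    (fun N hN => congrFun ((minRel_of_mem_minCone hN).x_mulVec_u i) a) hM
  w_vecMul_x i := funext fun a => eq_on_minOrbitClosure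
    (f := fun M => (wCoord i M ᵥ* xCoord M) a) (g := fun M => (lamCoord M i • wCoord i M) a)
    (sum_mem_polyFun fun c => mul_mem (wCoord_mem_polyFun i c) (xCoord_mem_polyFun c a))
    (mul_mem (lamCoord_mem_polyFun i) (wCoord_mem_polyFun i a))
    (fun N hN => congrFun ((minRel_of_mem_minCone hN).w_vecMul_x i) a) hM
  trace_sq := eq_on_minOrbitClosure
    (f := fun M => (xCoord M * xCoord M).trace) (g := fun M => -2 * esymmTwo (lamCoord M))
    (sum_mem_polyFun fun c => xCoord_sq_mem_polyFun c c)
    (mul_mem (const_mem_polyFun _) esymmTwo_mem_polyFun)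
    (fun N hN => (minRel_of_mem_minCone hN).trace_sq) hM
  u_mul_w i a b := eq_on_minOrbitClosure
    (f := fun M => uCoord i M a * wCoord i M b)
    (g := fun M => (xCoord M * xCoord M) a b + lamCoord M i * xCoord M a b +
      (lamCoord M i ^ 2 + esymmTwo (lamCoord M)) * (1 : Matrix (Fin 3) (Fin 3) ℂ) a b)
    (mul_mem (uCoord_mem_polyFun i a) (wCoord_mem_polyFun i b))
    (add_mem (add_mem (xCoord_sq_mem_polyFun a b)
      (mul_mem (lamCoord_mem_polyFun i) (xCoord_mem_polyFun a b)))
      (mul_mem (add_mem (pow_mem (lamCoord_mem_polyFun i) 2) esymmTwo_mem_polyFun)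
        (const_mem_polyFun _)))
    (fun N hN => (minRel_of_mem_minCone hN).u_mul_w i a b) hM
  u_mul_u i j hij a b := by
    rw [cross_apply_add]
    have hc : ∀ c d, (fun M : so8 => (xCoord M - lamCoord M i • 1) b c *
        wCoord (-(i + j)) M d) ∈ polyFun so8 := fun c d =>
      mul_mem (sub_mem (xCoord_mem_polyFun b c) (mul_mem (lamCoord_mem_polyFun i)
        (const_mem_polyFun ((1 : Matrix (Fin 3) (Fin 3) ℂ) b c)))) (wCoord_mem_polyFun _ d)
    refine eq_on_minOrbitClosure (f := fun M => uCoord i M a * uCoord j M b)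
      (mul_mem (uCoord_mem_polyFun i a) (uCoord_mem_polyFun j b))
      (sub_mem (hc (a + 1) (a + 2)) (hc (a + 2) (a + 1))) (fun N hN => ?_) hM
    exact ((minRel_of_mem_minCone hN).u_mul_u i j hij a b).trans (cross_apply_add _ _ _)
  w_mul_w i j hij a b := by
    rw [cross_apply_add]
    have hc : ∀ c d, (fun M : so8 => ((xCoord M)ᵀ - lamCoord M i • 1) b c *
        uCoord (-(i + j)) M d) ∈ polyFun so8 := fun c d =>
      mul_mem (sub_mem (xCoord_mem_polyFun c b) (mul_mem (lamCoord_mem_polyFun i)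
        (const_mem_polyFun ((1 : Matrix (Fin 3) (Fin 3) ℂ) b c)))) (uCoord_mem_polyFun _ d)
    refine eq_on_minOrbitClosure (f := fun M => wCoord i M a * wCoord j M b)
      (mul_mem (wCoord_mem_polyFun i a) (wCoord_mem_polyFun j b))
      (neg_mem (sub_mem (hc (a + 1) (a + 2)) (hc (a + 2) (a + 1)))) (fun N hN => ?_) hM
    exact ((minRel_of_mem_minCone hN).w_mul_w i j hij a b).trans
      (congrArg _ (cross_apply_add _ _ _))

theorem trace_cube_phi (g : Matrix.SpecialLinearGroup (Fin 3) ℂ) (z : zl) :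
    (xCoord (phi g z) * xCoord (phi g z) * xCoord (phi g z)).trace =
      3 * (z.1 0 * z.1 1 * z.1 2) := by
  have h2 : (g⁻¹).1 * g.1 = 1 := congrArg Subtype.val (inv_mul_cancel g)
  have hz : ∑ i, z.1 i = 0 := z.2
  rw [Fin.sum_univ_three] at hz
  have e : xCoord (phi g z) * xCoord (phi g z) * xCoord (phi g z) =
      g.1 * (Matrix.diagonal z.1 * Matrix.diagonal z.1 * Matrix.diagonal z.1) * (g⁻¹).1 := by
    rw [xCoord_phi]
    generalize (g⁻¹).1 = b at *
    simp only [Matrix.mul_assoc]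
    rw [← Matrix.mul_assoc b g.1, h2, Matrix.one_mul, ← Matrix.mul_assoc b g.1, h2, Matrix.one_mul]
  rw [e, Matrix.trace_mul_comm, ← Matrix.mul_assoc, h2, Matrix.one_mul]
  simp only [Matrix.diagonal_mul_diagonal, Matrix.trace_diagonal, Fin.sum_univ_three]
  have h : z.1 2 = -z.1 0 - z.1 1 := by linear_combination hz
  rw [h]
  ring

/-- The characteristic polynomial of the `sl₃`-component has the `𝔷(𝔩)`-coordinates as roots. -/
theorem trace_cube {M : so8} (hM : M ∈ minOrbitClosure) :
    (xCoord M * xCoord M * xCoord M).trace =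
      3 * (lamCoord M 0 * lamCoord M 1 * lamCoord M 2) := by
  refine sub_eq_zero.1 (eq_zero_of_forall_phi (f := fun M =>
    (xCoord M * xCoord M * xCoord M).trace - 3 * (lamCoord M 0 * lamCoord M 1 * lamCoord M 2))
    (sub_mem ?_ (mul_mem (const_mem_polyFun _) (mul_mem (mul_mem (lamCoord_mem_polyFun 0)
      (lamCoord_mem_polyFun 1)) (lamCoord_mem_polyFun 2)))) (fun g z => ?_) hM)
  · exact sum_mem_polyFun fun a => sum_mem_polyFun fun c =>
      mul_mem (xCoord_sq_mem_polyFun a c) (xCoord_mem_polyFun c a)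
  · rw [trace_cube_phi, lamCoord_phi, sub_self]

/-! ### Power sums of three conjugate functions -/

section PowerSums

/-- A submodule that contains `1` and is stable under multiplication by generators contains the
algebra that they generate. -/
theorem adjoin_induction_left {A : Type*} [CommRing A] [Algebra ℂ A] {s : Set A}
    {N : Submodule ℂ A} (h1 : 1 ∈ N) (h : ∀ g ∈ s, ∀ f ∈ N, g * f ∈ N) {f : A}
    (hf : f ∈ Algebra.adjoin ℂ s) : f ∈ N := by
  rw [← Subalgebra.mem_toSubmodule, Algebra.adjoin_eq_span] at hf
  refine Submodule.span_le.2 (fun x hx => ?_) hf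
  induction hx using Submonoid.closure_induction_left with
  | one => exact h1
  | mul_left x hx y _ ih => exact h x hx y ih

variable {R : Type*} [CommRing R] [Algebra ℂ R] {ι : Type*}

/-- The span of the products of members of one of the two families, with coefficients in `C`. -/
def productSpan (C : Subalgebra ℂ (Fin 3 → R)) (U W : ι → Fin 3 → R) :
    Submodule ℂ (Fin 3 → R) :=
  Submodule.span ℂ {y | ∃ c ∈ C, ∃ L : List ι, y = c * (L.map U).prod ∨ y = c * (L.map W).prod}

theorem productSpan_symm (C : Subalgebra ℂ (Fin 3 → R)) (U W : ι → Fin 3 → R) :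
    productSpan C U W = productSpan C W U := by
  unfold productSpan
  congr 1
  ext y
  simp only [or_comm]

/-- The algebra of triples generated by the coefficients and the two families. -/
def tripleAlgebra (C : Subalgebra ℂ (Fin 3 → R)) (U W : ι → Fin 3 → R) :
    Subalgebra ℂ (Fin 3 → R) :=
  Algebra.adjoin ℂ (C ∪ (Set.range U ∪ Set.range W))

/-- The span of the products of the components of three triples. -/
def componentSpan (Y : Subalgebra ℂ (Fin 3 → R)) : Submodule ℂ R :=
  Submodule.span ℂ {f | ∃ y ∈ Y, ∃ y' ∈ Y, ∃ y'' ∈ Y, f = y 0 * y' 1 * y'' 2}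

theorem adjoin_le_componentSpan {Y : Subalgebra ℂ (Fin 3 → R)} {f : R}
    (hf : f ∈ Algebra.adjoin ℂ {f | ∃ y ∈ Y, ∃ i, f = y i}) : f ∈ componentSpan Y := by
  refine adjoin_induction_left (N := componentSpan Y) (Submodule.subset_span
    ⟨1, one_mem Y, 1, one_mem Y, 1, one_mem Y, by simp⟩) ?_ hf
  rintro _ ⟨z, hz, i, rfl⟩ f hf
  induction hf using Submodule.span_induction with
  | zero => simp
  | add y z _ _ hy hz => rw [mul_add]; exact add_mem hy hz
  | smul a y _ hy => rw [mul_smul_comm]; exact Submodule.smul_mem _ _ hy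
  | mem f hf =>
    obtain ⟨y, hy, y', hy', y'', hy'', rfl⟩ := hf
    apply Submodule.subset_span
    fin_cases i
    · exact ⟨z * y, mul_mem hz hy, y', hy', y'', hy'', by simp [mul_assoc]⟩
    · exact ⟨y, hy, z * y', mul_mem hz hy', y'', hy'', by simp; ring⟩
    · exact ⟨y, hy, y', hy', z * y'', mul_mem hz hy'', by simp; ring⟩

/-- Every permutation of three letters is induced by four permutations of four letters. -/
theorem map_resolvent_univ : (Finset.univ : Finset (Equiv.Perm (Fin 4))).val.map
    (fun σ => (resolvent σ⁻¹ 0, resolvent σ⁻¹ 1, resolvent σ⁻¹ 2)) =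
      4 • ({(0, 1, 2), (0, 2, 1), (1, 0, 2), (1, 2, 0), (2, 0, 1), (2, 1, 0)} :
        Multiset (Fin 3 × Fin 3 × Fin 3)) := by
  decide +kernel

/-- The symmetrisation of a product of components in terms of power sums. -/
theorem sum_perm_mul {R : Type*} [CommRing R] (y y' y'' : Fin 3 → R) :
    ∑ σ : Equiv.Perm (Fin 4), y (resolvent σ⁻¹ 0) * y' (resolvent σ⁻¹ 1) * y'' (resolvent σ⁻¹ 2) =
      4 * ((∑ i, y i) * (∑ i, y' i) * (∑ i, y'' i) - (∑ i, (y * y') i) * (∑ i, y'' i) -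
        (∑ i, (y * y'') i) * (∑ i, y' i) - (∑ i, (y' * y'') i) * (∑ i, y i) +
        2 * ∑ i, (y * y' * y'') i) := by
  have h := congrArg (fun m => (m.map fun t : Fin 3 × Fin 3 × Fin 3 =>
    y t.1 * y' t.2.1 * y'' t.2.2).sum) map_resolvent_univ
  simp only [Multiset.map_map, Function.comp_def] at h
  refine Eq.trans h ?_
  simp [Multiset.map_nsmul, Multiset.sum_nsmul, Fin.sum_univ_three]
  ring

variable [Fintype ι]

/-- `C` is an algebra of triples of coefficients, `U` and `W` are families of triples. Power sums of
coefficients and their multiples by members of `U` and `W` are in `B`, and products of members of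
`U` and `W` can be rewritten. -/
structure IsPowerSumSystem (B : Subalgebra ℂ R) (C : Subalgebra ℂ (Fin 3 → R))
    (U W : ι → Fin 3 → R) : Prop where
  one_sum_mem : ∀ r, ∑ i, U r i ∈ B ∧ ∑ i, W r i ∈ B
  coeff_sum_mem : ∀ c ∈ C, ∑ i, c i ∈ B
  sum_mul_mem : ∀ c ∈ C, ∀ r, ∑ i, c i * U r i ∈ B
  sum_mul_mem' : ∀ c ∈ C, ∀ r, ∑ i, c i * W r i ∈ B
  prod_mem_coeff : ∀ r s, U r * W s ∈ C
  mul_eq : ∀ r s, ∃ c : ι → Fin 3 → R, (∀ t, c t ∈ C) ∧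
    ∀ i j, i ≠ j → U r i * U s j = ∑ t, c t i * W t (-(i + j))
  mul_eq' : ∀ r s, ∃ c : ι → Fin 3 → R, (∀ t, c t ∈ C) ∧
    ∀ i j, i ≠ j → W r i * W s j = ∑ t, c t i * U t (-(i + j))

variable {B : Subalgebra ℂ R} {C : Subalgebra ℂ (Fin 3 → R)} {U W : ι → Fin 3 → R}

theorem IsPowerSumSystem.symm (h : IsPowerSumSystem B C U W) : IsPowerSumSystem B C W U where
  one_sum_mem r := (h.one_sum_mem r).symm
  coeff_sum_mem := h.coeff_sum_mem
  sum_mul_mem := h.sum_mul_mem'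
  sum_mul_mem' := h.sum_mul_mem
  prod_mem_coeff r s := mul_comm (U s) (W r) ▸ h.prod_mem_coeff s r
  mul_eq := h.mul_eq'
  mul_eq' := h.mul_eq

variable (B C) in
/-- The triples all of whose multiples by coefficients have power sums in `B`. -/
def goodSubmodule : Submodule ℂ (Fin 3 → R) where
  carrier := {y | ∀ c ∈ C, ∑ i, c i * y i ∈ B}
  zero_mem' c _ := by simp
  add_mem' hy hz c hc := by
    simp only [Pi.add_apply, mul_add, Finset.sum_add_distrib]
    exact add_mem (hy c hc) (hz c hc)
  smul_mem' a y hy c hc := by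
    simp only [Pi.smul_apply, mul_smul_comm, ← Finset.smul_sum]
    exact B.smul_mem (hy c hc) a

theorem mul_mem_goodSubmodule {c y : Fin 3 → R} (hc : c ∈ C) (hy : y ∈ goodSubmodule B C) :
    c * y ∈ goodSubmodule B C := fun d hd => by
  have := hy (d * c) (mul_mem hd hc)
  simpa only [Pi.mul_apply, mul_assoc] using this

/-- The off-diagonal terms of `p(yU) p(U')` are rewritten in terms of `W`. -/
theorem IsPowerSumSystem.mul_mul_mem (h : IsPowerSumSystem B C U W) {y : Fin 3 → R} {r s : ι}
    (hy : y ∈ goodSubmodule B C) (hU : U r * y ∈ goodSubmodule B C)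
    (hW : ∀ t, W t * y ∈ goodSubmodule B C) : U s * (U r * y) ∈ goodSubmodule B C := by
  intro c hc
  obtain ⟨d, hd, e⟩ := h.mul_eq r s
  have key : ∑ i, c i * (U s * (U r * y)) i = (∑ i, c i * (U r * y) i) * ∑ i, U s i -
      ∑ t, ((∑ i, (c * d t) i * y i) * (∑ i, W t i) - ∑ i, (c * d t) i * (W t * y) i) := by
    have e1 : ∑ t, ((∑ i, (c * d t) i * y i) * (∑ i, W t i) - ∑ i, (c * d t) i * (W t * y) i) =
        c 0 * y 0 * (U r 0 * U s 2) + c 0 * y 0 * (U r 0 * U s 1) +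
        (c 1 * y 1 * (U r 1 * U s 2) + c 1 * y 1 * (U r 1 * U s 0)) +
        (c 2 * y 2 * (U r 2 * U s 1) + c 2 * y 2 * (U r 2 * U s 0)) := by
      rw [e 0 2 (by decide), e 0 1 (by decide), e 1 2 (by decide), e 1 0 (by decide),
        e 2 1 (by decide), e 2 0 (by decide)]
      simp only [Finset.mul_sum, ← Finset.sum_add_distrib]
      refine Finset.sum_congr rfl fun t _ => ?_
      simp only [Fin.sum_univ_three, Pi.mul_apply, show (-(0 + 2) : Fin 3) = 1 from rfl,
        show (-(0 + 1) : Fin 3) = 2 from rfl, show (-(1 + 2) : Fin 3) = 0 from rfl,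
        show (-(1 + 0) : Fin 3) = 2 from rfl, show (-(2 + 1) : Fin 3) = 0 from rfl,
        show (-(2 + 0) : Fin 3) = 1 from rfl]
      ring
    rw [e1]
    simp only [Fin.sum_univ_three, Pi.mul_apply]
    ring
  rw [key]
  refine sub_mem (mul_mem (hU c hc) (h.one_sum_mem s).1) (sum_mem fun t _ => sub_mem
    (mul_mem (hy _ (mul_mem hc (hd t))) (h.one_sum_mem t).2) (hW t _ (mul_mem hc (hd t))))

/-- Induction on the number of factors. The products with a member of `W` that arise are shorter,
because a member of `W` cancels against one of `U`. -/
theorem IsPowerSumSystem.prod_mem (h : IsPowerSumSystem B C U W) (L : List ι) :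
    (L.map U).prod ∈ goodSubmodule B C := by
  match L with
  | [] => exact fun c hc => by simpa using h.coeff_sum_mem c hc
  | [r] => exact fun c hc => by simpa using h.sum_mul_mem c hc r
  | r :: s :: L =>
    simp only [List.map_cons, List.prod_cons]
    refine h.mul_mul_mem (h.prod_mem L) ?_ fun t => ?_
    · exact h.prod_mem (s :: L)
    · match L with
      | [] => exact fun c hc => by simpa using h.sum_mul_mem' c hc t
      | r' :: L =>
        rw [List.map_cons, List.prod_cons, ← mul_assoc, mul_comm (W t)]
        exact mul_mem_goodSubmodule (h.prod_mem_coeff r' t) (h.prod_mem L)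

theorem IsPowerSumSystem.mul_mem_productSpan (h : IsPowerSumSystem B C U W) (r : ι)
    {y : Fin 3 → R} (hy : y ∈ productSpan C U W) : U r * y ∈ productSpan C U W := by
  induction hy using Submodule.span_induction with
  | zero => simp
  | add y z _ _ hy hz => rw [mul_add]; exact add_mem hy hz
  | smul a y _ hy => rw [mul_smul_comm]; exact Submodule.smul_mem _ _ hy
  | mem y hy =>
    obtain ⟨c, hc, L, rfl | rfl⟩ := hy
    · exact Submodule.subset_span ⟨c, hc, r :: L, .inl (by
        rw [List.map_cons, List.prod_cons, mul_left_comm])⟩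
    · match L with
      | [] => exact Submodule.subset_span ⟨c, hc, [r], .inl (by simp [mul_comm])⟩
      | s :: L =>
        refine Submodule.subset_span ⟨U r * W s * c, mul_mem (h.prod_mem_coeff r s) hc, L, .inr ?_⟩
        rw [List.map_cons, List.prod_cons]
        ring

/-- All power sums are in `B`. -/
theorem IsPowerSumSystem.sum_mem_of_mem_tripleAlgebra (h : IsPowerSumSystem B C U W)
    {y : Fin 3 → R} (hy : y ∈ tripleAlgebra C U W) : ∑ i, y i ∈ B := by
  have h1 : y ∈ productSpan C U W := by
    refine adjoin_induction_left (N := productSpan C U W)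
      (Submodule.subset_span ⟨1, one_mem C, [], .inl (by simp)⟩) ?_ hy
    rintro g (hg | ⟨r, rfl⟩ | ⟨r, rfl⟩) y hy
    · induction hy using Submodule.span_induction with
      | zero => simp
      | add y z _ _ hy hz => rw [mul_add]; exact add_mem hy hz
      | smul a y _ hy => rw [mul_smul_comm]; exact Submodule.smul_mem _ _ hy
      | mem y hy =>
        obtain ⟨c, hc, L, rfl | rfl⟩ := hy
        · exact Submodule.subset_span ⟨g * c, mul_mem hg hc, L, .inl (mul_assoc _ _ _).symm⟩
        · exact Submodule.subset_span ⟨g * c, mul_mem hg hc, L, .inr (mul_assoc _ _ _).symm⟩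
    · exact h.mul_mem_productSpan r hy
    · rw [productSpan_symm] at hy ⊢
      exact h.symm.mul_mem_productSpan r hy
  have h2 : productSpan C U W ≤ goodSubmodule B C := by
    refine Submodule.span_le.2 ?_
    rintro _ ⟨c, hc, L, rfl | rfl⟩
    · exact mul_mem_goodSubmodule hc (h.prod_mem L)
    · exact mul_mem_goodSubmodule hc (h.symm.prod_mem L)
  simpa using h2 h1 1 (one_mem C)

end PowerSums

/-! ### Reduction to functions with even exponents -/

section CrossSystem

variable {R : Type*} [CommRing R] [Algebra ℂ R]

/-- Two families of triples such that products of members of one family with different indices are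
combinations of members of the other family. -/
structure IsCrossSystem (A : Subalgebra ℂ R) (u w : Fin 3 → Fin 3 → R) : Prop where
  sq_mem : ∀ i a b, u i a * u i b ∈ A
  sq_mem' : ∀ i a b, w i a * w i b ∈ A
  mul_eq : ∀ i j, i ≠ j → ∀ a b, ∃ p ∈ A, ∃ q ∈ A,
    u i a * u j b = p * w (-(i + j)) (a + 2) + q * w (-(i + j)) (a + 1)
  mul_eq' : ∀ i j, i ≠ j → ∀ a b, ∃ p ∈ A, ∃ q ∈ A,
    w i a * w j b = p * u (-(i + j)) (a + 2) + q * u (-(i + j)) (a + 1)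

variable {A : Subalgebra ℂ R} {u w : Fin 3 → Fin 3 → R}

theorem IsCrossSystem.symm (h : IsCrossSystem A u w) : IsCrossSystem A w u :=
  ⟨h.sq_mem', h.sq_mem, h.mul_eq', h.mul_eq⟩

variable (A u w) in
/-- The `A`-module generated by the members of the two families and the products of a member of one
with a member of the other. -/
def crossSpan : Submodule A R :=
  Submodule.span A ({1} ∪ ({f | ∃ i a, f = u i a ∨ f = w i a} ∪ {f | ∃ i a j b, f = u i a * w j b}))

theorem crossSpan_symm : crossSpan A u w = crossSpan A w u := by
  unfold crossSpan
  congr 3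
  · ext f
    simp only [or_comm]
  · ext f
    constructor
    · rintro ⟨i, a, j, b, rfl⟩
      exact ⟨j, b, i, a, mul_comm _ _⟩
    · rintro ⟨i, a, j, b, rfl⟩
      exact ⟨j, b, i, a, mul_comm _ _⟩

theorem one_mem_crossSpan : 1 ∈ crossSpan A u w := Submodule.subset_span (.inl rfl)

theorem mul_mem_crossSpan {a f : R} (ha : a ∈ A) (hf : f ∈ crossSpan A u w) :
    a * f ∈ crossSpan A u w :=
  (crossSpan A u w).smul_mem ⟨a, ha⟩ hf

theorem mem_crossSpan_of_mem {a : R} (ha : a ∈ A) : a ∈ crossSpan A u w :=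
  mul_one a ▸ mul_mem_crossSpan ha one_mem_crossSpan

theorem fst_mem_crossSpan (i a : Fin 3) : u i a ∈ crossSpan A u w :=
  Submodule.subset_span (.inr (.inl ⟨i, a, .inl rfl⟩))

theorem snd_mem_crossSpan (i a : Fin 3) : w i a ∈ crossSpan A u w :=
  Submodule.subset_span (.inr (.inl ⟨i, a, .inr rfl⟩))

theorem fst_mul_snd_mem_crossSpan (i a j b : Fin 3) : u i a * w j b ∈ crossSpan A u w :=
  Submodule.subset_span (.inr (.inr ⟨i, a, j, b, rfl⟩))

theorem IsCrossSystem.fst_mul_fst_mem (h : IsCrossSystem A u w) (i a j b : Fin 3) :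
    u i a * u j b ∈ crossSpan A u w := by
  by_cases hij : i = j
  · subst hij
    exact mem_crossSpan_of_mem (h.sq_mem i a b)
  · obtain ⟨p, hp, q, hq, e⟩ := h.mul_eq i j hij a b
    rw [e]
    exact add_mem (mul_mem_crossSpan hp (snd_mem_crossSpan _ _))
      (mul_mem_crossSpan hq (snd_mem_crossSpan _ _))

theorem IsCrossSystem.snd_mul_snd_mem (h : IsCrossSystem A u w) (i a j b : Fin 3) :
    w i a * w j b ∈ crossSpan A u w := by
  rw [crossSpan_symm]
  exact h.symm.fst_mul_fst_mem i a j b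

theorem IsCrossSystem.fst_mul_mem (h : IsCrossSystem A u w) (i a : Fin 3) {f : R}
    (hf : f ∈ crossSpan A u w) : u i a * f ∈ crossSpan A u w := by
  induction hf using Submodule.span_induction with
  | zero => simp
  | add f g _ _ hf hg => rw [mul_add]; exact add_mem hf hg
  | smul r f _ hf => rw [mul_smul_comm]; exact Submodule.smul_mem _ _ hf
  | mem f hf =>
    rcases hf with rfl | ⟨j, b, rfl | rfl⟩ | ⟨j, b, k, c, rfl⟩
    · rw [mul_one]
      exact fst_mem_crossSpan i a
    · exact h.fst_mul_fst_mem i a j b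
    · exact fst_mul_snd_mem_crossSpan i a j b
    · rw [← mul_assoc]
      by_cases hij : i = j
      · subst hij
        exact mul_mem_crossSpan (h.sq_mem i a b) (snd_mem_crossSpan _ _)
      · obtain ⟨p, hp, q, hq, e⟩ := h.mul_eq i j hij a b
        rw [e, add_mul, mul_assoc, mul_assoc]
        exact add_mem (mul_mem_crossSpan hp (h.snd_mul_snd_mem _ _ _ _))
          (mul_mem_crossSpan hq (h.snd_mul_snd_mem _ _ _ _))

theorem IsCrossSystem.snd_mul_mem (h : IsCrossSystem A u w) (i a : Fin 3) {f : R}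
    (hf : f ∈ crossSpan A u w) : w i a * f ∈ crossSpan A u w := by
  rw [crossSpan_symm] at hf ⊢
  exact h.symm.fst_mul_mem i a hf

end CrossSystem

/-! ### The coordinate functions on the closure of the minimal orbit -/

/-- The restrictions of the coordinates `x`. -/
def xFun (a b : Fin 3) : minOrbitClosure → ℂ := fun M => xCoord M.1 a b

/-- The restrictions of the coordinates `λ`. -/
def lFun (i : Fin 3) : minOrbitClosure → ℂ := fun M => lamCoord M.1 i

/-- The restrictions of the coordinates `u`. -/
def uFun (i a : Fin 3) : minOrbitClosure → ℂ := fun M => uCoord i M.1 a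

/-- The restrictions of the coordinates `w`. -/
def wFun (i a : Fin 3) : minOrbitClosure → ℂ := fun M => wCoord i M.1 a

/-- The triples of quadratic functions `u i a * u i b`. -/
def uSq (r : Fin 3 × Fin 3) (i : Fin 3) : minOrbitClosure → ℂ := uFun i r.1 * uFun i r.2

/-- The triples of quadratic functions `w i a * w i b`. -/
def wSq (r : Fin 3 × Fin 3) (i : Fin 3) : minOrbitClosure → ℂ := wFun i r.1 * wFun i r.2

/-- The algebra generated by the components of the map to `sl₃ ⊕ S²V ⊕ S²V^*`. -/
def basicInvariants : Subalgebra ℂ (minOrbitClosure → ℂ) :=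
  Algebra.adjoin ℂ (Set.range (fun r : Fin 3 × Fin 3 => xFun r.1 r.2) ∪
    (Set.range (fun r => ∑ i, uSq r i) ∪ Set.range (fun r => ∑ i, wSq r i)))

/-- The triples of polynomials in `λ` with coefficients in the algebra of basic invariants. -/
def coeffAlgebra : Subalgebra ℂ (Fin 3 → minOrbitClosure → ℂ) :=
  Algebra.adjoin ℂ ({c | ∃ b ∈ basicInvariants, c = fun _ => b} ∪ {lFun})

theorem xFun_mem (a b : Fin 3) : xFun a b ∈ basicInvariants :=
  Algebra.subset_adjoin (.inl ⟨(a, b), rfl⟩)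

theorem sum_uSq_mem (r : Fin 3 × Fin 3) : ∑ i, uSq r i ∈ basicInvariants :=
  Algebra.subset_adjoin (.inr (.inl ⟨r, rfl⟩))

theorem sum_wSq_mem (r : Fin 3 × Fin 3) : ∑ i, wSq r i ∈ basicInvariants :=
  Algebra.subset_adjoin (.inr (.inr ⟨r, rfl⟩))

theorem const_mem_coeffAlgebra {b : minOrbitClosure → ℂ} (hb : b ∈ basicInvariants) :
    (fun _ => b) ∈ coeffAlgebra :=
  Algebra.subset_adjoin (.inl ⟨b, hb, rfl⟩)

theorem lFun_mem_coeffAlgebra : lFun ∈ coeffAlgebra := Algebra.subset_adjoin (.inr rfl)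

/-- The entries of `x²`. -/
def xSqFun (a b : Fin 3) : minOrbitClosure → ℂ := ∑ c, xFun a c * xFun c b

theorem xSqFun_mem (a b : Fin 3) : xSqFun a b ∈ basicInvariants :=
  sum_mem fun c _ => mul_mem (xFun_mem a c) (xFun_mem c b)

theorem xSqFun_apply (a b : Fin 3) (M : minOrbitClosure) :
    xSqFun a b M = (xCoord M.1 * xCoord M.1) a b := by
  rw [xSqFun, Finset.sum_apply, Matrix.mul_apply]
  rfl

/-- The second elementary symmetric function of the coordinates `λ`. -/
def esymmTwoFun : minOrbitClosure → ℂ := fun M => esymmTwo (lamCoord M.1)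

theorem esymmTwoFun_mem : esymmTwoFun ∈ basicInvariants := by
  have : esymmTwoFun = (-1 / 2 : ℂ) • ∑ a, xSqFun a a := by
    ext M
    have h := (minRel_of_mem_minOrbitClosure M.2).trace_sq
    simp only [Matrix.trace, Matrix.diag] at h
    simp only [Pi.smul_apply, Finset.sum_apply, xSqFun_apply, h, smul_eq_mul, esymmTwoFun]
    ring
  rw [this]
  exact Subalgebra.smul_mem _ (sum_mem fun a _ => xSqFun_mem a a) _

/-- The third elementary symmetric function of the coordinates `λ`. -/
def esymmThreeFun : minOrbitClosure → ℂ := lFun 0 * lFun 1 * lFun 2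

theorem esymmThreeFun_mem : esymmThreeFun ∈ basicInvariants := by
  have : esymmThreeFun = (1 / 3 : ℂ) • ∑ a, ∑ b, xSqFun a b * xFun b a := by
    ext M
    have h := trace_cube M.2
    simp only [Matrix.trace, Matrix.diag, Matrix.mul_apply (M := xCoord M.1 * xCoord M.1)] at h
    simp only [Pi.smul_apply, Finset.sum_apply, Pi.mul_apply, xSqFun_apply, smul_eq_mul, xFun, h,
      esymmThreeFun, lFun]
    ring
  rw [this]
  exact Subalgebra.smul_mem _ (sum_mem fun a _ => sum_mem fun b _ =>
    mul_mem (xSqFun_mem a b) (xFun_mem b a)) _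

/-- The coordinates `λ` are roots of a polynomial whose coefficients are basic invariants. -/
theorem lFun_cube (i : Fin 3) :
    lFun i * (lFun i * lFun i) = esymmThreeFun - esymmTwoFun * lFun i := by
  ext M
  have h := sum_lamCoord M.1
  rw [Fin.sum_univ_three] at h
  have h2 : lamCoord M.1 2 = -lamCoord M.1 0 - lamCoord M.1 1 := by linear_combination h
  fin_cases i <;> simp [lFun, esymmThreeFun, esymmTwoFun, esymmTwo, h2] <;> ring

theorem lFun_mul_uSq (a b i : Fin 3) : lFun i * uSq (a, b) i = ∑ c, xFun a c * uSq (c, b) i := by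
  ext M
  have h := congrFun ((minRel_of_mem_minOrbitClosure M.2).x_mulVec_u i) a
  simp only [Matrix.mulVec, dotProduct, Pi.smul_apply, smul_eq_mul] at h
  simp only [Pi.mul_apply, Finset.sum_apply, lFun, uSq, uFun, xFun, ← mul_assoc, ← h,
    Finset.sum_mul]

theorem lFun_mul_wSq (a b i : Fin 3) : lFun i * wSq (a, b) i = ∑ c, xFun c a * wSq (c, b) i := by
  ext M
  have h := congrFun ((minRel_of_mem_minOrbitClosure M.2).w_vecMul_x i) a
  simp only [Matrix.vecMul, dotProduct, Pi.smul_apply, smul_eq_mul, mul_comm (wCoord i M.1 _)] at h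
  simp only [Pi.mul_apply, Finset.sum_apply, lFun, wSq, wFun, xFun, ← mul_assoc, ← h,
    Finset.sum_mul]

/-- The triples with entries `(x²)_ab + λ_i x_ab + (λ_i² + e₂) δ_ab`. -/
def uwCoeff (a b i : Fin 3) : minOrbitClosure → ℂ :=
  xSqFun a b + lFun i * xFun a b +
    (1 : Matrix (Fin 3) (Fin 3) ℂ) a b • (lFun i * lFun i + esymmTwoFun)

theorem uFun_mul_wFun (a b i : Fin 3) : uFun i a * wFun i b = uwCoeff a b i := by
  ext M
  have h := (minRel_of_mem_minOrbitClosure M.2).u_mul_w i a b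
  simp only [Pi.mul_apply, uFun, wFun, h, uwCoeff, Pi.add_apply, xSqFun_apply, xFun, lFun,
    Pi.smul_apply, smul_eq_mul, esymmTwoFun]
  ring

theorem uwCoeff_mem (a b : Fin 3) : uwCoeff a b ∈ coeffAlgebra :=
  add_mem (add_mem (const_mem_coeffAlgebra (xSqFun_mem a b))
    (mul_mem lFun_mem_coeffAlgebra (const_mem_coeffAlgebra (xFun_mem a b))))
    (Subalgebra.smul_mem _ (add_mem (mul_mem lFun_mem_coeffAlgebra lFun_mem_coeffAlgebra)
      (const_mem_coeffAlgebra esymmTwoFun_mem)) _)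

/-- The triples with entries `x_cd - λ_i δ_cd`. -/
def crossCoeff (c d i : Fin 3) : minOrbitClosure → ℂ :=
  xFun c d - (1 : Matrix (Fin 3) (Fin 3) ℂ) c d • lFun i

theorem crossCoeff_mem (c d : Fin 3) : crossCoeff c d ∈ coeffAlgebra :=
  sub_mem (const_mem_coeffAlgebra (xFun_mem c d))
    (Subalgebra.smul_mem _ lFun_mem_coeffAlgebra _)

theorem uFun_mul_uFun {i j : Fin 3} (hij : i ≠ j) (a c : Fin 3) : uFun i a * uFun j c =
    crossCoeff c (a + 1) i * wFun (-(i + j)) (a + 2) -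
      crossCoeff c (a + 2) i * wFun (-(i + j)) (a + 1) := by
  ext M
  have h := (minRel_of_mem_minOrbitClosure M.2).u_mul_u i j hij a c
  rw [cross_apply_add] at h
  simp only [Matrix.sub_apply, Matrix.smul_apply, smul_eq_mul] at h
  simp only [Pi.mul_apply, Pi.sub_apply, uFun, wFun, h, crossCoeff, xFun, lFun, Pi.smul_apply,
    smul_eq_mul]
  ring

theorem wFun_mul_wFun {i j : Fin 3} (hij : i ≠ j) (a c : Fin 3) : wFun i a * wFun j c =
    -crossCoeff (a + 1) c i * uFun (-(i + j)) (a + 2) -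
      -crossCoeff (a + 2) c i * uFun (-(i + j)) (a + 1) := by
  ext M
  have h := (minRel_of_mem_minOrbitClosure M.2).w_mul_w i j hij a c
  rw [cross_apply_add] at h
  simp only [Matrix.sub_apply, Matrix.smul_apply, smul_eq_mul, Matrix.transpose_apply,
    Matrix.one_apply, eq_comm (a := c)] at h
  simp only [Pi.mul_apply, Pi.sub_apply, Pi.neg_apply, uFun, wFun, h, crossCoeff, xFun, lFun,
    Pi.smul_apply, smul_eq_mul, Matrix.one_apply]
  ring

/-! ### Power sums are basic invariants -/

/-- Power sums of multiples of the members of a family are basic invariants if multiplication by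
`λ` preserves this property. -/
theorem sum_mul_mem_basicInvariants {κ : Type*} {F : κ → Fin 3 → minOrbitClosure → ℂ}
    (h0 : ∀ k, ∑ i, F k i ∈ basicInvariants)
    (hl : ∀ c : Fin 3 → minOrbitClosure → ℂ, (∀ k, ∑ i, c i * F k i ∈ basicInvariants) →
      ∀ k, ∑ i, c i * (lFun i * F k i) ∈ basicInvariants)
    {c : Fin 3 → minOrbitClosure → ℂ} (hc : c ∈ coeffAlgebra) :
    ∀ k, ∑ i, c i * F k i ∈ basicInvariants := by
  let N : Submodule ℂ (Fin 3 → minOrbitClosure → ℂ) :=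
    { carrier := {c | ∀ k, ∑ i, c i * F k i ∈ basicInvariants}
      zero_mem' := fun k => by simp
      add_mem' := fun hc hd k => by
        simp only [Pi.add_apply, add_mul, Finset.sum_add_distrib]
        exact add_mem (hc k) (hd k)
      smul_mem' := fun a c hc k => by
        simp only [Pi.smul_apply, smul_mul_assoc, ← Finset.smul_sum]
        exact Subalgebra.smul_mem _ (hc k) a }
  refine adjoin_induction_left (N := N) (fun k => ?_) ?_ hc
  · simpa using h0 k
  · rintro _ (⟨b, hb, rfl⟩ | rfl) c hc k
    · simp only [Pi.mul_apply, mul_assoc, ← Finset.mul_sum]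
      exact mul_mem hb (hc k)
    · simp only [Pi.mul_apply, mul_comm (lFun _) (c _), mul_assoc]
      exact hl c hc k

theorem sum_mem_basicInvariants {c : Fin 3 → minOrbitClosure → ℂ} (hc : c ∈ coeffAlgebra) :
    ∑ i, c i ∈ basicInvariants := by
  have hl : ∑ i, lFun i = 0 := by
    ext M
    rw [Finset.sum_apply]
    exact sum_lamCoord M.1
  have hl2 : ∑ i, lFun i * lFun i = (-2 : ℂ) • esymmTwoFun := by
    ext M
    have h := sum_lamCoord M.1
    rw [Fin.sum_univ_three] at h
    simp only [Fin.sum_univ_three, Pi.add_apply, Pi.mul_apply, lFun, Pi.smul_apply, smul_eq_mul,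
      esymmTwoFun, esymmTwo]
    linear_combination (lamCoord M.1 0 + lamCoord M.1 1 + lamCoord M.1 2) * h
  -- the powers `λ ^ 0`, `λ ^ 1`, `λ ^ 2` span all powers
  have := sum_mul_mem_basicInvariants (F := ![1, lFun, lFun * lFun]) (fun k => ?_)
    (fun c hc k => ?_) hc 0
  · simpa using this
  · fin_cases k
    · simp
    · simp [hl]
    · simp only [Fin.reduceFinMk, Matrix.cons_val, Pi.mul_apply, hl2]
      exact Subalgebra.smul_mem _ esymmTwoFun_mem _
  · fin_cases k
    · simpa using hc 1
    · simpa using hc 2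
    · have h0 := hc 0
      have h1 := hc 1
      simp only [Matrix.cons_val, Pi.one_apply, mul_one] at h0 h1
      simp only [Fin.reduceFinMk, Matrix.cons_val, Pi.mul_apply, lFun_cube, mul_sub,
        Finset.sum_sub_distrib, mul_left_comm _ esymmTwoFun, ← Finset.mul_sum, ← Finset.sum_mul]
      exact sub_mem (mul_mem h0 esymmThreeFun_mem) (mul_mem esymmTwoFun_mem h1)

theorem sum_mul_uSq_mem {c : Fin 3 → minOrbitClosure → ℂ} (hc : c ∈ coeffAlgebra) :
    ∀ r, ∑ i, c i * uSq r i ∈ basicInvariants := by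
  refine sum_mul_mem_basicInvariants sum_uSq_mem (fun c hc r => ?_) hc
  obtain ⟨a, b⟩ := r
  simp only [lFun_mul_uSq, Finset.mul_sum]
  rw [Finset.sum_comm]
  simp only [mul_left_comm _ (xFun _ _), ← Finset.mul_sum]
  exact sum_mem fun d _ => mul_mem (xFun_mem a d) (hc (d, b))

theorem sum_mul_wSq_mem {c : Fin 3 → minOrbitClosure → ℂ} (hc : c ∈ coeffAlgebra) :
    ∀ r, ∑ i, c i * wSq r i ∈ basicInvariants := by
  refine sum_mul_mem_basicInvariants sum_wSq_mem (fun c hc r => ?_) hc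
  obtain ⟨a, b⟩ := r
  simp only [lFun_mul_wSq, Finset.mul_sum]
  rw [Finset.sum_comm]
  simp only [mul_left_comm _ (xFun _ _), ← Finset.mul_sum]
  exact sum_mem fun d _ => mul_mem (xFun_mem d a) (hc (d, b))

/-- Products of linear relations are relations between the quadratic functions. -/
theorem exists_mul_eq_sum {u w : Fin 3 → Fin 3 → minOrbitClosure → ℂ}
    {y : Fin 3 → Fin 3 → Fin 3 → minOrbitClosure → ℂ} (hy : ∀ c d, y c d ∈ coeffAlgebra)
    (h : ∀ i j, i ≠ j → ∀ a c, u i a * u j c =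
      y c (a + 1) i * w (-(i + j)) (a + 2) - y c (a + 2) i * w (-(i + j)) (a + 1))
    (r s : Fin 3 × Fin 3) : ∃ c : Fin 3 × Fin 3 → Fin 3 → minOrbitClosure → ℂ,
      (∀ t, c t ∈ coeffAlgebra) ∧ ∀ i j, i ≠ j → (u i r.1 * u i r.2) * (u j s.1 * u j s.2) =
        ∑ t, c t i * (w (-(i + j)) t.1 * w (-(i + j)) t.2) := by
  -- the coefficient of `w e` in `u i a * u j c`
  let k : Fin 3 → Fin 3 → Fin 3 → Fin 3 → minOrbitClosure → ℂ := fun a c e =>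
    (if e = a + 2 then y c (a + 1) else 0) - (if e = a + 1 then y c (a + 2) else 0)
  have hk : ∀ a c e, k a c e ∈ coeffAlgebra := by
    intro a c e
    refine sub_mem ?_ ?_ <;> split_ifs <;> first | exact hy _ _ | exact zero_mem _
  have hu : ∀ i j, i ≠ j → ∀ a c, u i a * u j c = ∑ e, k a c e i * w (-(i + j)) e := by
    intro i j hij a c
    rw [h i j hij]
    simp [k, sub_mul, Finset.sum_sub_distrib, ite_apply, ite_mul]
  refine ⟨fun t => k r.1 s.1 t.1 * k r.2 s.2 t.2, fun t => mul_mem (hk _ _ _) (hk _ _ _),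
    fun i j hij => ?_⟩
  rw [mul_mul_mul_comm, hu i j hij, hu i j hij, Finset.sum_mul_sum, Fintype.sum_prod_type]
  refine Finset.sum_congr rfl fun e _ => Finset.sum_congr rfl fun f _ => ?_
  exact mul_mul_mul_comm _ _ _ _

theorem isPowerSumSystem : IsPowerSumSystem basicInvariants coeffAlgebra uSq wSq where
  one_sum_mem r := ⟨sum_uSq_mem r, sum_wSq_mem r⟩
  coeff_sum_mem _ := sum_mem_basicInvariants
  sum_mul_mem _ := sum_mul_uSq_mem
  sum_mul_mem' _ := sum_mul_wSq_mem
  prod_mem_coeff r s := by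
    have : uSq r * wSq s = uwCoeff r.1 s.1 * uwCoeff r.2 s.2 := by
      ext1 i
      rw [Pi.mul_apply, Pi.mul_apply, ← uFun_mul_wFun, ← uFun_mul_wFun]
      exact mul_mul_mul_comm _ _ _ _
    rw [this]
    exact mul_mem (uwCoeff_mem _ _) (uwCoeff_mem _ _)
  mul_eq := exists_mul_eq_sum (y := crossCoeff) crossCoeff_mem fun _ _ => uFun_mul_uFun
  mul_eq' := exists_mul_eq_sum (y := fun c d => -crossCoeff d c)
    (fun c d => neg_mem (crossCoeff_mem d c)) fun _ _ => wFun_mul_wFun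

/-! ### The invariant functions -/

/-- The action of a permutation on functions on the closure of the minimal orbit. -/
def permFunAct (σ : Equiv.Perm (Fin 4)) :
    (minOrbitClosure → ℂ) →ₐ[ℂ] (minOrbitClosure → ℂ) where
  toFun f := fun M => f ⟨permRep σ M, isStable_permRep σ M M.2⟩
  map_one' := rfl
  map_mul' _ _ := rfl
  map_zero' := rfl
  map_add' _ _ := rfl
  commutes' _ := rfl

theorem permFunAct_mul (σ τ : Equiv.Perm (Fin 4)) (f : minOrbitClosure → ℂ) :
    permFunAct σ (permFunAct τ f) = permFunAct (τ * σ) f := by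
  ext M
  change f _ = f _
  congr 2
  rw [map_mul]
  rfl

section
variable (σ : Equiv.Perm (Fin 4))

theorem permFunAct_xFun (a b : Fin 3) : permFunAct σ (xFun a b) = xFun a b := by
  ext M
  exact congrFun (congrFun (xCoord_permRep σ M.1) a) b

theorem permFunAct_lFun (i : Fin 3) : permFunAct σ (lFun i) = lFun (resolvent σ⁻¹ i) := by
  ext M
  exact lamCoord_permRep σ M.1 i

theorem permFunAct_uFun (i a : Fin 3) :
    permFunAct σ (uFun i a) = (pairSign σ⁻¹ i : ℂ) • uFun (resolvent σ⁻¹ i) a := by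
  ext M
  exact congrFun (uCoord_permRep σ M.1 i) a

theorem permFunAct_wFun (i a : Fin 3) :
    permFunAct σ (wFun i a) = (pairSign σ⁻¹ i : ℂ) • wFun (resolvent σ⁻¹ i) a := by
  ext M
  exact congrFun (wCoord_permRep σ M.1 i) a

theorem permFunAct_uSq (r : Fin 3 × Fin 3) (i : Fin 3) :
    permFunAct σ (uSq r i) = uSq r (resolvent σ⁻¹ i) := by
  rw [uSq, map_mul, permFunAct_uFun, permFunAct_uFun, smul_mul_smul_comm, pairSign_mul_self,
    one_smul, uSq]

theorem permFunAct_wSq (r : Fin 3 × Fin 3) (i : Fin 3) :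
    permFunAct σ (wSq r i) = wSq r (resolvent σ⁻¹ i) := by
  rw [wSq, map_mul, permFunAct_wFun, permFunAct_wFun, smul_mul_smul_comm, pairSign_mul_self,
    one_smul, wSq]

theorem permFunAct_basicInvariants {f : minOrbitClosure → ℂ} (hf : f ∈ basicInvariants) :
    permFunAct σ f = f := by
  induction hf using Algebra.adjoin_induction with
  | mem f hf =>
    rcases hf with ⟨r, rfl⟩ | ⟨r, rfl⟩ | ⟨r, rfl⟩
    · exact permFunAct_xFun σ _ _
    · simp only [map_sum, permFunAct_uSq]
      exact sum_resolvent _ _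
    · simp only [map_sum, permFunAct_wSq]
      exact sum_resolvent _ _
  | algebraMap r => exact AlgHom.commutes _ r
  | add f g _ _ hf hg => rw [map_add, hf, hg]
  | mul f g _ _ hf hg => rw [map_mul, hf, hg]

theorem permFunAct_coeffAlgebra {c : Fin 3 → minOrbitClosure → ℂ} (hc : c ∈ coeffAlgebra)
    (i : Fin 3) : permFunAct σ (c i) = c (resolvent σ⁻¹ i) := by
  induction hc using Algebra.adjoin_induction with
  | mem f hf =>
    rcases hf with ⟨b, hb, rfl⟩ | rfl
    · exact permFunAct_basicInvariants σ hb
    · exact permFunAct_lFun σ i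
  | algebraMap r => exact AlgHom.commutes _ r
  | add f g _ _ hf hg => rw [Pi.add_apply, map_add, hf, hg, Pi.add_apply]
  | mul f g _ _ hf hg => rw [Pi.mul_apply, map_mul, hf, hg, Pi.mul_apply]

theorem permFunAct_tripleAlgebra {y : Fin 3 → minOrbitClosure → ℂ}
    (hy : y ∈ tripleAlgebra coeffAlgebra uSq wSq) (i : Fin 3) :
    permFunAct σ (y i) = y (resolvent σ⁻¹ i) := by
  induction hy using Algebra.adjoin_induction with
  | mem f hf =>
    rcases hf with hf | ⟨r, rfl⟩ | ⟨r, rfl⟩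
    · exact permFunAct_coeffAlgebra σ hf i
    · exact permFunAct_uSq σ r i
    · exact permFunAct_wSq σ r i
  | algebraMap r => exact AlgHom.commutes _ r
  | add f g _ _ hf hg => rw [Pi.add_apply, map_add, hf, hg, Pi.add_apply]
  | mul f g _ _ hf hg => rw [Pi.mul_apply, map_mul, hf, hg, Pi.mul_apply]

end

/-- The algebra generated by the components of the triples, that is, by the basic invariants, the
coordinates `λ`, and the products `u i a * u i b` and `w i a * w i b`. -/
def evenAlgebra : Subalgebra ℂ (minOrbitClosure → ℂ) :=
  Algebra.adjoin ℂ {f | ∃ y ∈ tripleAlgebra coeffAlgebra uSq wSq, ∃ i, f = y i}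

theorem mem_evenAlgebra {y : Fin 3 → minOrbitClosure → ℂ}
    (hy : y ∈ tripleAlgebra coeffAlgebra uSq wSq) (i : Fin 3) : y i ∈ evenAlgebra :=
  Algebra.subset_adjoin ⟨y, hy, i, rfl⟩

theorem mem_evenAlgebra_of_mem_coeffAlgebra {c : Fin 3 → minOrbitClosure → ℂ}
    (hc : c ∈ coeffAlgebra) (i : Fin 3) : c i ∈ evenAlgebra :=
  mem_evenAlgebra (Algebra.subset_adjoin (.inl hc)) i

/-- The kernel of `𝔖₄ → 𝔖₃` fixes the even functions. -/
theorem permFunAct_evenAlgebra {σ : Equiv.Perm (Fin 4)} (hσ : ∀ i, resolvent σ⁻¹ i = i)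
    {f : minOrbitClosure → ℂ} (hf : f ∈ evenAlgebra) : permFunAct σ f = f := by
  induction hf using Algebra.adjoin_induction with
  | mem f hf =>
    obtain ⟨y, hy, i, rfl⟩ := hf
    rw [permFunAct_tripleAlgebra σ hy, hσ]
  | algebraMap r => exact AlgHom.commutes _ r
  | add f g _ _ hf hg => rw [map_add, hf, hg]
  | mul f g _ _ hf hg => rw [map_mul, hf, hg]

theorem isCrossSystem : IsCrossSystem evenAlgebra uFun wFun where
  sq_mem i a b := mem_evenAlgebra (y := uSq (a, b))
    (Algebra.subset_adjoin (.inr (.inl ⟨(a, b), rfl⟩))) i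
  sq_mem' i a b := mem_evenAlgebra (y := wSq (a, b))
    (Algebra.subset_adjoin (.inr (.inr ⟨(a, b), rfl⟩))) i
  mul_eq i j hij a b := ⟨_, mem_evenAlgebra_of_mem_coeffAlgebra (crossCoeff_mem b (a + 1)) i, _,
    neg_mem (mem_evenAlgebra_of_mem_coeffAlgebra (crossCoeff_mem b (a + 2)) i), by
      rw [uFun_mul_uFun hij, neg_mul, sub_eq_add_neg]⟩
  mul_eq' i j hij a b := ⟨_, neg_mem
    (mem_evenAlgebra_of_mem_coeffAlgebra (crossCoeff_mem (a + 1) b) i), _,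
    mem_evenAlgebra_of_mem_coeffAlgebra (crossCoeff_mem (a + 2) b) i, by
      rw [wFun_mul_wFun hij, neg_mul (crossCoeff (a + 2) b i), sub_neg_eq_add]⟩

/-- Every linear form on `so₈` is a combination of the coordinate forms. -/
theorem dual_so8_eq (φ : so8 →ₗ[ℂ] ℂ) : ∃ (p : Fin 3 → Fin 3 → ℂ) (q : Fin 3 → ℂ)
    (r s : Fin 3 → Fin 3 → ℂ), ∀ M, φ M = (∑ a, ∑ b, p a b * xCoord M a b) +
      (∑ i, q i * lamCoord M i) + (∑ i, ∑ a, r i a * uCoord i M a) +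
      ∑ i, ∑ a, s i a * wCoord i M a := by
  let e : so8 →ₗ[ℂ] Matrix (Fin 3) (Fin 3) ℂ × (Fin 3 → ℂ) × (Fin 3 → Fin 3 → ℂ) ×
      (Fin 3 → Fin 3 → ℂ) :=
    xCoord.prod (lamCoord.prod ((LinearMap.pi uCoord).prod (LinearMap.pi wCoord)))
  have he : LinearMap.ker e = ⊥ := LinearMap.ker_eq_bot.2 fun M N h => by
    replace h : (xCoord M, lamCoord M, (fun i => uCoord i M), fun i => wCoord i M) =
      (xCoord N, lamCoord N, (fun i => uCoord i N), fun i => wCoord i N) := h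
    simp only [Prod.mk.injEq] at h
    exact ext_coord h.1 h.2.1 (fun i => congrFun h.2.2.1 i) fun i => congrFun h.2.2.2 i
  obtain ⟨d, hd⟩ := e.exists_leftInverse_of_injective he
  have hpi : ∀ (ψ : (Fin 3 → Fin 3 → ℂ) →ₗ[ℂ] ℂ), ∃ p : Fin 3 → Fin 3 → ℂ,
      ∀ v, ψ v = ∑ a, ∑ b, p a b * v a b := by
    intro ψ
    refine ⟨fun a b => ψ (Pi.single a (Pi.single b 1)), fun v => ?_⟩
    conv_lhs => rw [← Finset.univ_sum_single v]
    rw [map_sum]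
    refine Finset.sum_congr rfl fun a _ => ?_
    have h1 : Pi.single a (v a) =
        ∑ b, v a b • (Pi.single a (Pi.single b 1) : Fin 3 → Fin 3 → ℂ) := by
      ext c b
      by_cases hc : c = a
      · subst hc
        simp [Finset.sum_apply, Pi.single_apply]
      · simp [Finset.sum_apply, Pi.single_eq_of_ne hc]
    rw [h1, map_sum]
    exact Finset.sum_congr rfl fun b _ => by rw [map_smul, smul_eq_mul, mul_comm]
  obtain ⟨p, hp⟩ := hpi (φ ∘ₗ d ∘ₗ LinearMap.inl ℂ _ _)
  obtain ⟨r, hr⟩ := hpi (φ ∘ₗ d ∘ₗ LinearMap.inr ℂ _ _ ∘ₗ LinearMap.inr ℂ _ _ ∘ₗ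
    LinearMap.inl ℂ _ _)
  obtain ⟨s, hs⟩ := hpi (φ ∘ₗ d ∘ₗ LinearMap.inr ℂ _ _ ∘ₗ LinearMap.inr ℂ _ _ ∘ₗ
    LinearMap.inr ℂ _ _)
  have hq' : ∀ ψ : (Fin 3 → ℂ) →ₗ[ℂ] ℂ, ∃ q : Fin 3 → ℂ, ∀ v, ψ v = ∑ i, q i * v i := fun ψ =>
    ⟨fun i => ψ fun j => if i = j then 1 else 0, fun v => (ψ.pi_apply_eq_sum_univ v).trans
      (Finset.sum_congr rfl fun i _ => mul_comm _ _)⟩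
  obtain ⟨q, hq⟩ := hq' (φ ∘ₗ d ∘ₗ LinearMap.inr ℂ _ _ ∘ₗ LinearMap.inl ℂ _ _)
  refine ⟨p, q, r, s, fun M => ?_⟩
  · have h1 : φ M = φ (d (e M)) := congrArg φ (LinearMap.congr_fun hd M).symm
    have h2 : e M = LinearMap.inl ℂ _ _ (xCoord M) +
        (LinearMap.inr ℂ _ _ (LinearMap.inl ℂ _ _ (lamCoord M)) +
        (LinearMap.inr ℂ _ _ (LinearMap.inr ℂ _ _ (LinearMap.inl ℂ _ _ fun i => uCoord i M)) +
        LinearMap.inr ℂ _ _ (LinearMap.inr ℂ _ _ (LinearMap.inr ℂ _ _ fun i => wCoord i M)))) := by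
      change (xCoord M, lamCoord M, (fun i => uCoord i M), fun i => wCoord i M) = _
      simp
    rw [h1, h2, map_add, map_add, map_add, map_add, map_add, map_add, ← add_assoc, ← add_assoc]
    exact congrArg₂ (· + ·) (congrArg₂ (· + ·) (congrArg₂ (· + ·) (hp _) (hq _)) (hr _)) (hs _)

/-- Every polynomial function on the closure of the minimal orbit is a combination of products of
at most one coordinate `u` and one coordinate `w`, with even coefficients. -/
theorem coordRing_subset_crossSpan {f : minOrbitClosure → ℂ} (hf : f ∈ coordRing minOrbitClosure) :
    f ∈ crossSpan evenAlgebra uFun wFun := by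
  obtain ⟨f, hf, rfl⟩ := hf
  let N : Submodule ℂ (so8 → ℂ) :=
    ((crossSpan evenAlgebra uFun wFun).restrictScalars ℂ).comap
      (restrictFun minOrbitClosure).toLinearMap
  refine adjoin_induction_left (N := N) one_mem_crossSpan ?_ hf
  rintro _ ⟨φ, rfl⟩ g hg
  change restrictFun minOrbitClosure g ∈ crossSpan evenAlgebra uFun wFun at hg
  change restrictFun minOrbitClosure (φ * g) ∈ crossSpan evenAlgebra uFun wFun
  obtain ⟨p, q, r, s, h⟩ := dual_so8_eq φ
  have h1 : restrictFun minOrbitClosure φ = (∑ a, ∑ b, p a b • xFun a b) +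
      (∑ i, q i • lFun i) + (∑ i, ∑ a, r i a • uFun i a) + ∑ i, ∑ a, s i a • wFun i a := by
    ext M
    refine (h M.1).trans ?_
    simp [xFun, lFun, uFun, wFun, Finset.sum_apply]
  have hs : ∀ (c : ℂ) {f : minOrbitClosure → ℂ}, f ∈ crossSpan evenAlgebra uFun wFun →
      c • f ∈ crossSpan evenAlgebra uFun wFun := fun c f hf =>
    ((crossSpan evenAlgebra uFun wFun).restrictScalars ℂ).smul_mem c hf
  rw [map_mul, h1]
  simp only [add_mul, Finset.sum_mul, smul_mul_assoc]
  refine add_mem (add_mem (add_mem ?_ ?_) ?_) ?_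
  · exact sum_mem fun a _ => sum_mem fun b _ => hs _ (mul_mem_crossSpan
      (mem_evenAlgebra_of_mem_coeffAlgebra (const_mem_coeffAlgebra (xFun_mem a b)) 0) hg)
  · exact sum_mem fun i _ => hs _ (mul_mem_crossSpan
      (mem_evenAlgebra_of_mem_coeffAlgebra lFun_mem_coeffAlgebra i) hg)
  · exact sum_mem fun i _ => sum_mem fun a _ => hs _ (isCrossSystem.fst_mul_mem i a hg)
  · exact sum_mem fun i _ => sum_mem fun a _ => hs _ (isCrossSystem.snd_mul_mem i a hg)

/-- The sum of the transforms of a function by all permutations. -/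
def symmetrize : (minOrbitClosure → ℂ) →ₗ[ℂ] (minOrbitClosure → ℂ) :=
  ∑ σ, (permFunAct σ).toLinearMap

theorem symmetrize_apply (f : minOrbitClosure → ℂ) : symmetrize f = ∑ σ, permFunAct σ f := by
  simp [symmetrize]

theorem symmetrize_permFunAct (τ : Equiv.Perm (Fin 4)) (f : minOrbitClosure → ℂ) :
    symmetrize (permFunAct τ f) = symmetrize f := by
  simp only [symmetrize_apply, permFunAct_mul]
  exact Equiv.sum_comp (Equiv.mulLeft τ) fun σ => permFunAct σ f

theorem symmetrize_eq_zero {τ : Equiv.Perm (Fin 4)} {f : minOrbitClosure → ℂ}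
    (h : permFunAct τ f = -f) : symmetrize f = 0 := by
  have := symmetrize_permFunAct τ f
  rw [h, map_neg] at this
  exact self_eq_neg.1 this.symm

/-- The symmetrisation of a product of components of triples is a polynomial in power sums. -/
theorem symmetrize_mem_of_mem_evenAlgebra {f : minOrbitClosure → ℂ} (hf : f ∈ evenAlgebra) :
    symmetrize f ∈ basicInvariants := by
  have h {y} := isPowerSumSystem.sum_mem_of_mem_tripleAlgebra (y := y)
  suffices H : componentSpan (tripleAlgebra coeffAlgebra uSq wSq) ≤
      (Subalgebra.toSubmodule basicInvariants).comap symmetrize from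
    H (adjoin_le_componentSpan hf)
  refine Submodule.span_le.2 ?_
  rintro _ ⟨y, hy, y', hy', y'', hy'', rfl⟩
  change symmetrize _ ∈ basicInvariants
  rw [symmetrize_apply]
  simp only [map_mul, permFunAct_tripleAlgebra _ hy, permFunAct_tripleAlgebra _ hy',
    permFunAct_tripleAlgebra _ hy'']
  rw [sum_perm_mul]
  exact mul_mem (natCast_mem _ 4) (add_mem (sub_mem (sub_mem (sub_mem
    (mul_mem (mul_mem (h hy) (h hy')) (h hy'')) (mul_mem (h (mul_mem hy hy')) (h hy'')))
    (mul_mem (h (mul_mem hy hy'')) (h hy'))) (mul_mem (h (mul_mem hy' hy'')) (h hy)))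
    (mul_mem (natCast_mem _ 2) (h (mul_mem (mul_mem hy hy') hy''))))

theorem exists_pairSign : ∀ i : Fin 3, ∃ τ : Equiv.Perm (Fin 4),
    (∀ k, resolvent τ⁻¹ k = k) ∧ pairSign τ⁻¹ i = -1 := by
  decide +kernel

theorem exists_pairSign_mul : ∀ i j : Fin 3, i ≠ j → ∃ τ : Equiv.Perm (Fin 4),
    (∀ k, resolvent τ⁻¹ k = k) ∧ pairSign τ⁻¹ i * pairSign τ⁻¹ j = -1 := by
  decide +kernel

/-- Symmetrisation kills the functions whose sign is changed by one of the permutations that fix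
all partitions into pairs, and maps the others to basic invariants. -/
theorem symmetrize_mem {f : minOrbitClosure → ℂ} (hf : f ∈ coordRing minOrbitClosure) :
    symmetrize f ∈ basicInvariants := by
  have key : ∀ g ∈ crossSpan evenAlgebra uFun wFun, ∀ a ∈ evenAlgebra,
      symmetrize (a * g) ∈ basicInvariants := by
    intro g hg
    induction hg using Submodule.span_induction with
    | zero => intro a _; rw [mul_zero, map_zero]; exact zero_mem _
    | add f g _ _ hf hg => intro a ha; rw [mul_add, map_add]; exact add_mem (hf a ha) (hg a ha)
    | smul r f _ hf =>
      intro a ha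
      have : a * r • f = (a * r.1) * f := (mul_assoc a r.1 f).symm
      rw [this]
      exact hf _ (mul_mem ha r.2)
    | mem g hg =>
      intro a ha
      rcases hg with rfl | ⟨i, b, rfl | rfl⟩ | ⟨i, b, j, c, rfl⟩
      · rw [mul_one]
        exact symmetrize_mem_of_mem_evenAlgebra ha
      · obtain ⟨τ, h1, h2⟩ := exists_pairSign i
        rw [symmetrize_eq_zero (τ := τ)]
        · exact zero_mem _
        · rw [map_mul, permFunAct_evenAlgebra h1 ha, permFunAct_uFun, h1, h2]
          simp
      · obtain ⟨τ, h1, h2⟩ := exists_pairSign i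
        rw [symmetrize_eq_zero (τ := τ)]
        · exact zero_mem _
        · rw [map_mul, permFunAct_evenAlgebra h1 ha, permFunAct_wFun, h1, h2]
          simp
      · by_cases hij : i = j
        · subst hij
          rw [uFun_mul_wFun]
          exact symmetrize_mem_of_mem_evenAlgebra
            (mul_mem ha (mem_evenAlgebra_of_mem_coeffAlgebra (uwCoeff_mem b c) i))
        · obtain ⟨τ, h1, h2⟩ := exists_pairSign_mul i j hij
          rw [symmetrize_eq_zero (τ := τ)]
          · exact zero_mem _
          · have h3 : (pairSign τ⁻¹ i : ℂ) * pairSign τ⁻¹ j = -1 := by exact_mod_cast h2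
            rw [map_mul, permFunAct_evenAlgebra h1 ha, map_mul, permFunAct_uFun, permFunAct_wFun,
              h1, h1, smul_mul_smul_comm, h3]
            simp
  simpa using key f (coordRing_subset_crossSpan hf) 1 (one_mem _)

theorem basicInvariants_le_coordRing : basicInvariants ≤ coordRing minOrbitClosure := by
  refine Algebra.adjoin_le ?_
  rintro _ (⟨r, rfl⟩ | ⟨r, rfl⟩ | ⟨r, rfl⟩)
  · exact ⟨_, xCoord_mem_polyFun r.1 r.2, rfl⟩
  · exact sum_mem fun i _ =>
      ⟨_, mul_mem (uCoord_mem_polyFun i r.1) (uCoord_mem_polyFun i r.2), rfl⟩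
  · exact sum_mem fun i _ =>
      ⟨_, mul_mem (wCoord_mem_polyFun i r.1) (wCoord_mem_polyFun i r.2), rfl⟩

/-- The basic invariants are all invariants. -/
theorem invariantRing_eq (hstab : IsStable permRep minOrbitClosure) :
    invariantRing permRep minOrbitClosure hstab = basicInvariants := by
  apply le_antisymm
  · rintro f ⟨hf, h⟩
    have h1 : f = (1 / 24 : ℂ) • symmetrize f := by
      have h2 : ∀ σ, permFunAct σ f = f := fun σ => funext fun M => h σ M
      simp only [symmetrize_apply, h2, Finset.sum_const, Finset.card_univ, Fintype.card_perm,
        Fintype.card_fin]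
      rw [← Nat.cast_smul_eq_nsmul ℂ, smul_smul]
      norm_num [Nat.factorial]
    rw [h1]
    exact Subalgebra.smul_mem _ (symmetrize_mem hf) _
  · exact fun f hf => ⟨basicInvariants_le_coordRing hf, fun σ M =>
      congrFun (permFunAct_basicInvariants σ hf) M⟩

/-! ### The quotient map -/

/-- A row vector as a linear form. -/
def rowForm : (Fin 3 → ℂ) →ₗ[ℂ] Module.Dual ℂ V where
  toFun w :=
    { toFun := fun v => w ⬝ᵥ v
      map_add' := fun _ _ => dotProduct_add _ _ _
      map_smul' := fun _ _ => dotProduct_smul _ _ _ }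
  map_add' w w' := LinearMap.ext fun v => add_dotProduct w w' v
  map_smul' c w := LinearMap.ext fun v => smul_dotProduct c w v

theorem rowForm_apply (w : Fin 3 → ℂ) (v : V) : rowForm w v = w ⬝ᵥ v := rfl

theorem rowForm_inv (g : Matrix.SpecialLinearGroup (Fin 3) ℂ) (i : Fin 3) :
    rowForm ((g⁻¹).1 i) = chig g i := rfl

theorem tsq_smul {M : Type} [AddCommGroup M] [Module ℂ M] (c : ℂ) (m : M) :
    tsq (c • m) = c ^ 2 • tsq m := by
  apply Subtype.ext
  change (c • m) ⊗ₜ[ℂ] (c • m) = c ^ 2 • (m ⊗ₜ[ℂ] m)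
  rw [TensorProduct.smul_tmul_smul, sq]

/-- The target of `ψ`. -/
abbrev Target : Type :=
  LieAlgebra.SpecialLinear.sl (Fin 3) ℂ × symSq V × symSq (Module.Dual ℂ V)

/-- The polynomial map `so₈ → sl₃ ⊕ S²V ⊕ S²V^*` that restricts to the quotient map of the
closure of the minimal orbit. -/
def quotMap (M : so8) : Target :=
  (⟨xCoord M, trace_xCoord M⟩, ∑ i, tsq (uCoord i M), ∑ i, tsq (rowForm (wCoord i M)))

/-- The morphism `ψ` factors through the parametrisation of the minimal orbit. -/
theorem quotMap_phi (g : Matrix.SpecialLinearGroup (Fin 3) ℂ) (z : zl) :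
    quotMap (phi g z) = psi (g, z) := by
  refine Prod.ext (Subtype.ext (xCoord_phi g z)) (Prod.ext ?_ ?_)
  · simp only [quotMap, psi, uCoord_phi, tsq_smul]
  · simp only [quotMap, psi, wCoord_phi, map_smul, tsq_smul, rowForm_inv]

/-- Pullback of functions along the quotient map. -/
def quotPullback : (Target → ℂ) →ₐ[ℂ] (minOrbitClosure → ℂ) where
  toFun f := fun M => f (quotMap M)
  map_one' := rfl
  map_mul' _ _ := rfl
  map_zero' := rfl
  map_add' _ _ := rfl
  commutes' _ := rfl

/-- A linear form on symmetric tensors is a quadratic form on the squares of vectors. -/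
theorem tsq_sum_eq {M : Type} [AddCommGroup M] [Module ℂ M] (φ : symSq M →ₗ[ℂ] ℂ)
    (T : (Fin 3 → ℂ) →ₗ[ℂ] M) : ∃ p : Fin 3 × Fin 3 → ℂ, ∀ v : Fin 3 → ℂ,
      φ (tsq (T v)) = ∑ r, p r * (v r.1 * v r.2) := by
  obtain ⟨φ', hφ⟩ := φ.exists_extend
  refine ⟨fun r => φ' (T (fun b => if r.1 = b then 1 else 0) ⊗ₜ
    T (fun b => if r.2 = b then 1 else 0)), fun v => ?_⟩
  have h : φ (tsq (T v)) = φ' (T v ⊗ₜ T v) := (LinearMap.congr_fun hφ (tsq (T v))).symm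
  have hv : T v = ∑ a, v a • T (fun b => if a = b then 1 else 0) := T.pi_apply_eq_sum_univ v
  rw [h]
  conv_lhs => rw [hv]
  rw [TensorProduct.sum_tmul, map_sum, Fintype.sum_prod_type]
  refine Finset.sum_congr rfl fun a _ => ?_
  rw [TensorProduct.tmul_sum, map_sum]
  refine Finset.sum_congr rfl fun b _ => ?_
  rw [TensorProduct.smul_tmul_smul, map_smul, smul_eq_mul, mul_comm]

theorem quotPullback_dual_mem (φ : Target →ₗ[ℂ] ℂ) : quotPullback φ ∈ basicInvariants := by
  obtain ⟨φ₁, h₁⟩ := (φ ∘ₗ LinearMap.inl ℂ _ _).exists_extend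
    (p := (LieAlgebra.SpecialLinear.sl (Fin 3) ℂ).toSubmodule)
  obtain ⟨p, hp⟩ := tsq_sum_eq (φ ∘ₗ LinearMap.inr ℂ _ _ ∘ₗ LinearMap.inl ℂ _ _) LinearMap.id
  obtain ⟨q, hq⟩ := tsq_sum_eq (φ ∘ₗ LinearMap.inr ℂ _ _ ∘ₗ LinearMap.inr ℂ _ _) rowForm
  have e : quotPullback φ = (∑ a, ∑ b, φ₁ (Matrix.single a b 1) • xFun a b) +
      (∑ r, p r • ∑ i, uSq r i) + ∑ r, q r • ∑ i, wSq r i := by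
    ext M
    have h : quotMap M.1 = LinearMap.inl ℂ _ _ ⟨xCoord M.1, trace_xCoord M.1⟩ +
        LinearMap.inr ℂ _ _ (LinearMap.inl ℂ _ _ (∑ i, tsq (uCoord i M.1))) +
        LinearMap.inr ℂ _ _ (LinearMap.inr ℂ _ _ (∑ i, tsq (rowForm (wCoord i M.1)))) := by
      simp only [quotMap, LinearMap.inl_apply, LinearMap.inr_apply, Prod.mk_add_mk, add_zero,
        zero_add]
    change φ (quotMap M.1) = _
    rw [h, map_add, map_add]
    simp only [Pi.add_apply]
    refine congrArg₂ (· + ·) (congrArg₂ (· + ·) ?_ ?_) ?_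
    · refine (LinearMap.congr_fun h₁ ⟨xCoord M.1, trace_xCoord M.1⟩).symm.trans ?_
      change φ₁ (xCoord M.1) = _
      conv_lhs => rw [Matrix.matrix_eq_sum_single (xCoord M.1)]
      simp only [map_sum, Finset.sum_apply, Pi.smul_apply, smul_eq_mul]
      refine Finset.sum_congr rfl fun a _ => Finset.sum_congr rfl fun b _ => ?_
      rw [← mul_one (xCoord M.1 a b), ← smul_eq_mul (xCoord M.1 a b), ← Matrix.smul_single,
        map_smul, smul_eq_mul, mul_comm]
      simp [xFun]
    · simp only [map_sum, Finset.sum_apply, Pi.smul_apply, smul_eq_mul]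
      refine (Finset.sum_congr rfl fun i _ => hp (uCoord i M.1)).trans ?_
      rw [Finset.sum_comm]
      simp only [Finset.mul_sum]
      rfl
    · simp only [map_sum, Finset.sum_apply, Pi.smul_apply, smul_eq_mul]
      refine (Finset.sum_congr rfl fun i _ => hq (wCoord i M.1)).trans ?_
      rw [Finset.sum_comm]
      simp only [Finset.mul_sum]
      rfl
  rw [e]
  exact add_mem (add_mem
    (sum_mem fun a _ => sum_mem fun b _ => Subalgebra.smul_mem _ (xFun_mem a b) _)
    (sum_mem fun r _ => Subalgebra.smul_mem _ (sum_uSq_mem r) _))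
    (sum_mem fun r _ => Subalgebra.smul_mem _ (sum_wSq_mem r) _)

/-- A product of two linear forms, as a linear form on symmetric tensors. -/
def mulForm {M : Type} [AddCommGroup M] [Module ℂ M] (φ ψ : M →ₗ[ℂ] ℂ) : symSq M →ₗ[ℂ] ℂ :=
  LinearMap.mul' ℂ ℂ ∘ₗ TensorProduct.map φ ψ ∘ₗ (symSq M).subtype

theorem mulForm_tsq {M : Type} [AddCommGroup M] [Module ℂ M] (φ ψ : M →ₗ[ℂ] ℂ) (m : M) :
    mulForm φ ψ (tsq m) = φ m * ψ m := by
  simp [mulForm, tsq]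

/-- The basic invariants are the pullbacks of the polynomial functions on the target. -/
theorem map_quotPullback : (polyFun Target).map quotPullback = basicInvariants := by
  apply le_antisymm
  · rw [polyFun, AlgHom.map_adjoin]
    refine Algebra.adjoin_le ?_
    rintro _ ⟨_, ⟨φ, rfl⟩, rfl⟩
    exact quotPullback_dual_mem φ
  · refine Algebra.adjoin_le ?_
    rintro _ (⟨⟨a, b⟩, rfl⟩ | ⟨⟨a, b⟩, rfl⟩ | ⟨⟨a, b⟩, rfl⟩)
    · exact ⟨_, dual_mem_polyFun (LinearMap.proj b ∘ₗ LinearMap.proj a ∘ₗ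
        (LieAlgebra.SpecialLinear.sl (Fin 3) ℂ).toSubmodule.subtype ∘ₗ LinearMap.fst ℂ _ _), rfl⟩
    · refine ⟨_, dual_mem_polyFun (mulForm (LinearMap.proj a) (LinearMap.proj b) ∘ₗ
        LinearMap.fst ℂ _ _ ∘ₗ LinearMap.snd ℂ _ _), ?_⟩
      ext M
      change mulForm _ _ (∑ i, tsq (uCoord i M.1)) = _
      simp only [map_sum, mulForm_tsq, Finset.sum_apply]
      rfl
    · refine ⟨_, dual_mem_polyFun (mulForm (LinearMap.applyₗ (Pi.single a 1))
        (LinearMap.applyₗ (Pi.single b 1)) ∘ₗ LinearMap.snd ℂ _ _ ∘ₗ LinearMap.snd ℂ _ _), ?_⟩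
      ext M
      change mulForm _ _ (∑ i, tsq (rowForm (wCoord i M.1))) = _
      simp only [map_sum, mulForm_tsq, Finset.sum_apply, LinearMap.applyₗ_apply_apply,
        rowForm_apply, dotProduct_single_one]
      rfl

/-- A polynomial function on the target vanishes on the image of `ψ` if and only if its pullback
vanishes. -/
theorem quotPullback_eq_zero_iff {f : Target → ℂ} (hf : f ∈ polyFun Target) :
    quotPullback f = 0 ↔ ∀ y ∈ Set.range psi, f y = 0 := by
  constructor
  · rintro h _ ⟨⟨g, z⟩, rfl⟩
    rw [← quotMap_phi]
    exact congrFun h ⟨phi g z, minCone_subset_minOrbitClosure (phi_mem_minCone g z)⟩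
  · intro h
    obtain ⟨F, hF, e⟩ := basicInvariants_le_coordRing
      (map_quotPullback ▸ Subalgebra.mem_map.2 ⟨f, hf, rfl⟩ : quotPullback f ∈ basicInvariants)
    ext M
    rw [← e]
    refine eq_zero_of_forall_phi hF (fun g z => ?_) M.2
    have h1 := congrFun e ⟨phi g z, minCone_subset_minOrbitClosure (phi_mem_minCone g z)⟩
    refine h1.trans ?_
    change f (quotMap (phi g z)) = 0
    rw [quotMap_phi]
    exact h _ ⟨_, rfl⟩

theorem quotMap_mem {M : so8} (hM : M ∈ minOrbitClosure) :
    quotMap M ∈ zariskiClosure (Set.range psi) := fun _ hf h =>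
  congrFun ((quotPullback_eq_zero_iff hf).2 h) ⟨M, hM⟩

/-- Pullback along the quotient map to the closure of the image of `ψ`. -/
def closurePullback : coordRing (zariskiClosure (Set.range psi)) →ₐ[ℂ] (minOrbitClosure → ℂ) :=
  AlgHom.comp
    { toFun := fun f M => f ⟨quotMap M.1, quotMap_mem M.2⟩
      map_one' := rfl
      map_mul' := fun _ _ => rfl
      map_zero' := rfl
      map_add' := fun _ _ => rfl
      commutes' := fun _ => rfl }
    (coordRing (zariskiClosure (Set.range psi))).val

theorem closurePullback_injective : Function.Injective closurePullback := by
  rw [injective_iff_map_eq_zero]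
  rintro ⟨_, f, hf, rfl⟩ h
  have h1 := (quotPullback_eq_zero_iff hf).1 h
  ext y
  exact y.2 f hf h1

theorem range_closurePullback : closurePullback.range = basicInvariants := by
  rw [← map_quotPullback]
  ext F
  constructor
  · rintro ⟨⟨_, f, hf, rfl⟩, rfl⟩
    exact ⟨f, hf, rfl⟩
  · rintro ⟨f, hf, rfl⟩
    exact ⟨⟨_, f, hf, rfl⟩, rfl⟩

/-- The coordinate ring of the closure of the image of `ψ` is the ring of invariants. -/
def coordRingEquiv (hstab : IsStable permRep minOrbitClosure) :
    coordRing (zariskiClosure (Set.range psi)) ≃ₐ[ℂ]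
      invariantRing permRep minOrbitClosure hstab :=
  (AlgEquiv.ofInjective closurePullback closurePullback_injective).trans
    (Subalgebra.equivOfEq _ _ (range_closurePullback.trans (invariantRing_eq hstab).symm))

open CategoryTheory in
/-- Isomorphic algebras have isomorphic spectra. -/
def specOverIso {A A' : Type} [CommRing A] [Algebra ℂ A] [CommRing A'] [Algebra ℂ A']
    (e : A ≃ₐ[ℂ] A') : specOver A' ≅ specOver A :=
  CategoryTheory.Over.isoMk
    (AlgebraicGeometry.Scheme.Spec.mapIso e.toRingEquiv.toCommRingCatIso.op) (by
      change AlgebraicGeometry.Spec.map _ ≫ AlgebraicGeometry.Spec.map _ =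
        AlgebraicGeometry.Spec.map _
      rw [← AlgebraicGeometry.Spec.map_comp]
      congr 1
      ext c
      exact e.commutes c)

end D4ModS4

end

open D4ModS4 in
theorem mainTheorem11 :
    (∃! ρ : Representation ℂ (Equiv.Perm (Fin 4)) D4ModS4.so8,
      D4ModS4.IsAffineDiagramAction ρ) ∧
    ∀ ρ : Representation ℂ (Equiv.Perm (Fin 4)) D4ModS4.so8,
      D4ModS4.IsAffineDiagramAction ρ →
        ∃ hstab : D4ModS4.IsStable ρ D4ModS4.minOrbitClosure,
          Nonempty (D4ModS4.quotientVariety ρ D4ModS4.minOrbitClosure hstab ≅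
            D4ModS4.variety (D4ModS4.zariskiClosure (Set.range D4ModS4.psi))) := by
  refine ⟨⟨permRep, isAffineDiagramAction_permRep, fun ρ h =>
    eq_of_isAffineDiagramAction h isAffineDiagramAction_permRep⟩, fun ρ h => ?_⟩
  obtain rfl := eq_of_isAffineDiagramAction h isAffineDiagramAction_permRep
  exact ⟨isStable_permRep, ⟨specOverIso (coordRingEquiv isStable_permRep)⟩⟩
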